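/- **Theorem 4.** Let $S,E$ be finite-dimensional systems, $|\varphi^0\rangle,|\varphi^1\rangle$ unit vectors of $SE$, and $$|\psi\rangle_{ABSE}=\tfrac1{\sqrt2}\sum_{k\in\{0,1\}}|kk\rangle_{AB}|\varphi^k\rangle_{SE},\qquad A,B\text{ qubits}.$$ Write $|\widetilde x\rangle=(|0\rangle+(-1)^x|1\rangle)/\sqrt2$, extended to bit strings by tensor products, and let $\chi(\mathcal E)=S\big(\tfrac12\sum_x\rho^x\big)-\tfrac12\sum_xS(\rho^x)$ (von Neumann entropies, base $2$) be the Holevo quantity of $\mathcal E=\{\tfrac12,\rho^x_{BS}\}_{x=0,1}$, $\rho^x_{BS}=2\,{}_A\langle\widetilde x|\psi_{ABS}|\widetilde x\rangle_A$; put $\rho=\tfrac12(\rho^0+\rho^1)$. *Protocol* for $n$ copies, with parameters $r\le n$, $m=n-r$, $\delta>0$. Let $u_1,\dots,u_m\in\mathbb F_2^n$ be linearly independent. Choose any linear bijection $c:\mathbb F_2^n\to\mathbb F_2^r\times\mathbb F_2^m$ with $c^{-1}(0,e_i)=u_i$, and decompose Alice's $n$ qubits as $A=A_1A_2$ and Bob's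 as $B=B_1B_2$ by $|k\rangle=|\ell\rangle|\mathbf m\rangle$ for $c(k)=(\ell,\mathbf m)$. Alice measures the observables $X^{u_1},\dots,X^{u_m}$ (i.e. $A_2$ in the $x$-basis) and announces the outcome $h\in\mathbb F_2^m$; this is the linear hash $h_i=u_i\cdot x$ of the outcome $x$ of an $x$-basis measurement of all her qubits. Bob applies $Z^h$ to $B_2$. The result is the normalized vector $|\Psi'\rangle\propto{}_{A_2}\langle\widetilde h|Z^h_{B_2}|\psi\rangle^{\otimes n}$ on $A_1B_1(B_2S^n)E^n$, in which $B_2S^n$ is the shield. With $\varrho^y=2^r\,{}_{A_1}\langle\widetilde y|\Psi'_{A_1BS^n}|\widetilde y\rangle_{A_1}$, let $\Pi^y$ be the projection onto the eigenvectors of $\varrho^y$ with eigenvalues in $[2^{-n(s+\delta)},2^{-n(s-\delta)}]$, $s=\tfrac12\sum_xS(\rho^x)$, let $\Pi$ be the corresponding projection for $\rho^{\otimes n}$ with $s=S(\rho)$, and let $$E^y=T^{-1/2}\,\Pi\Pi^y\Pi\,T^{-1/2},\qquad T=\sum_{y\in\mathbb F_2^r}\Pi\Pi^y\Pi$$ (inverse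 on the support) be Bob's pretty good measurement. An untwisting operator for it is the adjoint of a unitary $U=\sum_{\ell}|\ell\rangle\langle\ell|_{B_1}\otimes V^\ell_{B_2S^n}$ ($V^\ell$ unitary) with $E^y=Q\,U(|\widetilde y\rangle\langle\widetilde y|_{B_1}\otimes 1)U^\dagger Q$ for all $y$, where $Q=\sum_yE^y$. Call $(u_i)$ *$\varepsilon$-good* if for every such $c$ and every announcement $h$: 1. $2^{-r}\sum_y\operatorname{Tr}[\varrho^yE^y]\ge1-\varepsilon$; 2. there are an untwisting operator $U^\dagger$ for $(E^y)$ as above and a unit vector $|\xi\rangle_{(B_2S^n)E^n}$ such that $\big\||\Psi'\rangle\langle\Psi'|-|\gamma\rangle\langle\gamma|\big\|_1\le2\varepsilon$ for the $r$-bit private state $|\gamma\rangle=2^{-r/2}\sum_{k\in\mathbb F_2^r}|kk\rangle_{A_1B_1}V^k|\xi\rangle$; 3. measuring $A_1$ and $B_1$ of $\Psi'$ in the standard basis and discarding the shield gives a state within trace-norm distance $2\varepsilon$ of a perfect secret key $\big(2^{-r}\sum_k|k\rangle\langle k|\otimes|k\rangle\langle k|\big)\otimes\rho_{E}$ for some density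 operator $\rho_E$ of $E^n$. *Claim.* There are integers $0\le r_n\le n$ with $r_n/n\to\chi(\mathcal E)$, and $\delta_n>0$, $\varepsilon_n$ with $\delta_n\to0$, $\varepsilon_n\to0$, such that for every $n$, when $(u_1,\dots,u_{n-r_n})$ is chosen uniformly among the linearly independent families in $\mathbb F_2^n$, it is $\varepsilon_n$-good (with $r=r_n$, $\delta=\delta_n$) with probability at least $1-\varepsilon_n$. -/

import Mathlib

open scoped Matrix Kronecker ComplexOrder

noncomputable section

namespace PrivateState

/-- Bit strings of length `n`, as vectors over the field with two elements. -/
abbrev Bits (n : ℕ) : Type := Fin n → ZMod 2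

/-! ### Finite-dimensional quantum states

A vector of the Hilbert space with orthonormal basis `ι` is a function `ι → ℂ`; an operator is a
complex matrix indexed by `ι`. Registers are combined by products of index types. Functions of a
Hermitian matrix are taken by the functional calculus `cfc`. -/

section Basic

variable {ι : Type*} [Fintype ι]

/-- `v` is a normalized vector. -/
def IsNormalized (v : ι → ℂ) : Prop := ∑ i, ‖v i‖ ^ 2 = 1

/-- The normalized vector proportional to `v` (for `v ≠ 0`). -/
def normalize (v : ι → ℂ) : ι → ℂ := fun i => ((√(∑ j, ‖v j‖ ^ 2))⁻¹ : ℝ) * v i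

/-- The rank-one operator `|v⟩⟨v|`. -/
def proj (v : ι → ℂ) : Matrix ι ι ℂ := Matrix.vecMulVec v (star v)

variable [DecidableEq ι]

/-- Trace norm `Tr √(A† A)`. -/
def traceNorm (A : Matrix ι ι ℂ) : ℝ := (cfc Real.sqrt (Aᴴ * A)).trace.re

/-- Von Neumann entropy `-Tr ρ log₂ ρ`, in bits. -/
def entropy (ρ : Matrix ι ι ℂ) : ℝ := (cfc Real.negMulLog ρ).trace.re / Real.log 2

/-- Holevo quantity of the ensemble `{1/2, ρ^x}` of two equally likely states. -/
def holevo (ρ : ZMod 2 → Matrix ι ι ℂ) : ℝ :=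
  entropy ((1 / 2 : ℂ) • ∑ x, ρ x) - 1 / 2 * ∑ x, entropy (ρ x)

/-- Projection onto the typical subspace of a state `σ` of `n` systems with entropy `s` per system:
the span of the eigenvectors of `σ` with eigenvalue between `2^(-n(s+δ))` and `2^(-n(s-δ))`. -/
def typicalProj (n : ℕ) (s δ : ℝ) (σ : Matrix ι ι ℂ) : Matrix ι ι ℂ :=
  open Classical in
  cfc (fun t : ℝ =>
    if (2 : ℝ) ^ (-(n * (s + δ))) ≤ t ∧ t ≤ (2 : ℝ) ^ (-(n * (s - δ))) then 1 else 0) σ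

/-- The square root of the pseudo-inverse of a positive semidefinite matrix
(`0⁻¹ = 0`, so that the kernel is mapped to zero). -/
def invSqrt (T : Matrix ι ι ℂ) : Matrix ι ι ℂ := cfc (fun t : ℝ => (√t)⁻¹) T

/-- Pretty good measurement of a finite family `Λ` of positive operators:
`E^y = T^{-1/2} Λ^y T^{-1/2}` with `T = ∑ Λ^y`. -/
def prettyGood {Y : Type*} [Fintype Y] (Λ : Y → Matrix ι ι ℂ) (y : Y) : Matrix ι ι ℂ :=
  invSqrt (∑ y', Λ y') * Λ y * invSqrt (∑ y', Λ y')

end Basic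

/-- For a vector `Ψ` on registers `A`, `B`, `S`, `E` and a vector `f` on `A`, the (unnormalized)
operator `⟨f|_A Ψ_{ABS} |f⟩_A` on `BS`, where `Ψ_{ABS} = Tr_E |Ψ⟩⟨Ψ|`. -/
def condState {A B S E : Type*} [Fintype A] [Fintype E] (f : A → ℂ) (Ψ : A × B × S × E → ℂ) :
    Matrix (B × S) (B × S) ℂ :=
  Matrix.of fun p q => ∑ a, ∑ a', ∑ e,
    star (f a) * (Ψ (a, p.1, p.2, e) * star (Ψ (a', q.1, q.2, e))) * f a'

/-! ### Conjugate bases -/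

/-- Amplitude of `|a⟩` in the `x`-basis state `|x̃⟩ = (|0⟩ + (-1)^x |1⟩)/√2` of a qubit. -/
def xKetBit (x a : ZMod 2) : ℂ := (-1) ^ (x * a).val / (√2 : ℝ)

/-- The `x`-basis state `|x̃⟩` of `n` qubits, for a string `x`. -/
def xKet {n : ℕ} (x : Bits n) : Bits n → ℂ := fun a => ∏ i, xKetBit (x i) (a i)

/-- Eigenvalue `(-1)^(x·b)` of `Z^x` on `|b⟩`. -/
def zPhase {n : ℕ} (x b : Bits n) : ℂ := ∏ i, (-1) ^ (x i * b i).val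

/-! ### The input -/

section Input

variable {S E : Type*} [Fintype S] [DecidableEq S] [Fintype E] [DecidableEq E]

/-- `|ψ⟩_{ABSE} = (1/√2) ∑_k |kk⟩_{AB} |φ^k⟩_{SE}`. -/
def inputState (φ : ZMod 2 → S × E → ℂ) : ZMod 2 × ZMod 2 × S × E → ℂ := fun p =>
  if p.1 = p.2.1 then φ p.1 p.2.2 / (√2 : ℝ) else 0

/-- `|Ψ⟩_{ABSE} = |ψ⟩^{⊗n}`. -/
def inputPow (φ : ZMod 2 → S × E → ℂ) (n : ℕ) :
    Bits n × Bits n × (Fin n → S) × (Fin n → E) → ℂ := fun p =>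
  ∏ i, inputState φ (p.1 i, p.2.1 i, p.2.2.1 i, p.2.2.2 i)

/-- `ρ^x_{BS} = 2 ⟨x̃|_A ψ_{ABS} |x̃⟩_A`: the state of `BS` given the outcome `x` of a measurement
of `A` in the `x`-basis. -/
def ensemble (φ : ZMod 2 → S × E → ℂ) (x : ZMod 2) : Matrix (ZMod 2 × S) (ZMod 2 × S) ℂ :=
  (2 : ℂ) • condState (xKetBit x) (inputState φ)

/-- The average state `ρ_{BS}` of the ensemble. -/
def avgState (φ : ZMod 2 → S × E → ℂ) : Matrix (ZMod 2 × S) (ZMod 2 × S) ℂ :=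
  (1 / 2 : ℂ) • ∑ x, ensemble φ x

/-! ### The protocol

A linear bijection `c : F₂^n ≃ F₂^r × F₂^m` decomposes the `n` qubits of Alice (and likewise those of
Bob) into encoded qubits: `|k⟩ = |ℓ⟩_{A₁} |m⟩_{A₂}` for `c k = (ℓ, m)`. A shift of the `i`-th bit of
`A₂` shifts `k` by `u_i = c⁻¹(0, e_i)`, so that the Pauli operator `X` of the `i`-th qubit of `A₂` is
`X^{u_i}`, and measuring `A₂` in the `x`-basis gives `h_i = u_i · x`, where `x` is the outcome of
an `x`-basis measurement of all of Alice's qubits. The key bits are `ℓ_j = v_j · k` for vectors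
`v_j` with `u_i · v_j = 0`. -/

variable {n r m : ℕ}

/-- The normalized state of `A₁`, `B₁`, the shield `B₂S`, and `E` after Alice measures the
`X^{u_i}`, announces the outcome `h`, and Bob applies `Z^h` to `B₂`:
`⟨h̃|_{A₂} Z^h_{B₂} |Ψ⟩`. -/
def announced (φ : ZMod 2 → S × E → ℂ) (c : Bits n ≃ₗ[ZMod 2] Bits r × Bits m) (h : Bits m) :
    Bits r × Bits r × (Bits m × (Fin n → S)) × (Fin n → E) → ℂ :=
  normalize fun p =>
    ∑ a₂, star (xKet h a₂) * (zPhase h p.2.2.1.1 *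
      inputPow φ n (c.symm (p.1, a₂), c.symm (p.2.1, p.2.2.1.1), p.2.2.1.2, p.2.2.2))

/-- `ϱ^y_{BS}`: the state of `BS` after the announcement, given that `A₁` is found in `|ỹ⟩`. -/
def codeState (φ : ZMod 2 → S × E → ℂ) (c : Bits n ≃ₗ[ZMod 2] Bits r × Bits m) (h : Bits m)
    (y : Bits r) : Matrix (Bits r × Bits m × (Fin n → S)) (Bits r × Bits m × (Fin n → S)) ℂ :=
  (2 ^ r : ℂ) • condState (xKet y) (announced φ c h)

/-- `ρ_{BS}^{⊗n}`, written in the registers `B₁`, `B₂`, `S`. -/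
def avgPow (φ : ZMod 2 → S × E → ℂ) (c : Bits n ≃ₗ[ZMod 2] Bits r × Bits m) :
    Matrix (Bits r × Bits m × (Fin n → S)) (Bits r × Bits m × (Fin n → S)) ℂ :=
  Matrix.of fun p q => ∏ i, avgState φ (c.symm (p.1, p.2.1) i, p.2.2 i)
    (c.symm (q.1, q.2.1) i, q.2.2 i)

/-- Bob's measurement of `y`: the pretty good measurement of the operators `Π Π^y Π`, where `Π^y`
and `Π` are the typical projections of `ϱ^y` and of the average state. -/
def bobPGM (φ : ZMod 2 → S × E → ℂ) (c : Bits n ≃ₗ[ZMod 2] Bits r × Bits m) (h : Bits m) (δ : ℝ) :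
    Bits r → Matrix (Bits r × Bits m × (Fin n → S)) (Bits r × Bits m × (Fin n → S)) ℂ :=
  prettyGood fun y =>
    typicalProj n (entropy (avgState φ)) δ (avgPow φ c) *
      typicalProj n (1 / 2 * ∑ x, entropy (ensemble φ x)) δ (codeState φ c h y) *
      typicalProj n (entropy (avgState φ)) δ (avgPow φ c)

end Input

/-! ### Private states and secret keys -/

section Private

variable {r : ℕ} {S E : Type*} [Fintype S] [DecidableEq S] [Fintype E] [DecidableEq E]

/-- The twisting operator `U = ∑_ℓ P^ℓ ⊗ V^ℓ` on a key register of `r` qubits and a shield. -/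
def twist (V : Bits r → Matrix S S ℂ) : Matrix (Bits r × S) (Bits r × S) ℂ :=
  Matrix.of fun p q => if p.1 = q.1 then V p.1 p.2 q.2 else 0

/-- `2^(-r/2) ∑_k |kk⟩_{AB} V^k_S |ξ⟩_{SE} = U_{BS} |Φ⟩^{⊗r}_{AB} |ξ⟩_{SE}`, `U = twist V`. For
unitary `V^k` and normalized `ξ` this is the private state of `r` bits. -/
def privateState (V : Bits r → Matrix S S ℂ) (ξ : S × E → ℂ) : Bits r × Bits r × S × E → ℂ :=
  fun p => if p.1 = p.2.1 then
    ((√2 : ℝ)⁻¹ : ℂ) ^ r * ∑ s, V p.1 p.2.2.1 s * ξ (s, p.2.2.2) else 0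

/-- The pure state `Ψ` is `ε`-close, in trace distance, to the private state of `V` and `ξ`. -/
def IsClosePrivate (ε : ℝ) (V : Bits r → Matrix S S ℂ) (ξ : S × E → ℂ)
    (Ψ : Bits r × Bits r × S × E → ℂ) : Prop :=
  traceNorm (proj Ψ - proj (privateState V ξ)) ≤ 2 * ε

/-- The state of `A`, `B`, `E` after standard basis measurements of the key registers `A` and `B`,
the shield being traced out. -/
def measuredKey (Ψ : Bits r × Bits r × S × E → ℂ) :
    Matrix (Bits r × Bits r × E) (Bits r × Bits r × E) ℂ :=
  Matrix.of fun p q => if p.1 = q.1 ∧ p.2.1 = q.2.1 then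
    ∑ s, Ψ (p.1, p.2.1, s, p.2.2) * star (Ψ (q.1, q.2.1, s, q.2.2)) else 0

/-- The perfect secret key of `r` bits, `(2^(-r) ∑_k P^k_A ⊗ P^k_B) ⊗ ρ_E`. -/
def secretKey (r : ℕ) (ρE : Matrix E E ℂ) :
    Matrix (Bits r × Bits r × E) (Bits r × Bits r × E) ℂ :=
  Matrix.of fun p q => if p.1 = q.1 ∧ p.2.1 = q.2.1 ∧ p.1 = p.2.1 then
    (1 / 2 : ℂ) ^ r * ρE p.2.2 q.2.2 else 0

/-- The vector `Ψ` yields, on measurement, an `ε`-private key of `r` bits. -/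
def IsEpsPrivate (ε : ℝ) (Ψ : Bits r × Bits r × S × E → ℂ) : Prop :=
  ∃ ρE : Matrix E E ℂ, ρE.PosSemidef ∧ ρE.trace = 1 ∧
    traceNorm (measuredKey Ψ - secretKey r ρE) ≤ 2 * ε

/-- The twisting operator of `V` turns the measurement `F` of the shielded key register into an
`x`-basis measurement of the key: `F^y = Q U (P^ỹ ⊗ 1) U† Q`, where `Q = ∑ F^y` is the projection
onto the support of the measurement (`Q = 1` if the measurement is complete). -/
def Untwists (V : Bits r → Matrix S S ℂ) (F : Bits r → Matrix (Bits r × S) (Bits r × S) ℂ) : Prop :=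
  (∀ ℓ, V ℓ ∈ Matrix.unitaryGroup S ℂ) ∧
  ∀ y, F y = (∑ y', F y') * twist V * (proj (xKet y) ⊗ₖ (1 : Matrix S S ℂ)) * (twist V)ᴴ *
    (∑ y', F y')

end Private

/-- The hash `x ↦ (u_i · x)_i` is `ε`-good for `n` copies of the input: for every choice of encoded
qubits in which the measured observables are the `X^{u_i}`, and for every announcement `h`,
* Bob's pretty good measurement finds `y` with error probability at most `ε`,
* there is an untwisting operator for this measurement such that the state is `ε`-close, in trace
  distance, to a private state of `r` bits with this twisting operator, and
* the key obtained by measuring is `ε`-private. -/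
def GoodHash {S E : Type*} [Fintype S] [DecidableEq S] [Fintype E] [DecidableEq E]
    (φ : ZMod 2 → S × E → ℂ) {n m : ℕ} (r : ℕ) (δ ε : ℝ) (u : Fin m → Bits n) : Prop :=
  ∀ c : Bits n ≃ₗ[ZMod 2] Bits r × Bits m, (∀ i, c.symm (0, Pi.single i 1) = u i) →
    ∀ h : Bits m,
      1 - ε ≤ (1 / 2 : ℝ) ^ r * ∑ y, (codeState φ c h y * bobPGM φ c h δ y).trace.re ∧
      (∃ (V : Bits r → Matrix (Bits m × (Fin n → S)) (Bits m × (Fin n → S)) ℂ)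
        (ξ : (Bits m × (Fin n → S)) × (Fin n → E) → ℂ),
          Untwists V (bobPGM φ c h δ) ∧ IsNormalized ξ ∧
          IsClosePrivate ε V ξ (announced φ c h)) ∧
      IsEpsPrivate ε (announced φ c h)

end PrivateState

end

/-! Alice and Bob agree in the standard basis, so an x-basis outcome of Alice acts on Bob's side as
a power of `Z`. Bob's `Z^h` removes the phases left by the announcement, hence the resulting vector
does not depend on `h` (`announced_eq`). In the original registers `ϱ^y` is `Z^x (ρ^0)^{⊗n} Z^x`
with `x = codeword c y`, which runs through strings orthogonal to all `u_i`. The protocol is thus a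
random linear code for the channel `x ↦ ρ^x`, and the Holevo–Schumacher–Westmoreland argument
applies.

Decoding. `hayashi_nagaoka` bounds the error for `y = 0` by the weight outside the typical
subspaces, which is small by Chebyshev (`exists_typical_bound`), plus the overlaps with the other
codewords; covariance makes this error the average error. Summed over all strings, the overlaps are
at most `2^{n(1-χ+2δ)}` (`sum_overlap_le`), and a nonzero string passes `m = n - r` random
independent checks with probability at most `2^{-m}` (`card_checks_mul_le`). For `r ≤ n(χ-3δ)` the
mean overlap is at most `2^{-nδ}`, and Markov's inequality finishes.

Untwisting. Since `E^y = Z^y E^0 Z^y`, the sum `Q` is block diagonal in the key. If `E^0` has rank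
at most the dimension of the shield, it factors through the shield alone, and the polar parts of the
blocks of this factor are the adjoints of the `V^ℓ` (`exists_untwists`). The rank bound holds below
the Holevo rate because `S(ρ) ≤ log dim BS` (`rank_zeroTypical_le`).

Privacy. With `G = U(|0̃⟩⟨0̃| ⊗ 1)U†`, the private states twisted by `U` are the shared-key vectors
with amplitudes in the range of `G`. As `E^0 = QGQ`, near-certain success puts nearly all weight in
that range, and the normalized projection is a nearby private state (`exists_close_privateState`).
Distance of vectors then controls both trace-norm claims (`exists_proj_sub_proj`). -/

namespace PrivateState

set_option linter.unusedSectionVars false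

/-! ### Functional calculus of matrices -/

section FunctionalCalculus

variable {ι κ : Type*} [Fintype ι] [DecidableEq ι] [Fintype κ] [DecidableEq κ]

/-- On a finite set of prescribed points, and on a given Hermitian matrix, the functional calculus
of `f` is a polynomial. -/
theorem exists_cfc_eq_aeval (f : ℝ → ℝ) (F : Finset ℝ) {A : Matrix ι ι ℂ} (hA : A.IsHermitian) :
    ∃ p : Polynomial ℝ, cfc f A = Polynomial.aeval A p ∧ ∀ t ∈ F, p.eval t = f t := by
  classical
  set G : Finset ℝ := F ∪ (Matrix.finite_real_spectrum (A := A)).toFinset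
  refine ⟨Lagrange.interpolate G id f, ?_, fun t ht => ?_⟩
  · rw [← cfc_polynomial _ A hA]
    refine cfc_congr fun t ht => ?_
    exact (Lagrange.eval_interpolate_at_node (v := id) f (Set.injOn_id _) (by simp [G, ht])).symm
  · exact Lagrange.eval_interpolate_at_node (v := id) f (Set.injOn_id _) (by simp [G, ht])

/-- One polynomial interpolates `f` on both spectra, and algebra homomorphisms commute with
polynomials. No continuity of `f` is needed, which matters for the indicator functions defining
typical projections. -/
theorem cfc_map_algHom (Φ : Matrix ι ι ℂ →ₐ[ℝ] Matrix κ κ ℂ) (f : ℝ → ℝ) {A : Matrix ι ι ℂ}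
    (hA : A.IsHermitian) (hΦ : (Φ A).IsHermitian) : cfc f (Φ A) = Φ (cfc f A) := by
  obtain ⟨p, hp, hpF⟩ := exists_cfc_eq_aeval f
    (Matrix.finite_real_spectrum (A := Φ A)).toFinset hA
  rw [hp, ← Polynomial.aeval_algHom_apply, ← cfc_polynomial p (Φ A) hΦ]
  exact cfc_congr fun t ht => (hpF t (by simpa using ht)).symm

/-- Conjugation by a unitary matrix. -/
noncomputable def unitaryConj (W : Matrix ι ι ℂ) (hW : W ∈ Matrix.unitaryGroup ι ℂ) :
    Matrix ι ι ℂ →ₐ[ℝ] Matrix ι ι ℂ :=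
  ((Unitary.conjStarAlgAut ℝ (Matrix ι ι ℂ) ⟨W, hW⟩ : Matrix ι ι ℂ ≃⋆ₐ[ℝ] Matrix ι ι ℂ) :
    Matrix ι ι ℂ →ₐ[ℝ] Matrix ι ι ℂ)

theorem unitaryConj_apply (W : Matrix ι ι ℂ) (hW : W ∈ Matrix.unitaryGroup ι ℂ)
    (A : Matrix ι ι ℂ) : unitaryConj W hW A = W * A * Wᴴ := rfl

theorem cfc_unitary_conj (f : ℝ → ℝ) {W A : Matrix ι ι ℂ} (hW : W ∈ Matrix.unitaryGroup ι ℂ)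
    (hA : A.IsHermitian) : cfc f (W * A * Wᴴ) = W * cfc f A * Wᴴ := by
  have h := cfc_map_algHom (unitaryConj W hW) f hA
  rw [unitaryConj_apply, unitaryConj_apply] at h
  exact h (Matrix.isHermitian_mul_mul_conjTranspose W hA)

theorem cfc_submatrix (f : ℝ → ℝ) (e : κ ≃ ι) {A : Matrix ι ι ℂ} (hA : A.IsHermitian) :
    cfc f (A.submatrix e e) = (cfc f A).submatrix e e :=
  cfc_map_algHom (Matrix.reindexAlgEquiv ℝ ℂ e.symm : Matrix ι ι ℂ →ₐ[ℝ] Matrix κ κ ℂ) f hA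
    (hA.submatrix e)

/-- The matrix with eigenbasis the columns of `W` and eigenvalues `d`. -/
noncomputable def ofSpectrum (W : Matrix ι ι ℂ) (d : ι → ℝ) : Matrix ι ι ℂ :=
  W * Matrix.diagonal (fun i => (d i : ℂ)) * Wᴴ

theorem isHermitian_ofSpectrum (W : Matrix ι ι ℂ) (d : ι → ℝ) : (ofSpectrum W d).IsHermitian :=
  Matrix.isHermitian_mul_mul_conjTranspose W
    (Matrix.isHermitian_diagonal_iff.2 fun i => by simp [IsSelfAdjoint])

theorem exists_eq_ofSpectrum {A : Matrix ι ι ℂ} (hA : A.IsHermitian) :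
    ∃ W ∈ Matrix.unitaryGroup ι ℂ, ∃ d : ι → ℝ, A = ofSpectrum W d :=
  ⟨hA.eigenvectorUnitary, hA.eigenvectorUnitary.2, hA.eigenvalues, hA.spectral_theorem⟩

theorem posSemidef_ofSpectrum (W : Matrix ι ι ℂ) {d : ι → ℝ} (hd : ∀ i, 0 ≤ d i) :
    (ofSpectrum W d).PosSemidef :=
  (Matrix.PosSemidef.diagonal fun i => by simpa using hd i).mul_mul_conjTranspose_same W

theorem exists_eq_ofSpectrum_nonneg {A : Matrix ι ι ℂ} (hA : A.PosSemidef) :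
    ∃ W ∈ Matrix.unitaryGroup ι ℂ, ∃ d : ι → ℝ, (∀ i, 0 ≤ d i) ∧ A = ofSpectrum W d :=
  ⟨hA.1.eigenvectorUnitary, hA.1.eigenvectorUnitary.2, hA.1.eigenvalues, hA.eigenvalues_nonneg,
    hA.1.spectral_theorem⟩

theorem cfc_diagonal (f : ℝ → ℝ) (d : ι → ℝ) :
    cfc f (Matrix.diagonal fun i => (d i : ℂ)) = Matrix.diagonal fun i => (f (d i) : ℂ) := by
  have hD : (Matrix.diagonal fun i => (d i : ℂ)).IsHermitian :=
    Matrix.isHermitian_diagonal_iff.2 fun i => by simp [IsSelfAdjoint]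
  obtain ⟨p, hp, hpF⟩ := exists_cfc_eq_aeval f (Finset.univ.image d) hD
  have key : Polynomial.aeval (Matrix.diagonal fun i => (d i : ℂ)) p =
      Matrix.diagonal fun i => ((p.eval (d i) : ℝ) : ℂ) := by
    clear hp hpF
    induction p using Polynomial.induction_on' with
    | add p q hp hq =>
      rw [map_add, hp, hq, Matrix.diagonal_add]
      simp
    | monomial k a =>
      rw [Polynomial.aeval_monomial, Matrix.diagonal_pow, Matrix.algebraMap_eq_diagonal,
        Matrix.diagonal_mul_diagonal]
      simp
  rw [hp, key]
  congr 1
  funext i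
  rw [hpF _ (by simp)]

theorem cfc_ofSpectrum (f : ℝ → ℝ) {W : Matrix ι ι ℂ} (hW : W ∈ Matrix.unitaryGroup ι ℂ)
    (d : ι → ℝ) : cfc f (ofSpectrum W d) = ofSpectrum W (f ∘ d) := by
  rw [ofSpectrum, cfc_unitary_conj f hW (Matrix.isHermitian_diagonal_iff.2 fun i => by
    simp [IsSelfAdjoint]), cfc_diagonal]
  rfl

theorem trace_ofSpectrum {W : Matrix ι ι ℂ} (hW : W ∈ Matrix.unitaryGroup ι ℂ) (d : ι → ℝ) :
    (ofSpectrum W d).trace = ((∑ i, d i : ℝ) : ℂ) := by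
  have h : Wᴴ * W = 1 := (Matrix.mem_unitaryGroup_iff').1 hW
  rw [ofSpectrum, Matrix.trace_mul_comm, ← Matrix.mul_assoc, h, Matrix.one_mul,
    Matrix.trace_diagonal]
  push_cast; rfl

theorem ofSpectrum_mul {W : Matrix ι ι ℂ} (hW : W ∈ Matrix.unitaryGroup ι ℂ) (d d' : ι → ℝ) :
    ofSpectrum W d * ofSpectrum W d' = ofSpectrum W (d * d') := by
  have h : Wᴴ * W = 1 := (Matrix.mem_unitaryGroup_iff').1 hW
  have : ofSpectrum W d * ofSpectrum W d' =
      W * (Matrix.diagonal (fun i => (d i : ℂ)) * (Wᴴ * W) *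
        Matrix.diagonal fun i => (d' i : ℂ)) * Wᴴ := by
    simp only [ofSpectrum, Matrix.mul_assoc]
  rw [this, h, Matrix.mul_one, Matrix.diagonal_mul_diagonal]
  simp [ofSpectrum]

theorem ofSpectrum_sub (W : Matrix ι ι ℂ) (d d' : ι → ℝ) :
    ofSpectrum W d - ofSpectrum W d' = ofSpectrum W (d - d') := by
  simp only [ofSpectrum, ← Matrix.mul_sub, ← Matrix.sub_mul, Matrix.diagonal_sub]
  simp

theorem ofSpectrum_smul (W : Matrix ι ι ℂ) (a : ℝ) (d : ι → ℝ) :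
    (a : ℂ) • ofSpectrum W d = ofSpectrum W (a • d) := by
  rw [ofSpectrum, ofSpectrum, ← Matrix.smul_mul, ← Matrix.mul_smul, ← Matrix.diagonal_smul]
  congr 3
  ext i; simp

theorem ofSpectrum_one {W : Matrix ι ι ℂ} (hW : W ∈ Matrix.unitaryGroup ι ℂ) :
    ofSpectrum W 1 = 1 := by
  have h : W * Wᴴ = 1 := (Matrix.mem_unitaryGroup_iff).1 hW
  simp [ofSpectrum, h]

theorem isHermitian_cfc (f : ℝ → ℝ) (A : Matrix ι ι ℂ) : (cfc f A).IsHermitian :=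
  cfc_predicate f A

end FunctionalCalculus

/-! ### Positive matrices -/

section Positive

variable {ι κ : Type*} [Fintype ι] [Fintype κ]

theorem trace_mul_re_nonneg {A B : Matrix ι ι ℂ} (hA : A.PosSemidef) (hB : B.PosSemidef) :
    0 ≤ (A * B).trace.re := by
  classical
  obtain ⟨C, rfl⟩ : ∃ C : Matrix ι ι ℂ, A = C * Cᴴ := by
    obtain ⟨W, hW, d, hd, rfl⟩ := exists_eq_ofSpectrum_nonneg hA
    refine ⟨ofSpectrum W fun i => √(d i), ?_⟩
    rw [(isHermitian_ofSpectrum W _).eq, ofSpectrum_mul hW]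
    congr 1; ext i; simp [Real.mul_self_sqrt (hd i)]
  rw [Matrix.mul_assoc, Matrix.trace_mul_comm]
  exact (Complex.nonneg_iff.1 (hB.conjTranspose_mul_mul_same C).trace_nonneg).1

theorem trace_mul_re_le {σ A B : Matrix ι ι ℂ} (hσ : σ.PosSemidef) (h : (B - A).PosSemidef) :
    (σ * A).trace.re ≤ (σ * B).trace.re := by
  have := trace_mul_re_nonneg hσ h
  rw [Matrix.mul_sub, Matrix.trace_sub, Complex.sub_re] at this
  linarith

/-- An orthogonal projection. -/
def IsProj (P : Matrix ι ι ℂ) : Prop := P.IsHermitian ∧ P * P = P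

theorem IsProj.posSemidef {P : Matrix ι ι ℂ} (hP : IsProj P) : P.PosSemidef := by
  have := Matrix.posSemidef_self_mul_conjTranspose P
  rwa [hP.1.eq, hP.2] at this

theorem IsProj.one_sub [DecidableEq ι] {P : Matrix ι ι ℂ} (hP : IsProj P) : IsProj (1 - P) :=
  ⟨Matrix.isHermitian_one.sub hP.1, by
    simp [Matrix.sub_mul, Matrix.mul_sub, hP.2]⟩

theorem isProj_cfc [DecidableEq ι] {f : ℝ → ℝ} (hf : ∀ t, f t * f t = f t) {A : Matrix ι ι ℂ}
    (hA : A.IsHermitian) : IsProj (cfc f A) := by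
  refine ⟨isHermitian_cfc f A, ?_⟩
  obtain ⟨W, hW, d, rfl⟩ := exists_eq_ofSpectrum hA
  rw [cfc_ofSpectrum f hW, ofSpectrum_mul hW]
  congr 1; ext i; simp [hf]

theorem posSemidef_conj_of_isHermitian {A B : Matrix ι ι ℂ} (hA : A.PosSemidef)
    (hB : B.IsHermitian) : (B * A * B).PosSemidef := by
  have := hA.mul_mul_conjTranspose_same B
  rwa [hB.eq] at this

/-- `1 - PNP ≤ 3 (1 - P) + 2 (1 - N)` for projections `P`, `N`. -/
theorem posSemidef_one_sub_conj [DecidableEq ι] {P N : Matrix ι ι ℂ} (hP : IsProj P)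
    (hN : IsProj N) :
    ((3 : ℂ) • (1 - P) + (2 : ℂ) • (1 - N) - (1 - P * N * P)).PosSemidef := by
  have hM := hP.one_sub
  have hK := hN.one_sub
  have e : (3 : ℂ) • (1 - P) + (2 : ℂ) • (1 - N) - (1 - P * N * P) =
      (2 : ℂ) • ((1 - P) * N * (1 - P)) + (1 + (1 - P)) * (1 - N) * (1 + (1 - P)) := by
    have hPP := hP.2
    simp only [two_smul, show (3 : ℂ) = 1 + 1 + 1 by norm_num, add_smul, one_smul]
    simp only [mul_add, add_mul, mul_sub, sub_mul, mul_one, one_mul, hPP]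
    abel
  rw [e]
  exact ((posSemidef_conj_of_isHermitian hN.posSemidef hM.1).smul (by norm_num)).add
    (posSemidef_conj_of_isHermitian hK.posSemidef (Matrix.isHermitian_one.add hM.1))

/-- `1 - G ≤ 2 (1 - QGQ)` for projections `Q`, `G`. -/
theorem posSemidef_two_smul_one_sub_conj [DecidableEq ι] {Q G : Matrix ι ι ℂ} (hQ : IsProj Q)
    (hG : IsProj G) : ((2 : ℂ) • (1 - Q * G * Q) - (1 - G)).PosSemidef := by
  have hM := hQ.one_sub
  have hN := hG.one_sub
  have e : (2 : ℂ) • (1 - Q * G * Q) - (1 - G) =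
      (Q - (1 - Q)) * (1 - G) * (Q - (1 - Q)) + (2 : ℂ) • ((1 - Q) * G * (1 - Q)) := by
    have hQQ := hQ.2
    simp only [two_smul]
    simp only [mul_sub, sub_mul, mul_one, one_mul, hQQ]
    abel
  rw [e]
  exact (posSemidef_conj_of_isHermitian hN.posSemidef (hQ.1.sub hM.1)).add
    ((posSemidef_conj_of_isHermitian hG.posSemidef hM.1).smul (by norm_num))

end Positive

/-! ### Trace norm, operator inequalities and factorizations -/

section Positive

variable {ι κ : Type*} [Fintype ι] [DecidableEq ι] [Fintype κ] [DecidableEq κ]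

/-- In an eigenbasis of `X - Y` each eigenvalue is a difference of diagonal entries of `X` and `Y`,
which are nonnegative. -/
theorem traceNorm_sub_le {X Y : Matrix ι ι ℂ} (hX : X.PosSemidef) (hY : Y.PosSemidef) :
    traceNorm (X - Y) ≤ X.trace.re + Y.trace.re := by
  have hH : (X - Y).IsHermitian := hX.1.sub hY.1
  obtain ⟨W, hW, d, hd⟩ := exists_eq_ofSpectrum hH
  have hWW : W * Wᴴ = 1 := Matrix.mem_unitaryGroup_iff.1 hW
  have hWW' : Wᴴ * W = 1 := Matrix.mem_unitaryGroup_iff'.1 hW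
  have h1 : traceNorm (X - Y) = ∑ i, |d i| := by
    rw [traceNorm, hH.eq, hd, ofSpectrum_mul hW, cfc_ofSpectrum _ hW, trace_ofSpectrum hW,
      Complex.ofReal_re]
    exact Finset.sum_congr rfl fun i _ => by simp [Real.sqrt_mul_self_eq_abs]
  have htr : ∀ Z : Matrix ι ι ℂ, Z.trace = (Wᴴ * Z * W).trace := fun Z => by
    rw [Matrix.trace_mul_comm, ← Matrix.mul_assoc, hWW, Matrix.one_mul]
  rw [h1, htr X, htr Y, Matrix.trace, Matrix.trace, Complex.re_sum, Complex.re_sum,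
    ← Finset.sum_add_distrib]
  refine Finset.sum_le_sum fun i _ => ?_
  have hx := (Complex.nonneg_iff.1 ((hX.conjTranspose_mul_mul_same W).diag_nonneg (i := i))).1
  have hy := (Complex.nonneg_iff.1 ((hY.conjTranspose_mul_mul_same W).diag_nonneg (i := i))).1
  have hdi : d i = (Wᴴ * X * W) i i - (Wᴴ * Y * W) i i := by
    rw [← Matrix.sub_apply, ← Matrix.sub_mul, ← Matrix.mul_sub, hd, ofSpectrum]
    rw [show Wᴴ * (W * Matrix.diagonal (fun i => (d i : ℂ)) * Wᴴ) * W =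
      (Wᴴ * W) * Matrix.diagonal (fun i => (d i : ℂ)) * (Wᴴ * W) by simp only [Matrix.mul_assoc],
      hWW']
    simp
  have hdi' : d i = ((Wᴴ * X * W) i i).re - ((Wᴴ * Y * W) i i).re := by
    rw [← Complex.sub_re, ← hdi, Complex.ofReal_re]
  simp only [Matrix.diag_apply]
  rw [hdi']
  exact abs_le.2 ⟨by linarith, by linarith⟩

/-- Operator monotonicity of the square root. -/
theorem posSemidef_sub_of_sq {K A : Matrix ι ι ℂ} (hK : K.PosSemidef) (hA : A.PosSemidef)
    (h : (K * K - A * A).PosSemidef) : (K - A).PosSemidef := by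
  obtain ⟨W, hW, d, hd⟩ := exists_eq_ofSpectrum (hK.1.sub hA.1)
  rw [hd]
  refine posSemidef_ofSpectrum W fun i => ?_
  -- `N` projects onto the negative eigenspaces of `K - A`, and `M` is its negative part.
  -- Symmetrizing `K² - A²` gives `Tr N(K² - A²) = -Tr M(K + A)`, so the hypothesis forces `Tr MK =
  -- Tr MA = 0`; but `Tr M(K - A)` is minus the sum of the squared negative eigenvalues.
  set N := ofSpectrum W fun i => if d i < 0 then 1 else 0
  set M := ofSpectrum W fun i => if d i < 0 then -d i else 0
  have hM : M.PosSemidef := posSemidef_ofSpectrum W fun i => by split_ifs <;> linarith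
  have hN : N.PosSemidef := posSemidef_ofSpectrum W fun i => by split_ifs <;> norm_num
  have hneg : ∀ d' : ι → ℝ, -ofSpectrum W d' = ofSpectrum W (-d') := fun d' => by
    have := ofSpectrum_sub W 0 d'
    simpa [ofSpectrum] using this
  have h1 : N * (K - A) = -M := by
    rw [hd, ofSpectrum_mul hW, hneg]
    congr 1; ext i; simp; split_ifs <;> simp
  have h2 : (K - A) * N = -M := by
    rw [hd, ofSpectrum_mul hW, hneg]
    congr 1; ext i; simp; split_ifs <;> simp
  have h3 : (N * (K * K - A * A)).trace = -(M * K).trace - (M * A).trace := by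
    have e : (2 : ℂ) • (N * (K * K - A * A)) =
        N * (K - A) * (K + A) + N * ((K + A) * (K - A)) := by
      rw [two_smul]; noncomm_ring
    have e2 : (N * ((K + A) * (K - A))).trace = ((K - A) * N * (K + A)).trace := by
      rw [← Matrix.mul_assoc, Matrix.trace_mul_comm, ← Matrix.mul_assoc]
    have := congrArg Matrix.trace e
    rw [Matrix.trace_smul, Matrix.trace_add, e2, h1, h2, Matrix.mul_add, Matrix.trace_add] at this
    simp only [Matrix.neg_mul, Matrix.trace_neg, smul_eq_mul] at this
    linear_combination this / 2
  have h4 := trace_mul_re_nonneg hN h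
  have h5 := trace_mul_re_nonneg hM hK
  have h6 := trace_mul_re_nonneg hM hA
  have h7 : (M * (K - A)).trace.re = -∑ i, (if d i < 0 then d i ^ 2 else 0) := by
    rw [hd, ofSpectrum_mul hW, trace_ofSpectrum hW, Complex.ofReal_re, ← Finset.sum_neg_distrib]
    exact Finset.sum_congr rfl fun i _ => by
      simp only [Pi.mul_apply]; split_ifs <;> ring
  rw [h3] at h4
  rw [Matrix.mul_sub, Matrix.trace_sub] at h7
  simp only [Complex.sub_re, Complex.neg_re] at h4 h7
  by_contra! hi
  have h8 : d i ^ 2 ≤ ∑ i, (if d i < 0 then d i ^ 2 else 0) := by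
    have := Finset.single_le_sum (f := fun i => if d i < 0 then d i ^ 2 else 0)
      (fun i _ => by positivity) (Finset.mem_univ i)
    simpa [hi] using this
  have : 0 < d i ^ 2 := sq_pos_of_neg hi
  linarith

/-- This is the support projection: the convention `0⁻¹ = 0` leaves the kernel at zero. -/
theorem invSqrt_conj_isProj {T : Matrix ι ι ℂ} (hT : T.PosSemidef) :
    IsProj (invSqrt T * T * invSqrt T) := by
  obtain ⟨W, hW, d, hd, rfl⟩ := exists_eq_ofSpectrum_nonneg hT
  rw [invSqrt, cfc_ofSpectrum _ hW, ofSpectrum_mul hW, ofSpectrum_mul hW]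
  refine ⟨isHermitian_ofSpectrum _ _, ?_⟩
  rw [ofSpectrum_mul hW]
  congr 1; ext i
  simp only [Pi.mul_apply, Function.comp_apply]
  rcases (hd i).eq_or_lt with h | h
  · simp [← h]
  · have : √(d i) ≠ 0 := (Real.sqrt_pos.2 h).ne'
    field_simp
    rw [Real.sq_sqrt h.le]

theorem isHermitian_invSqrt (T : Matrix ι ι ℂ) : (invSqrt T).IsHermitian := isHermitian_cfc _ _

/-- Hayashi–Nagaoka inequality:
`1 - (A+T)^{-1/2} A (A+T)^{-1/2} ≤ 2 (1 - A) + 4 T` for `0 ≤ A ≤ 1` and `T ≥ 0`. -/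
theorem hayashi_nagaoka {A T : Matrix ι ι ℂ} (hA : A.PosSemidef) (hA1 : (1 - A).PosSemidef)
    (hT : T.PosSemidef) :
    ((2 : ℂ) • (1 - A) + (4 : ℂ) • T -
      (1 - invSqrt (A + T) * A * invSqrt (A + T))).PosSemidef := by
  have hAT := hA.add hT
  set R := invSqrt (A + T) with hR
  have hRH : R.IsHermitian := isHermitian_invSqrt _
  have hP := invSqrt_conj_isProj hAT
  rw [← hR] at hP
  set P := R * (A + T) * R with hPdef
  -- `K` is the square root of `A + T`. Since `K² ≥ A ≥ A²`, operator monotonicity gives `K ≥ A`,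
  -- the only non-algebraic input to the identity below.
  obtain ⟨K, hK, hKK, hRK, hKR⟩ : ∃ K : Matrix ι ι ℂ, K.PosSemidef ∧ K * K = A + T ∧
      R * (A + T) = K ∧ (A + T) * R = K := by
    obtain ⟨W, hW, d, hd, e⟩ := exists_eq_ofSpectrum_nonneg hAT
    refine ⟨ofSpectrum W fun i => √(d i), posSemidef_ofSpectrum W fun i => Real.sqrt_nonneg _,
      ?_, ?_, ?_⟩
    · rw [e, ofSpectrum_mul hW]
      congr 1; ext i; simp [Real.mul_self_sqrt (hd i)]
    all_goals
      rw [hR, e, invSqrt, cfc_ofSpectrum _ hW, ofSpectrum_mul hW]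
      congr 1; ext i
      simp only [Pi.mul_apply, Function.comp_apply]
      rcases (hd i).eq_or_lt with h | h
      · simp [← h]
      · have : √(d i) ≠ 0 := (Real.sqrt_pos.2 h).ne'
        field_simp
        rw [Real.sq_sqrt h.le]
  have hAA : (A - A * A).PosSemidef := by
    have h1 := posSemidef_conj_of_isHermitian hA hA1.1
    have h2 := posSemidef_conj_of_isHermitian hA1 hA.1
    have : A - A * A = (1 - A) * A * (1 - A) + A * (1 - A) * A := by noncomm_ring
    rw [this]; exact h1.add h2
  have hKA : (K - A).PosSemidef := posSemidef_sub_of_sq hK hA (by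
    rw [hKK, show A + T - A * A = (A - A * A) + T by abel]
    exact hAA.add hT)
  have e : (2 : ℂ) • (1 - A) + (4 : ℂ) • T - (1 - R * A * R) =
      (R - (1 + 1)) * T * (R - (1 + 1)) + (2 : ℂ) • ((R - 1) * A * (R - 1)) + (1 - P) +
        (4 : ℂ) • (K - A) := by
    have hRA : R * A = K - R * T := by rw [← hRK, mul_add]; abel
    have hAR : A * R = K - T * R := by rw [← hKR, add_mul]; abel
    have hKP : K * R = P := by rw [hPdef, hRK]
    simp only [two_smul, show (4 : ℂ) = 1 + 1 + 1 + 1 by norm_num, add_smul, one_smul, mul_add,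
      add_mul, mul_sub, sub_mul, mul_one, one_mul, hRA, hAR, hKP]
    abel
  rw [e]
  refine (((posSemidef_conj_of_isHermitian hT (hRH.sub ?_)).add
    ((posSemidef_conj_of_isHermitian hA (hRH.sub Matrix.isHermitian_one)).smul (by norm_num))).add
    hP.one_sub.posSemidef).add (hKA.smul (by norm_num))
  exact Matrix.isHermitian_one.add Matrix.isHermitian_one

/-- Take the square root in an eigenbasis and relabel the nonzero eigenvalues by elements of `κ`. -/
theorem exists_conjTranspose_mul_self_of_rank_le {A : Matrix ι ι ℂ} (hA : A.PosSemidef)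
    (h : A.rank ≤ Fintype.card κ) : ∃ X : Matrix κ ι ℂ, A = Xᴴ * X := by
  rw [hA.1.rank_eq_card_non_zero_eigs] at h
  obtain ⟨f⟩ := Function.Embedding.nonempty_of_card_le h
  set d := hA.1.eigenvalues with hd
  have hd0 : ∀ i, 0 ≤ d i := hA.eigenvalues_nonneg
  set W : Matrix ι ι ℂ := (hA.1.eigenvectorUnitary : Matrix ι ι ℂ)
  have hAd : A = ofSpectrum W d := hA.1.spectral_theorem
  set B : Matrix κ ι ℂ := Matrix.of fun k i =>
    if hi : d i ≠ 0 then (if f ⟨i, hi⟩ = k then ((√(d i) : ℝ) : ℂ) else 0) else 0 with hB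
  have hBB : Bᴴ * B = Matrix.diagonal fun i => (d i : ℂ) := by
    ext i j
    rw [Matrix.mul_apply]
    by_cases hi : d i = 0
    · simp [hB, hi, Matrix.diagonal_apply]
    by_cases hj : d j = 0
    · have hij : i ≠ j := fun h => hi (h ▸ hj)
      simp [hB, hj, hij]
    have hs : ((√(d i) : ℝ) : ℂ) * ((√(d i) : ℝ) : ℂ) = (d i : ℂ) := by
      rw [← Complex.ofReal_mul, Real.mul_self_sqrt (hd0 i)]
    simp only [hB, Matrix.conjTranspose_apply, Matrix.of_apply, hi, hj, ne_eq, not_false_eq_true,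
      dite_true, Matrix.diagonal_apply]
    by_cases hij : i = j
    · subst hij
      simp [hs]
    · simp [hij]
  refine ⟨B * Wᴴ, ?_⟩
  rw [Matrix.conjTranspose_mul, Matrix.conjTranspose_conjTranspose, Matrix.mul_assoc,
    ← Matrix.mul_assoc Bᴴ, hBB, ← Matrix.mul_assoc]
  exact hAd

/-- A partial isometry of a finite-dimensional space is the restriction of a unitary. -/
theorem exists_unitary_of_conjTranspose_mul_self {X Q : Matrix κ κ ℂ} (hQ : IsProj Q)
    (hX : Xᴴ * X = Q) : ∃ O ∈ Matrix.unitaryGroup κ ℂ, X = O * Q := by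
  have hXQ : X * Q = X := by
    have h0 : (X * Q - X)ᴴ * (X * Q - X) = 0 := by
      rw [Matrix.conjTranspose_sub, Matrix.conjTranspose_mul, hQ.1.eq]
      have : (Q * Xᴴ - Xᴴ) * (X * Q - X) =
          Q * (Xᴴ * X) * Q - Q * (Xᴴ * X) - (Xᴴ * X) * Q + Xᴴ * X := by noncomm_ring
      rw [this, hX, hQ.2, hQ.2]; abel
    exact sub_eq_zero.1 (Matrix.conjTranspose_mul_self_eq_zero.1 h0)
  set V := EuclideanSpace ℂ κ
  set q : V →ₗ[ℂ] V := Matrix.toEuclideanLin Q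
  set x : V →ₗ[ℂ] V := Matrix.toEuclideanLin X
  have hmul : ∀ (M N : Matrix κ κ ℂ) (v : V), Matrix.toEuclideanLin (M * N) v =
      Matrix.toEuclideanLin M (Matrix.toEuclideanLin N v) := fun M N v => by
    rw [Matrix.toEuclideanLin, Matrix.toLpLin_mul_same]; rfl
  have hadj : ∀ (M : Matrix κ κ ℂ) (v w : V), inner ℂ (Matrix.toEuclideanLin M v)
      (Matrix.toEuclideanLin M w) = inner ℂ v (Matrix.toEuclideanLin (Mᴴ * M) w) := by
    intro M v w
    rw [hmul, Matrix.toEuclideanLin_conjTranspose_eq_adjoint, LinearMap.adjoint_inner_right]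
  have hxq : ∀ v, x (q v) = x v := fun v => by
    rw [← hmul, hXQ]
  have hnorm : ∀ v, ‖x v‖ = ‖q v‖ := fun v => by
    have : (inner ℂ (x v) (x v) : ℂ) = inner ℂ (q v) (q v) := by
      rw [hadj, hadj, hX, hQ.1.eq, hQ.2]
    rw [inner_self_eq_norm_sq_to_K, inner_self_eq_norm_sq_to_K] at this
    exact (pow_left_inj₀ (norm_nonneg _) (norm_nonneg _) two_ne_zero).1 (by exact_mod_cast this)
  -- On the range of `Q`, `X` preserves norms. In finite dimension this isometry of a subspace
  -- extends to the whole space, where it is unitary.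
  let Lr : LinearMap.range q →ₗᵢ[ℂ] V :=
    { toLinearMap := x.comp (LinearMap.range q).subtype
      norm_map' := by
        rintro ⟨_, v, rfl⟩
        simp only [LinearMap.comp_apply, Submodule.subtype_apply, hxq, hnorm]
        rfl }
  set O : Matrix κ κ ℂ := Matrix.toEuclideanLin.symm Lr.extend.toLinearMap with hO
  have hOv : ∀ v, Matrix.toEuclideanLin O v = Lr.extend v := fun v => by
    rw [hO, LinearEquiv.apply_symm_apply]; rfl
  refine ⟨O, ?_, ?_⟩
  · rw [Matrix.mem_unitaryGroup_iff']
    apply Matrix.toEuclideanLin.injective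
    ext1 w
    refine ext_inner_left ℂ fun v => ?_
    rw [Matrix.star_eq_conjTranspose, ← hadj, hOv, hOv, LinearIsometry.inner_map_map]
    simp [Matrix.toEuclideanLin]
  · apply Matrix.toEuclideanLin.injective
    ext1 v
    have h1 : Matrix.toEuclideanLin (O * Q) v = Lr.extend (q v) := by
      rw [← hOv, hmul]
    rw [h1]
    have := Lr.extend_apply ⟨q v, v, rfl⟩
    rw [show Lr.extend (q v) = _ from this]
    exact (hxq v).symm

end Positive

/-! ### Phases -/

section Phase

variable {n r : ℕ}

theorem neg_one_pow_val_add (a b : ZMod 2) :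
    (-1 : ℂ) ^ (a + b).val = (-1) ^ a.val * (-1) ^ b.val := by
  revert a b
  have h : ∀ a b : ZMod 2, (a.val + b.val) % 2 = (a + b).val % 2 := by decide
  intro a b
  rw [← pow_add, neg_one_pow_eq_pow_mod_two, ← h, ← neg_one_pow_eq_pow_mod_two]

theorem zPhase_eq (x b : Bits n) : zPhase x b = (-1) ^ (x ⬝ᵥ b).val := by
  rw [zPhase, dotProduct]
  induction (Finset.univ : Finset (Fin n)) using Finset.induction_on with
  | empty => simp
  | insert i s hi ih => rw [Finset.prod_insert hi, Finset.sum_insert hi, neg_one_pow_val_add, ih]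

theorem zPhase_add_left (x y b : Bits n) : zPhase (x + y) b = zPhase x b * zPhase y b := by
  simp only [zPhase_eq, add_dotProduct, neg_one_pow_val_add]

theorem zPhase_add_right (x b b' : Bits n) : zPhase x (b + b') = zPhase x b * zPhase x b' := by
  simp only [zPhase_eq, dotProduct_add, neg_one_pow_val_add]

theorem zPhase_zero_left (b : Bits n) : zPhase 0 b = 1 := by simp [zPhase]

theorem zPhase_mul_self (x b : Bits n) : zPhase x b * zPhase x b = 1 := by
  rw [zPhase_eq, ← mul_pow]; simp

theorem star_zPhase (x b : Bits n) : star (zPhase x b) = zPhase x b := by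
  rw [zPhase_eq]; simp

theorem xKetBit_eq (x a : ZMod 2) : xKetBit x a = (-1) ^ (x * a).val * ((√2 : ℝ) : ℂ)⁻¹ := by
  rw [xKetBit, div_eq_mul_inv]

theorem xKet_eq (y a : Bits n) : xKet y a = zPhase y a * (((√2 : ℝ) : ℂ)⁻¹) ^ n := by
  simp [xKet, xKetBit_eq, Finset.prod_mul_distrib, zPhase]

theorem sum_zPhase (b : Bits n) : ∑ y, zPhase y b = if b = 0 then (2 : ℂ) ^ n else 0 := by
  have h2 : ∀ a : ZMod 2, ∑ x : ZMod 2, (-1 : ℂ) ^ (x * a).val = if a = 0 then 2 else 0 := by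
    intro a
    rw [show (Finset.univ : Finset (ZMod 2)) = {0, 1} from rfl, Finset.sum_pair (by decide)]
    obtain rfl | rfl : a = 0 ∨ a = 1 := by revert a; decide
    · norm_num
    · simp [show (1 : ZMod 2).val = 1 from rfl]
  have h1 : ∑ y, zPhase y b = ∏ i, ∑ x : ZMod 2, (-1 : ℂ) ^ (x * b i).val := by
    rw [Finset.prod_univ_sum]
    simp [zPhase]
  rw [h1]
  simp only [h2]
  split_ifs with h
  · simp [h]
  · obtain ⟨i, hi⟩ := Function.ne_iff.1 h
    exact Finset.prod_eq_zero (Finset.mem_univ i) (by simpa using hi)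

theorem bits_add_self (b : Bits n) : b + b = 0 := by
  ext i; exact CharTwo.add_self_eq_zero _

theorem sum_zPhase_mul (b b' : Bits n) :
    ∑ y, zPhase y b * zPhase y b' = if b = b' then (2 : ℂ) ^ n else 0 := by
  simp only [← zPhase_add_right, sum_zPhase]
  congr 1
  rw [eq_iff_iff]
  refine ⟨fun h => ?_, fun h => h ▸ bits_add_self b⟩
  have := congrArg (· + b') h
  simpa [add_assoc, bits_add_self] using this

theorem inv_sqrt_two_pow_mul_self (n : ℕ) :
    (((√2 : ℝ) : ℂ)⁻¹) ^ n * (((√2 : ℝ) : ℂ)⁻¹) ^ n = (1 / 2) ^ n := by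
  rw [← mul_pow, ← mul_inv, ← Complex.ofReal_mul, Real.mul_self_sqrt (by norm_num)]
  norm_num

end Phase

/-! ### Twisting operators -/

section Twist

variable {r : ℕ} {K : Type*} [Fintype K] [DecidableEq K]

/-- The operator `Z^y ⊗ 1`. -/
noncomputable def phaseOp (K : Type*) [DecidableEq K] (y : Bits r) :
    Matrix (Bits r × K) (Bits r × K) ℂ :=
  Matrix.diagonal fun p => zPhase y p.1

theorem phaseOp_conj_apply (y : Bits r) (M : Matrix (Bits r × K) (Bits r × K) ℂ)
    (p q : Bits r × K) :
    (phaseOp K y * M * phaseOp K y) p q = zPhase y p.1 * M p q * zPhase y q.1 := by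
  simp [phaseOp]

theorem phaseOp_mul (y y' : Bits r) : phaseOp K y * phaseOp K y' = phaseOp K (y + y') := by
  rw [phaseOp, phaseOp, Matrix.diagonal_mul_diagonal, phaseOp]
  simp only [zPhase_add_left]

theorem phaseOp_zero : phaseOp K (0 : Bits r) = 1 := by
  simp [phaseOp, zPhase_zero_left]

theorem phaseOp_mul_self (y : Bits r) : phaseOp K y * phaseOp K y = 1 := by
  rw [phaseOp_mul, bits_add_self, phaseOp_zero]

theorem isHermitian_phaseOp (y : Bits r) : (phaseOp K y).IsHermitian :=
  Matrix.isHermitian_diagonal_iff.2 fun p => star_zPhase y p.1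

theorem phaseOp_mem_unitaryGroup (y : Bits r) :
    phaseOp K y ∈ Matrix.unitaryGroup (Bits r × K) ℂ := by
  rw [Matrix.mem_unitaryGroup_iff, Matrix.star_eq_conjTranspose, (isHermitian_phaseOp y).eq,
    phaseOp_mul_self]

theorem cfc_phaseOp_conj (f : ℝ → ℝ) (y : Bits r) {M : Matrix (Bits r × K) (Bits r × K) ℂ}
    (hM : M.IsHermitian) :
    cfc f (phaseOp K y * M * phaseOp K y) = phaseOp K y * cfc f M * phaseOp K y := by
  have := cfc_unitary_conj f (phaseOp_mem_unitaryGroup (K := K) y) hM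
  rwa [(isHermitian_phaseOp y).eq] at this

/-- Orthogonality of characters: twirling by the `Z^y` removes the coherences between different key
values. -/
theorem sum_phaseOp_conj_apply (M : Matrix (Bits r × K) (Bits r × K) ℂ) (p q : Bits r × K) :
    (∑ y : Bits r, phaseOp K y * M * phaseOp K y) p q = if p.1 = q.1 then (2 : ℂ) ^ r * M p q else 0 := by
  rw [Matrix.sum_apply]
  simp only [phaseOp_conj_apply]
  have : ∀ y : Bits r, zPhase y p.1 * M p q * zPhase y q.1 =
    (zPhase y p.1 * zPhase y q.1) * M p q := fun y => by ring
  simp only [this, ← Finset.sum_mul, sum_zPhase_mul, ite_mul, zero_mul]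

theorem phaseOp_conj_sum (y : Bits r) (M : Matrix (Bits r × K) (Bits r × K) ℂ) :
    phaseOp K y * (∑ y' : Bits r, phaseOp K y' * M * phaseOp K y') * phaseOp K y =
      ∑ y' : Bits r, phaseOp K y' * M * phaseOp K y' := by
  ext p q
  rw [phaseOp_conj_apply, sum_phaseOp_conj_apply]
  split_ifs with h
  · rw [h]; linear_combination (2 ^ r * M p q) * zPhase_mul_self y q.1
  · simp

theorem twist_mul (V V' : Bits r → Matrix K K ℂ) :
    twist V * twist V' = twist fun ℓ => V ℓ * V' ℓ := by
  ext p q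
  rw [Matrix.mul_apply, Fintype.sum_prod_type]
  simp only [twist, Matrix.of_apply, Matrix.mul_apply]
  rw [Finset.sum_eq_single p.1]
  · split_ifs <;> simp_all
  · intro b _ hb; simp [Ne.symm hb]
  · simp

theorem conjTranspose_twist (V : Bits r → Matrix K K ℂ) :
    (twist V)ᴴ = twist fun ℓ => (V ℓ)ᴴ := by
  ext p q
  simp only [twist, Matrix.conjTranspose_apply, Matrix.of_apply]
  by_cases h : p.1 = q.1
  · simp [h]
  · simp [h, Ne.symm h]

theorem twist_proj_twist_apply (V V' : Bits r → Matrix K K ℂ) (f : Bits r → ℂ)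
    (p q : Bits r × K) :
    (twist V * (proj f ⊗ₖ (1 : Matrix K K ℂ)) * twist V') p q =
      f p.1 * star (f q.1) * (V p.1 * V' q.1) p.2 q.2 := by
  have h1 : ∀ t : Bits r × K, (twist V * (proj f ⊗ₖ (1 : Matrix K K ℂ))) p t =
      f p.1 * star (f t.1) * V p.1 p.2 t.2 := by
    intro t
    rw [Matrix.mul_apply, Fintype.sum_prod_type, Finset.sum_eq_single p.1]
    · simp [twist, proj, Matrix.vecMulVec_apply, Matrix.one_apply]; ring
    · intro b _ hb; simp [twist, Ne.symm hb]
    · simp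
  rw [Matrix.mul_apply, Fintype.sum_prod_type, Finset.sum_eq_single q.1]
  · simp only [h1]
    simp only [twist, Matrix.of_apply, if_true, Matrix.mul_apply, Finset.mul_sum, mul_assoc]
  · intro b _ hb; simp [twist, hb]
  · simp

/-- A covariant measurement of rank at most the dimension of the shield has an untwisting
operator. -/
theorem exists_untwists {F : Bits r → Matrix (Bits r × K) (Bits r × K) ℂ}
    (hF : ∀ y, F y = phaseOp K y * F 0 * phaseOp K y) (h0 : (F 0).PosSemidef)
    (hQ : IsProj (∑ y, F y)) (hrank : (F 0).rank ≤ Fintype.card K) :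
    ∃ V : Bits r → Matrix K K ℂ, Untwists V F := by
  -- The rank hypothesis is used here: `X` lands in the shield alone, so its restriction to each key
  -- value is a square matrix on the shield.
  obtain ⟨X, hX⟩ := exists_conjTranspose_mul_self_of_rank_le h0 hrank
  set Q : Bits r → Matrix K K ℂ := fun ℓ => Matrix.of fun s s' => 2 ^ r * F 0 (ℓ, s) (ℓ, s')
    with hQdef
  have hsum : ∑ y, F y = twist Q := by
    ext p q
    rw [Finset.sum_congr rfl fun y _ => hF y, sum_phaseOp_conj_apply, twist, Matrix.of_apply]
    split_ifs with h
    · change _ = 2 ^ r * F 0 (p.1, p.2) (p.1, q.2)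
      rw [show (p.1, q.2) = q by rw [h]]
    · rfl
  rw [hsum] at hQ
  have hQℓ : ∀ ℓ, IsProj (Q ℓ) := by
    intro ℓ
    have h1 := hQ.1.eq
    have h2 := hQ.2
    rw [conjTranspose_twist] at h1
    rw [twist_mul] at h2
    constructor
    · ext s s'
      have := congrFun (congrFun h1 (ℓ, s)) (ℓ, s')
      simpa [twist] using this
    · ext s s'
      have := congrFun (congrFun h2 (ℓ, s)) (ℓ, s')
      simpa [twist] using this
  -- The twirl multiplies the diagonal blocks of `F 0` by `2^r`, so rescaling the blocks of `X` by
  -- `c = 2^(r/2)` turns them into partial isometries with initial projections `Q ℓ`.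
  set c : ℂ := ((√2 : ℝ) : ℂ) ^ r with hc
  have hcc : c * c = 2 ^ r := by
    rw [hc, ← mul_pow, ← Complex.ofReal_mul, Real.mul_self_sqrt (by norm_num)]; norm_num
  have hcs : star c = c := by simp [hc]
  set Y : Bits r → Matrix K K ℂ := fun ℓ => Matrix.of fun k s => c * X k (ℓ, s) with hY
  have hYY : ∀ ℓ ℓ' s s', ((Y ℓ)ᴴ * Y ℓ') s s' = 2 ^ r * F 0 (ℓ, s) (ℓ', s') := by
    intro ℓ ℓ' s s'
    rw [hX, Matrix.mul_apply, Matrix.mul_apply, Finset.mul_sum]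
    refine Finset.sum_congr rfl fun k _ => ?_
    simp only [hY, Matrix.conjTranspose_apply, Matrix.of_apply, star_mul', hcs, ← hcc]
    ring
  have hYQ : ∀ ℓ, (Y ℓ)ᴴ * Y ℓ = Q ℓ := fun ℓ => by
    ext s s'; rw [hYY]; rfl
  choose O hO hYO using fun ℓ => exists_unitary_of_conjTranspose_mul_self (hQℓ ℓ) (hYQ ℓ)
  -- As `Y ℓ = O ℓ * Q ℓ`, the block `(ℓ, ℓ')` of `Q U(P^ỹ ⊗ 1)U† Q` is `2^{-r}` times a phase times
  -- `(Y ℓ)ᴴ * Y ℓ'`, which is the block of `F y`.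
  refine ⟨fun ℓ => (O ℓ)ᴴ, fun ℓ => ?_, fun y => ?_⟩
  · have := Unitary.star_mem (hO ℓ)
    exact this
  · rw [hsum, conjTranspose_twist, twist_mul, Matrix.mul_assoc, twist_mul]
    ext p q
    rw [twist_proj_twist_apply, hF, phaseOp_conj_apply]
    simp only [Matrix.conjTranspose_conjTranspose, ← hYO]
    have : Q p.1 * (O p.1)ᴴ = (Y p.1)ᴴ := by
      rw [hYO, Matrix.conjTranspose_mul, (hQℓ _).1.eq]
    rw [this, hYY, xKet_eq, xKet_eq, star_mul', star_zPhase]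
    have hs : star ((((√2 : ℝ) : ℂ)⁻¹) ^ r) = (((√2 : ℝ) : ℂ)⁻¹) ^ r := by simp
    rw [hs]
    have h3 := inv_sqrt_two_pow_mul_self r
    have h4 : (1 / 2 : ℂ) ^ r * 2 ^ r = 1 := by rw [← mul_pow]; norm_num
    linear_combination (-(zPhase y p.1 * zPhase y q.1 * F 0 p q)) * h4 -
      (zPhase y p.1 * zPhase y q.1 * F 0 p q * 2 ^ r) * h3

end Twist

/-! ### Distance of pure states -/

section Distance

variable {ι : Type*} [Fintype ι] [DecidableEq ι]

/-- If `a` and `b` are unit vectors at distance at most `D`, then `|a⟩⟨a| - |b⟩⟨b|` is a difference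
of two rank-one operators of total trace at most `2 D`. -/
theorem exists_proj_sub_proj {a b : ι → ℂ} (ha : IsNormalized a) (hb : IsNormalized b) {D : ℝ}
    (hD : 0 < D) (h : ∑ i, ‖a i - b i‖ ^ 2 ≤ D ^ 2) :
    ∃ v w : ι → ℂ, (∀ i j, a i * star (a j) - b i * star (b j) =
      v i * star (v j) - w i * star (w j)) ∧ ∑ i, ‖v i‖ ^ 2 + ∑ i, ‖w i‖ ^ 2 ≤ 2 * D := by
  -- For every nonzero real `t`, the vectors `v, w = (t(a-b) ± (a+b)/t)/2` satisfy the identity.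
  -- Their total square norm is `(t²‖a-b‖² + ‖a+b‖²/t²)/2 ≤ (t²D² + 4/t²)/2`, and `t² = 2/D`
  -- balances the two terms.
  set t : ℝ := √(2 / D) with ht
  have ht2 : t ^ 2 = 2 / D := Real.sq_sqrt (by positivity)
  have ht0 : 0 < t := Real.sqrt_pos.2 (by positivity)
  have htc : (t : ℂ) * (t : ℂ)⁻¹ = 1 := mul_inv_cancel₀ (by exact_mod_cast ht0.ne')
  refine ⟨fun i => (1 / 2) * (t * (a i - b i) + (t : ℂ)⁻¹ * (a i + b i)),
    fun i => (1 / 2) * (t * (a i - b i) - (t : ℂ)⁻¹ * (a i + b i)), fun i j => ?_, ?_⟩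
  · simp only [star_mul', star_add, star_sub, star_inv₀, Complex.star_def, Complex.conj_ofReal,
      map_div₀, map_one, map_ofNat]
    linear_combination (-(a i * (starRingEnd ℂ) (a j) - b i * (starRingEnd ℂ) (b j))) * htc
  · have key : ∀ i, ‖(1 / 2 : ℂ) * (t * (a i - b i) + (t : ℂ)⁻¹ * (a i + b i))‖ ^ 2 +
        ‖(1 / 2 : ℂ) * (t * (a i - b i) - (t : ℂ)⁻¹ * (a i + b i))‖ ^ 2 ≤
        1 / 2 * (t ^ 2 * ‖a i - b i‖ ^ 2 + (t ^ 2)⁻¹ * (2 * ‖a i‖ ^ 2 + 2 * ‖b i‖ ^ 2)) := by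
      intro i
      have p1 := parallelogram_law_with_norm ℂ ((t : ℂ) * (a i - b i)) ((t : ℂ)⁻¹ * (a i + b i))
      have p2 := parallelogram_law_with_norm ℂ (a i) (b i)
      have n1 : ‖(t : ℂ) * (a i - b i)‖ = t * ‖a i - b i‖ := by
        rw [norm_mul, Complex.norm_real, Real.norm_of_nonneg ht0.le]
      have n2 : ‖(t : ℂ)⁻¹ * (a i + b i)‖ = t⁻¹ * ‖a i + b i‖ := by
        rw [norm_mul, norm_inv, Complex.norm_real, Real.norm_of_nonneg ht0.le]
      rw [n1, n2] at p1
      rw [norm_mul, norm_mul, show ‖(1 / 2 : ℂ)‖ = 1 / 2 by norm_num]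
      have p3 : ‖a i + b i‖ ^ 2 ≤ 2 * ‖a i‖ ^ 2 + 2 * ‖b i‖ ^ 2 := by
        nlinarith [mul_self_nonneg ‖a i - b i‖]
      have p4 := mul_le_mul_of_nonneg_left p3 (by positivity : 0 ≤ (t ^ 2)⁻¹)
      have p5 : (t⁻¹ * ‖a i + b i‖) ^ 2 = (t ^ 2)⁻¹ * ‖a i + b i‖ ^ 2 := by
        rw [mul_pow, inv_pow]
      rw [p5] at p1
      nlinarith
    rw [← Finset.sum_add_distrib]
    refine (Finset.sum_le_sum fun i _ => key i).trans ?_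
    rw [← Finset.mul_sum, Finset.sum_add_distrib, ← Finset.mul_sum, ← Finset.mul_sum,
      Finset.sum_add_distrib, ← Finset.mul_sum, ← Finset.mul_sum, ha, hb, ht2]
    have : 2 / D * ∑ i, ‖a i - b i‖ ^ 2 ≤ 2 / D * D ^ 2 := by gcongr
    have e : 2 / D * D ^ 2 = 2 * D := by field_simp
    have e2 : (2 / D)⁻¹ = D / 2 := by rw [inv_div]
    rw [e2]; linarith

theorem posSemidef_proj (v : ι → ℂ) : (proj v).PosSemidef :=
  Matrix.posSemidef_vecMulVec_self_star v

theorem trace_proj_re (v : ι → ℂ) : (proj v).trace.re = ∑ i, ‖v i‖ ^ 2 := by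
  simp only [proj, Matrix.trace, Matrix.diag_apply, Matrix.vecMulVec_apply, Complex.re_sum,
    Pi.star_apply, Complex.star_def, Complex.mul_conj, Complex.ofReal_re,
    Complex.normSq_eq_norm_sq]

theorem traceNorm_proj_sub_proj_le {a b : ι → ℂ} (ha : IsNormalized a) (hb : IsNormalized b)
    {D : ℝ} (hD : 0 < D) (h : ∑ i, ‖a i - b i‖ ^ 2 ≤ D ^ 2) :
    traceNorm (proj a - proj b) ≤ 2 * D := by
  obtain ⟨v, w, hvw, hle⟩ := exists_proj_sub_proj ha hb hD h
  have : proj a - proj b = proj v - proj w := by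
    ext i j; simpa [proj, Matrix.vecMulVec_apply] using hvw i j
  rw [this]
  refine (traceNorm_sub_le (posSemidef_proj v) (posSemidef_proj w)).trans ?_
  rwa [trace_proj_re, trace_proj_re]

end Distance

/-! ### Measured keys and closeness to private states -/

section Key

variable {r : ℕ} {K E : Type*} [Fintype K] [DecidableEq K] [Fintype E] [DecidableEq E]

theorem posSemidef_measuredKey (Ψ : Bits r × Bits r × K × E → ℂ) :
    (measuredKey Ψ).PosSemidef := by
  set M : Matrix (Bits r × Bits r × E) (Bits r × Bits r × K) ℂ := Matrix.of fun p q =>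
    if p.1 = q.1 ∧ p.2.1 = q.2.1 then Ψ (q.1, q.2.1, q.2.2, p.2.2) else 0 with hM
  have : measuredKey Ψ = M * Mᴴ := by
    ext p q
    rw [Matrix.mul_apply, Fintype.sum_prod_type, Finset.sum_eq_single p.1,
      Fintype.sum_prod_type, Finset.sum_eq_single p.2.1]
    · simp only [measuredKey, hM, Matrix.of_apply, Matrix.conjTranspose_apply, and_self, if_true]
      by_cases h : p.1 = q.1 ∧ p.2.1 = q.2.1
      · simp [h.1, h.2]
      · have h' : ¬(q.1 = p.1 ∧ q.2.1 = p.2.1) := fun h' => h ⟨h'.1.symm, h'.2.symm⟩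
        simp [h, h']
    · intro b _ hb; simp [hM, Ne.symm hb]
    · simp
    · intro b _ hb; simp [hM, Ne.symm hb]
    · simp
  rw [this]
  exact Matrix.posSemidef_self_mul_conjTranspose M

theorem trace_measuredKey_re (Ψ : Bits r × Bits r × K × E → ℂ) :
    (measuredKey Ψ).trace.re = ∑ p, ‖Ψ p‖ ^ 2 := by
  simp only [measuredKey, Matrix.trace, Matrix.diag_apply, Matrix.of_apply, and_self, if_true,
    Complex.re_sum, Fintype.sum_prod_type, Complex.star_def, Complex.mul_conj, Complex.ofReal_re,
    Complex.normSq_eq_norm_sq]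
  refine Finset.sum_congr rfl fun a _ => Finset.sum_congr rfl fun b _ => Finset.sum_comm

/-- `measuredKey` depends linearly on `|Ψ⟩⟨Ψ|`, is positive and preserves the trace, so the
decomposition of a difference of pure states passes through it. This replaces contractivity of the
trace norm under channels. -/
theorem traceNorm_measuredKey_sub_le {Ψ γ : Bits r × Bits r × K × E → ℂ} (ha : IsNormalized Ψ)
    (hb : IsNormalized γ) {D : ℝ} (hD : 0 < D) (h : ∑ i, ‖Ψ i - γ i‖ ^ 2 ≤ D ^ 2) :
    traceNorm (measuredKey Ψ - measuredKey γ) ≤ 2 * D := by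
  obtain ⟨v, w, hvw, hle⟩ := exists_proj_sub_proj ha hb hD h
  have : measuredKey Ψ - measuredKey γ = measuredKey v - measuredKey w := by
    ext p q
    simp only [measuredKey, Matrix.sub_apply, Matrix.of_apply]
    split_ifs
    · rw [← Finset.sum_sub_distrib, ← Finset.sum_sub_distrib]
      exact Finset.sum_congr rfl fun s _ => hvw _ _
    · rfl
  rw [this]
  refine (traceNorm_sub_le (posSemidef_measuredKey v) (posSemidef_measuredKey w)).trans ?_
  rwa [trace_measuredKey_re, trace_measuredKey_re]

/-- Given the key value, the twist is a unitary on the discarded shield, so the marginal on `E` does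
not see the key. -/
theorem measuredKey_privateState {V : Bits r → Matrix K K ℂ}
    (hV : ∀ ℓ, V ℓ ∈ Matrix.unitaryGroup K ℂ) (ξ : K × E → ℂ) :
    measuredKey (privateState V ξ) =
      secretKey r (Matrix.of fun e e' => ∑ s, ξ (s, e) * star (ξ (s, e'))) := by
  ext p q
  simp only [measuredKey, secretKey, Matrix.of_apply, privateState]
  by_cases h : p.1 = q.1 ∧ p.2.1 = q.2.1
  swap
  · rw [if_neg h, if_neg fun h' => h ⟨h'.1, h'.2.1⟩]
  rw [if_pos h]
  by_cases h2 : p.1 = p.2.1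
  swap
  · simp [h2]
  rw [if_pos ⟨h.1, h.2, h2⟩]
  have h3 : p.1 = q.2.1 := by rw [← h.2, h2]
  simp only [← h.1, if_pos h2, if_pos h3]
  set X : Matrix K E ℂ := Matrix.of fun s e => ξ (s, e)
  have hVV : (V p.1)ᴴ * V p.1 = 1 := Matrix.mem_unitaryGroup_iff'.1 (hV p.1)
  have e1 : (V p.1 * X)ᴴ * (V p.1 * X) = Xᴴ * X := by
    rw [Matrix.conjTranspose_mul, Matrix.mul_assoc, ← Matrix.mul_assoc _ (V p.1), hVV,
      Matrix.one_mul]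
  have e2 := congrFun (congrFun e1 q.2.2) p.2.2
  simp only [Matrix.mul_apply, Matrix.conjTranspose_apply] at e2
  rw [← inv_sqrt_two_pow_mul_self]
  have hs : star ((((√2 : ℝ) : ℂ)⁻¹) ^ r) = (((√2 : ℝ) : ℂ)⁻¹) ^ r := by simp
  simp only [star_mul', hs]
  calc _ = ∑ s, (((√2 : ℝ) : ℂ)⁻¹) ^ r * (((√2 : ℝ) : ℂ)⁻¹) ^ r *
        (star (∑ j, V p.1 s j * X j q.2.2) * ∑ j, V p.1 s j * X j p.2.2) :=
        Finset.sum_congr rfl fun s _ => by simp only [X, Matrix.of_apply]; ring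
    _ = _ := by
        rw [← Finset.mul_sum, e2]
        exact congrArg _ (Finset.sum_congr rfl fun s _ => mul_comm _ _)

/-- The vector `∑_b |b⟩_A |b⟩_B η_b`, with the amplitudes of `BK` and `E` given by a matrix. -/
def sharedKey (η : Matrix (Bits r × K) E ℂ) : Bits r × Bits r × K × E → ℂ := fun p =>
  if p.1 = p.2.1 then η (p.2.1, p.2.2.1) p.2.2.2 else 0

theorem sharedKey_sub (η θ : Matrix (Bits r × K) E ℂ) (p) :
    sharedKey η p - sharedKey θ p = sharedKey (η - θ) p := by
  simp only [sharedKey, Matrix.sub_apply]; split_ifs <;> simp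

theorem trace_conjTranspose_mul_self_re {ι κ : Type*} [Fintype ι] [Fintype κ]
    (M : Matrix ι κ ℂ) : (Mᴴ * M).trace.re = ∑ i, ∑ j, ‖M i j‖ ^ 2 := by
  rw [Finset.sum_comm]
  simp only [Matrix.trace, Matrix.diag_apply, Matrix.mul_apply, Matrix.conjTranspose_apply,
    Complex.re_sum]
  refine Finset.sum_congr rfl fun i _ => Finset.sum_congr rfl fun j _ => ?_
  rw [mul_comm, Complex.star_def, Complex.mul_conj, Complex.ofReal_re, Complex.normSq_eq_norm_sq]

theorem sum_norm_sq_sharedKey (η : Matrix (Bits r × K) E ℂ) :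
    ∑ p, ‖sharedKey η p‖ ^ 2 = (ηᴴ * η).trace.re := by
  rw [trace_conjTranspose_mul_self_re]
  simp only [Fintype.sum_prod_type, sharedKey]
  refine Finset.sum_congr rfl fun a _ => ?_
  rw [Finset.sum_eq_single a]
  · simp
  · intro b _ hb; simp [Ne.symm hb]
  · simp

/-- Transposed amplitudes `⟨0̃|_B U†` of a twisting operator. -/
noncomputable def untwistRow (V : Bits r → Matrix K K ℂ) : Matrix K (Bits r × K) ℂ :=
  Matrix.of fun s p => (((√2 : ℝ) : ℂ)⁻¹) ^ r * star (V p.1 p.2 s)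

theorem conjTranspose_untwistRow_apply (V : Bits r → Matrix K K ℂ) (p : Bits r × K) (s : K) :
    (untwistRow V)ᴴ p s = (((√2 : ℝ) : ℂ)⁻¹) ^ r * V p.1 p.2 s := by
  simp [untwistRow]

theorem untwistRow_mul_conjTranspose {V : Bits r → Matrix K K ℂ}
    (hV : ∀ ℓ, V ℓ ∈ Matrix.unitaryGroup K ℂ) : untwistRow V * (untwistRow V)ᴴ = 1 := by
  ext s s'
  rw [Matrix.mul_apply, Fintype.sum_prod_type]
  have : ∀ ℓ, ∑ k, untwistRow V s (ℓ, k) * (untwistRow V)ᴴ (ℓ, k) s' =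
      (1 / 2) ^ r * (1 : Matrix K K ℂ) s s' := by
    intro ℓ
    rw [← Matrix.mem_unitaryGroup_iff'.1 (hV ℓ), Matrix.mul_apply, Finset.mul_sum,
      ← inv_sqrt_two_pow_mul_self]
    refine Finset.sum_congr rfl fun k _ => ?_
    rw [conjTranspose_untwistRow_apply, untwistRow, Matrix.of_apply, Matrix.star_apply]
    ring
  simp only [this, Finset.sum_const, Finset.card_univ, nsmul_eq_mul]
  rw [← mul_assoc]
  simp [ZMod.card]

/-- Factors the conjugate-key projection through `⟨0̃|U†`, a coisometry onto the shield, so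
compressing by it produces the vector `ξ` of a private state. -/
theorem twist_proj_zero_eq (V : Bits r → Matrix K K ℂ) :
    twist V * (proj (xKet 0) ⊗ₖ (1 : Matrix K K ℂ)) * (twist V)ᴴ =
      (untwistRow V)ᴴ * untwistRow V := by
  ext p q
  rw [conjTranspose_twist, twist_proj_twist_apply, Matrix.mul_apply, Matrix.mul_apply,
    Finset.mul_sum]
  refine Finset.sum_congr rfl fun s _ => ?_
  rw [conjTranspose_untwistRow_apply, untwistRow, Matrix.of_apply, xKet_eq, xKet_eq,
    zPhase_zero_left, zPhase_zero_left, Matrix.conjTranspose_apply]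
  simp
  ring

/-- Identifies private states with amplitudes in the range of the adjoint of `untwistRow V`;
approximation by a private state becomes projection onto this range. -/
theorem privateState_eq_sharedKey (V : Bits r → Matrix K K ℂ) (ξ : Matrix K E ℂ) :
    privateState V (fun p => ξ p.1 p.2) = sharedKey ((untwistRow V)ᴴ * ξ) := by
  funext p
  simp only [privateState, sharedKey]
  split_ifs with h
  · rw [Matrix.mul_apply, Finset.mul_sum]
    refine Finset.sum_congr rfl fun s _ => ?_
    rw [conjTranspose_untwistRow_apply, h]
    ring
  · rfl

/-- If a measurement with untwisting operator `U†` predicts the conjugate key, then the state is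
close to a private state with twisting operator `U`. -/
theorem exists_close_privateState {V : Bits r → Matrix K K ℂ}
    {F : Bits r → Matrix (Bits r × K) (Bits r × K) ℂ} (hV : Untwists V F)
    (hQ : IsProj (∑ y, F y)) {η : Matrix (Bits r × K) E ℂ} (hη : (ηᴴ * η).trace.re = 1) {e : ℝ}
    (he : e < 1 / 2) (hF : 1 - e ≤ (η * ηᴴ * F 0).trace.re) :
    ∃ ξ : K × E → ℂ, IsNormalized ξ ∧ IsNormalized (privateState V ξ) ∧
      ∑ p, ‖sharedKey η p - privateState V ξ p‖ ^ 2 ≤ 4 * e := by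
  set B := untwistRow V with hB
  have hBB : B * Bᴴ = 1 := untwistRow_mul_conjTranspose hV.1
  have hG : IsProj (Bᴴ * B) := by
    refine ⟨Matrix.isHermitian_conjTranspose_mul_self B, ?_⟩
    rw [Matrix.mul_assoc, ← Matrix.mul_assoc B, hBB, Matrix.one_mul]
  have hF0 : F 0 = (∑ y, F y) * (Bᴴ * B) * ∑ y, F y := by
    rw [hB, ← twist_proj_zero_eq]
    refine (hV.2 0).trans ?_
    simp only [Matrix.mul_assoc]
  have h1 : (η * ηᴴ * 1).trace.re = 1 := by rw [Matrix.mul_one, Matrix.trace_mul_comm, hη]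
  set ζ := B * η with hζ
  set z := (ζᴴ * ζ).trace.re with hz
  have hzG : (η * ηᴴ * (Bᴴ * B)).trace.re = z := by
    rw [hz, hζ, Matrix.conjTranspose_mul, Matrix.mul_assoc, Matrix.trace_mul_comm]
    simp only [Matrix.mul_assoc]
  -- The measurement tests `QGQ`, not `G`. The inequality `1 - G ≤ 2(1 - QGQ)` removes `Q` at the
  -- price of doubling the error.
  have hz1 : 1 - 2 * e ≤ z := by
    have := trace_mul_re_nonneg (Matrix.posSemidef_self_mul_conjTranspose η)
      (posSemidef_two_smul_one_sub_conj hQ hG)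
    rw [← hF0, Matrix.mul_sub, Matrix.mul_smul, Matrix.mul_sub, Matrix.mul_sub,
      Matrix.trace_sub, Matrix.trace_smul, Matrix.trace_sub, Matrix.trace_sub] at this
    simp only [smul_eq_mul, Complex.sub_re, Complex.mul_re, h1, hzG] at this
    norm_num at this
    linarith
  have hz0 : 0 < z := by linarith
  have hz2 : z ≤ 1 := by
    have := trace_mul_re_nonneg (Matrix.posSemidef_self_mul_conjTranspose η) hG.one_sub.posSemidef
    rw [Matrix.mul_sub, Matrix.trace_sub, Complex.sub_re, h1, hzG] at this
    linarith
  set a : ℝ := (√z)⁻¹ with ha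
  -- With `ξ` the normalized compression of `η`, the overlap with the private state is `√z ≥ z`, so
  -- the squared distance is `2 - 2√z ≤ 4e`.
  set ξ : Matrix K E ℂ := (a : ℂ) • ζ with hξ
  have hξζ : (ζᴴ * ξ).trace.re = √z := by
    rw [hξ, Matrix.mul_smul, Matrix.trace_smul, smul_eq_mul, Complex.re_ofReal_mul, ← hz, ha]
    have : √z ≠ 0 := (Real.sqrt_pos.2 hz0).ne'
    field_simp
    rw [Real.sq_sqrt hz0.le]
  have hξξ : (ξᴴ * ξ).trace.re = 1 := by
    rw [hξ, Matrix.conjTranspose_smul, Matrix.smul_mul, ← hξ, Matrix.trace_smul, smul_eq_mul,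
      Complex.star_def, Complex.conj_ofReal, Complex.re_ofReal_mul, hξζ, ha]
    exact inv_mul_cancel₀ (Real.sqrt_pos.2 hz0).ne'
  have hγγ : ((Bᴴ * ξ)ᴴ * (Bᴴ * ξ)).trace.re = 1 := by
    rw [Matrix.conjTranspose_mul, Matrix.conjTranspose_conjTranspose, Matrix.mul_assoc,
      ← Matrix.mul_assoc B, hBB, Matrix.one_mul, hξξ]
  refine ⟨fun p => ξ p.1 p.2, ?_, ?_, ?_⟩
  · rw [IsNormalized, Fintype.sum_prod_type]
    exact (trace_conjTranspose_mul_self_re ξ).symm.trans hξξ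
  · rw [IsNormalized, privateState_eq_sharedKey, sum_norm_sq_sharedKey, hγγ]
  · rw [privateState_eq_sharedKey]
    simp only [sharedKey_sub]
    rw [sum_norm_sq_sharedKey]
    have hc : ((η - Bᴴ * ξ)ᴴ * (η - Bᴴ * ξ)).trace.re =
        (ηᴴ * η).trace.re + ((Bᴴ * ξ)ᴴ * (Bᴴ * ξ)).trace.re - 2 * (ζᴴ * ξ).trace.re := by
      have e1 : ηᴴ * (Bᴴ * ξ) = ζᴴ * ξ := by
        rw [hζ, Matrix.conjTranspose_mul, Matrix.mul_assoc]
      have e2 : (Bᴴ * ξ)ᴴ * η = (ζᴴ * ξ)ᴴ := by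
        rw [← e1, Matrix.conjTranspose_mul ηᴴ, Matrix.conjTranspose_conjTranspose]
      rw [Matrix.conjTranspose_sub, Matrix.sub_mul, Matrix.mul_sub, Matrix.mul_sub, e1, e2]
      simp only [Matrix.trace_sub, Complex.sub_re, Matrix.trace_conjTranspose, Complex.star_def,
        Complex.conj_re]
      ring
    rw [hc, hη, hγγ, hξζ]
    have : z ≤ √z := Real.le_sqrt_of_sq_le (by nlinarith)
    linarith

theorem isClosePrivate_of_close {V : Bits r → Matrix K K ℂ} {ξ : K × E → ℂ}
    {Ψ : Bits r × Bits r × K × E → ℂ} (hΨ : IsNormalized Ψ)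
    (hγ : IsNormalized (privateState V ξ)) {D : ℝ} (hD : 0 < D)
    (h : ∑ p, ‖Ψ p - privateState V ξ p‖ ^ 2 ≤ D ^ 2) : IsClosePrivate D V ξ Ψ :=
  traceNorm_proj_sub_proj_le hΨ hγ hD h

/-- Closeness to a private state, in norm, makes the measured key private. -/
theorem isEpsPrivate_of_close {V : Bits r → Matrix K K ℂ}
    (hV : ∀ ℓ, V ℓ ∈ Matrix.unitaryGroup K ℂ) {ξ : K × E → ℂ} (hξ : IsNormalized ξ)
    {Ψ : Bits r × Bits r × K × E → ℂ} (hΨ : IsNormalized Ψ)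
    (hγ : IsNormalized (privateState V ξ)) {D : ℝ} (hD : 0 < D)
    (h : ∑ p, ‖Ψ p - privateState V ξ p‖ ^ 2 ≤ D ^ 2) : IsEpsPrivate D Ψ := by
  refine ⟨Matrix.of fun e e' => ∑ s, ξ (s, e) * star (ξ (s, e')), ?_, ?_, ?_⟩
  · set X : Matrix E K ℂ := Matrix.of fun e s => ξ (s, e)
    exact Matrix.posSemidef_self_mul_conjTranspose X
  · rw [IsNormalized, Fintype.sum_prod_type, Finset.sum_comm] at hξ
    simp only [Matrix.trace, Matrix.diag_apply, Matrix.of_apply, Complex.star_def,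
      Complex.mul_conj, Complex.normSq_eq_norm_sq]
    exact_mod_cast hξ
  · rw [← measuredKey_privateState hV]
    exact traceNorm_measuredKey_sub_le hΨ hγ hD h

end Key

/-! ### Entropy -/

section Entropy

variable {ι : Type*} [Fintype ι] [DecidableEq ι]

theorem entropy_ofSpectrum {W : Matrix ι ι ℂ} (hW : W ∈ Matrix.unitaryGroup ι ℂ) (p : ι → ℝ) :
    entropy (ofSpectrum W p) = (∑ i, Real.negMulLog (p i)) / Real.log 2 := by
  rw [entropy, cfc_ofSpectrum _ hW, trace_ofSpectrum hW, Complex.ofReal_re]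
  rfl

theorem entropy_unitary_conj {W A : Matrix ι ι ℂ} (hW : W ∈ Matrix.unitaryGroup ι ℂ)
    (hA : A.IsHermitian) : entropy (W * A * Wᴴ) = entropy A := by
  have h : Wᴴ * W = 1 := (Matrix.mem_unitaryGroup_iff').1 hW
  rw [entropy, cfc_unitary_conj _ hW hA, Matrix.trace_mul_comm, ← Matrix.mul_assoc, h,
    Matrix.one_mul, entropy]

/-- Gibbs' inequality against the uniform distribution, from `log t ≤ t - 1` at `t = 1/(d p_i)`. -/
theorem sum_negMulLog_le_log_card {p : ι → ℝ} (hp : ∀ i, 0 ≤ p i) (h1 : ∑ i, p i = 1) :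
    ∑ i, Real.negMulLog (p i) ≤ Real.log (Fintype.card ι) := by
  have hne : Nonempty ι := by
    by_contra h
    rw [not_nonempty_iff] at h
    simp at h1
  have hd : (0 : ℝ) < Fintype.card ι := by exact_mod_cast Fintype.card_pos
  have key : ∀ i, Real.negMulLog (p i) ≤
      p i * Real.log (Fintype.card ι) + ((Fintype.card ι : ℝ)⁻¹ - p i) := by
    intro i
    rcases (hp i).eq_or_lt with h | h
    · rw [← h]; simp
    · have := Real.log_le_sub_one_of_pos (x := (Fintype.card ι * p i)⁻¹) (by positivity)
      rw [Real.log_inv, Real.log_mul hd.ne' h.ne'] at this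
      have h3 := mul_le_mul_of_nonneg_left this h.le
      have h4 : p i * ((Fintype.card ι * p i : ℝ)⁻¹ - 1) = (Fintype.card ι : ℝ)⁻¹ - p i := by
        field_simp
      rw [h4] at h3
      rw [Real.negMulLog]
      linarith
  refine (Finset.sum_le_sum fun i _ => key i).trans ?_
  rw [Finset.sum_add_distrib, ← Finset.sum_mul, Finset.sum_sub_distrib, h1]
  simp [hd.ne']

theorem sum_eq_one_of_trace {W : Matrix ι ι ℂ} (hW : W ∈ Matrix.unitaryGroup ι ℂ) {p : ι → ℝ}
    (h : (ofSpectrum W p).trace = 1) : ∑ i, p i = 1 := by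
  rw [trace_ofSpectrum hW] at h
  exact_mod_cast h

theorem entropy_le_logb_card {σ : Matrix ι ι ℂ} (hσ : σ.PosSemidef) (h1 : σ.trace = 1) :
    entropy σ ≤ Real.logb 2 (Fintype.card ι) := by
  obtain ⟨W, hW, p, hp, rfl⟩ := exists_eq_ofSpectrum_nonneg hσ
  rw [entropy_ofSpectrum hW, Real.logb]
  have := sum_negMulLog_le_log_card hp (sum_eq_one_of_trace hW h1)
  have h2 : 0 < Real.log 2 := Real.log_pos (by norm_num)
  gcongr

/-- Matrix elements of a positive matrix in a basis `W`, in terms of its spectrum. -/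
theorem diag_ofSpectrum (W W' : Matrix ι ι ℂ) (q : ι → ℝ) (i : ι) :
    ((Wᴴ * ofSpectrum W' q * W) i i).re = ∑ j, ‖(Wᴴ * W') i j‖ ^ 2 * q j := by
  have e : Wᴴ * ofSpectrum W' q * W =
      (Wᴴ * W') * Matrix.diagonal (fun i => (q i : ℂ)) * (Wᴴ * W')ᴴ := by
    rw [ofSpectrum, Matrix.conjTranspose_mul, Matrix.conjTranspose_conjTranspose]
    simp only [Matrix.mul_assoc]
  rw [e, Matrix.mul_apply, Complex.re_sum]
  refine Finset.sum_congr rfl fun j _ => ?_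
  rw [Matrix.mul_diagonal, Matrix.conjTranspose_apply, mul_right_comm, Complex.star_def,
    Complex.mul_conj, ← Complex.ofReal_mul, Complex.ofReal_re, Complex.normSq_eq_norm_sq]

theorem sum_norm_sq_row {B : Matrix ι ι ℂ} (hB : B ∈ Matrix.unitaryGroup ι ℂ) (i : ι) :
    ∑ j, ‖B i j‖ ^ 2 = 1 := by
  have h : (B * Bᴴ) i i = 1 := by
    rw [show B * Bᴴ = 1 from Matrix.mem_unitaryGroup_iff.1 hB, Matrix.one_apply_eq]
  rw [Matrix.mul_apply] at h
  simp only [Matrix.conjTranspose_apply, Complex.star_def, Complex.mul_conj,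
    Complex.normSq_eq_norm_sq] at h
  exact_mod_cast h

theorem sum_norm_sq_col {B : Matrix ι ι ℂ} (hB : B ∈ Matrix.unitaryGroup ι ℂ) (j : ι) :
    ∑ i, ‖B i j‖ ^ 2 = 1 := by
  have := sum_norm_sq_row (Unitary.star_mem hB) j
  simpa [Matrix.star_eq_conjTranspose] using this

theorem conjTranspose_mul_mem_unitaryGroup {W W' : Matrix ι ι ℂ}
    (hW : W ∈ Matrix.unitaryGroup ι ℂ) (hW' : W' ∈ Matrix.unitaryGroup ι ℂ) :
    Wᴴ * W' ∈ Matrix.unitaryGroup ι ℂ := mul_mem (Unitary.star_mem hW) hW'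

/-- The entropy of the outcome of a complete projective measurement is at least the entropy of the
state. -/
theorem sum_negMulLog_le_diag {W W' : Matrix ι ι ℂ} (hW : W ∈ Matrix.unitaryGroup ι ℂ)
    (hW' : W' ∈ Matrix.unitaryGroup ι ℂ) {q : ι → ℝ} (hq : ∀ i, 0 ≤ q i) :
    ∑ j, Real.negMulLog (q j) ≤
      ∑ i, Real.negMulLog ((Wᴴ * ofSpectrum W' q * W) i i).re := by
  have hB := conjTranspose_mul_mem_unitaryGroup hW hW'
  -- The diagonal is the image of `q` under a doubly stochastic matrix: unit row sums allow Jensen's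
  -- inequality, unit column sums give back the entropy of `q` after summing.
  have h1 : ∀ i, ∑ j, ‖(Wᴴ * W') i j‖ ^ 2 * Real.negMulLog (q j) ≤
      Real.negMulLog ((Wᴴ * ofSpectrum W' q * W) i i).re := by
    intro i
    rw [diag_ofSpectrum]
    have := Real.concaveOn_negMulLog.le_map_sum (t := Finset.univ)
      (w := fun j => ‖(Wᴴ * W') i j‖ ^ 2) (p := q) (fun j _ => by positivity)
      (sum_norm_sq_row hB i) (fun j _ => hq j)
    simpa only [smul_eq_mul] using this
  refine le_trans (le_of_eq ?_) (Finset.sum_le_sum fun i _ => h1 i)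
  rw [Finset.sum_comm]
  refine Finset.sum_congr rfl fun j _ => ?_
  rw [← Finset.sum_mul, sum_norm_sq_col hB, one_mul]

theorem zmod_two_sum {M : Type*} [AddCommMonoid M] (f : ZMod 2 → M) : ∑ x, f x = f 0 + f 1 := by
  rw [show (Finset.univ : Finset (ZMod 2)) = {0, 1} from rfl, Finset.sum_pair (by decide)]

theorem diag_avg {W : Matrix ι ι ℂ} (hW : W ∈ Matrix.unitaryGroup ι ℂ) {p : ι → ℝ}
    {ρ : ZMod 2 → Matrix ι ι ℂ} (h : (1 / 2 : ℂ) • ∑ x, ρ x = ofSpectrum W p) (i : ι) :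
    p i = 1 / 2 * ((Wᴴ * ρ 0 * W) i i).re + 1 / 2 * ((Wᴴ * ρ 1 * W) i i).re := by
  have hB : Wᴴ * W = 1 := Matrix.mem_unitaryGroup_iff'.1 hW
  have h1 := diag_ofSpectrum W W p i
  rw [← h, hB, zmod_two_sum] at h1
  rw [Finset.sum_eq_single i (fun j _ hj => by simp [Ne.symm hj]) (by simp)] at h1
  simp only [Matrix.mul_smul, Matrix.smul_mul, Matrix.mul_add, Matrix.add_mul, Matrix.smul_apply,
    Matrix.add_apply, Matrix.one_apply_eq] at h1
  have h2 : ∀ z : ℂ, ((1 / 2 : ℂ) • z).re = 1 / 2 * z.re := fun z => by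
    rw [smul_eq_mul, show (1 / 2 : ℂ) = ((1 / 2 : ℝ) : ℂ) by norm_num, Complex.re_ofReal_mul]
  rw [h2, Complex.add_re] at h1
  norm_num at h1
  linarith

theorem posSemidef_avg {ρ : ZMod 2 → Matrix ι ι ℂ} (hρ : ∀ x, (ρ x).PosSemidef) :
    ((1 / 2 : ℂ) • ∑ x, ρ x).PosSemidef := by
  rw [zmod_two_sum]
  exact ((hρ 0).add (hρ 1)).smul (Complex.nonneg_iff.2 (by norm_num))

/-- Measure in an eigenbasis of the average: the entropies of the `ρ x` can only grow, that of the
average is unchanged, and the outcome entropy is concave. -/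
theorem holevo_nonneg {ρ : ZMod 2 → Matrix ι ι ℂ} (hρ : ∀ x, (ρ x).PosSemidef) :
    0 ≤ holevo ρ := by
  obtain ⟨W, hW, p, hp, h⟩ := exists_eq_ofSpectrum_nonneg (posSemidef_avg hρ)
  have hx : ∀ x, entropy (ρ x) ≤
      (∑ i, Real.negMulLog ((Wᴴ * ρ x * W) i i).re) / Real.log 2 := by
    intro x
    obtain ⟨W', hW', q, hq, e⟩ := exists_eq_ofSpectrum_nonneg (hρ x)
    rw [e, entropy_ofSpectrum hW']
    have := sum_negMulLog_le_diag hW hW' hq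
    have h2 : 0 < Real.log 2 := Real.log_pos (by norm_num)
    gcongr
  have hd : ∀ x i, 0 ≤ ((Wᴴ * ρ x * W) i i).re := fun x i =>
    (Complex.nonneg_iff.1 (((hρ x).conjTranspose_mul_mul_same W).diag_nonneg (i := i))).1
  have hp' : ∀ i, 1 / 2 * Real.negMulLog ((Wᴴ * ρ 0 * W) i i).re +
      1 / 2 * Real.negMulLog ((Wᴴ * ρ 1 * W) i i).re ≤ Real.negMulLog (p i) := by
    intro i
    rw [diag_avg hW h i]
    exact Real.concaveOn_negMulLog.2 (hd 0 i) (hd 1 i) (by norm_num) (by norm_num) (by norm_num)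
  have hs := Finset.sum_le_sum fun i (_ : i ∈ Finset.univ) => hp' i
  rw [Finset.sum_add_distrib, ← Finset.mul_sum, ← Finset.mul_sum] at hs
  rw [holevo, h, entropy_ofSpectrum hW, zmod_two_sum]
  have h2 : 0 < Real.log 2 := Real.log_pos (by norm_num)
  have hs' := div_le_div_of_nonneg_right hs h2.le
  have := hx 0
  have := hx 1
  rw [add_div, mul_div_assoc, mul_div_assoc] at hs'
  linarith

/-- `D(σ‖ρ) ≤ log 2` if `σ ≤ 2ρ`. -/
theorem cross_entropy_le {W W' : Matrix ι ι ℂ} (hW : W ∈ Matrix.unitaryGroup ι ℂ)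
    (hW' : W' ∈ Matrix.unitaryGroup ι ℂ) {p q : ι → ℝ} (hp : ∀ i, 0 ≤ p i) (hq : ∀ i, 0 ≤ q i)
    (hq1 : ∑ i, q i = 1)
    (h : ((2 : ℂ) • ofSpectrum W p - ofSpectrum W' q).PosSemidef) :
    ∑ i, ((Wᴴ * ofSpectrum W' q * W) i i).re * (-Real.log (p i)) ≤
      ∑ j, Real.negMulLog (q j) + Real.log 2 := by
  set B := Wᴴ * W' with hBdef
  have hB := conjTranspose_mul_mem_unitaryGroup hW hW'
  have hWW : Wᴴ * W = 1 := Matrix.mem_unitaryGroup_iff'.1 hW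
  have hM : ((2 : ℂ) • Matrix.diagonal (fun i => (p i : ℂ)) -
      B * Matrix.diagonal (fun i => (q i : ℂ)) * Bᴴ).PosSemidef := by
    have := h.conjTranspose_mul_mul_same W
    convert this using 1
    rw [Matrix.mul_sub, Matrix.sub_mul, Matrix.mul_smul, Matrix.smul_mul]
    congr 1
    · rw [ofSpectrum, show Wᴴ * (W * Matrix.diagonal (fun i => (p i : ℂ)) * Wᴴ) * W =
        (Wᴴ * W) * Matrix.diagonal (fun i => (p i : ℂ)) * (Wᴴ * W) by
          simp only [Matrix.mul_assoc], hWW, Matrix.one_mul, Matrix.mul_one]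
    · rw [ofSpectrum, hBdef, Matrix.conjTranspose_mul, Matrix.conjTranspose_conjTranspose]
      simp only [Matrix.mul_assoc]
  -- The form of `2ρ - σ` at `u` is nonnegative; all terms of `σ` but the `j`-th are dropped.
  have hquad : ∀ u : ι → ℂ, ∀ j, q j * ‖∑ i, star (B i j) * u i‖ ^ 2 ≤
      2 * ∑ i, p i * ‖u i‖ ^ 2 := by
    intro u j
    have h1 := (Complex.nonneg_iff.1 (hM.dotProduct_mulVec_nonneg u)).1
    have h2 : star u ⬝ᵥ ((2 : ℂ) • Matrix.diagonal (fun i => (p i : ℂ)) -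
      B * Matrix.diagonal (fun i => (q i : ℂ)) * Bᴴ) *ᵥ u =
        ((2 * ∑ i, p i * ‖u i‖ ^ 2 - ∑ k, q k * ‖∑ i, star (B i k) * u i‖ ^ 2 : ℝ) : ℂ) := by
      have hv : star u ᵥ* B = star (Bᴴ *ᵥ u) := by
        rw [Matrix.star_mulVec, Matrix.conjTranspose_conjTranspose]
      have hk : ∀ k, (Bᴴ *ᵥ u) k = ∑ i, star (B i k) * u i := fun k => rfl
      rw [Matrix.sub_mulVec, dotProduct_sub, ← Matrix.mulVec_mulVec, ← Matrix.mulVec_mulVec,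
        Matrix.dotProduct_mulVec _ B, hv, Matrix.smul_mulVec, dotProduct_smul]
      simp only [dotProduct, Matrix.mulVec_diagonal, Pi.star_apply, hk]
      push_cast
      simp only [← Complex.conj_mul', Complex.star_def, smul_eq_mul]
      congr 1
      · exact congrArg _ (Finset.sum_congr rfl fun i _ => by ring)
      · exact Finset.sum_congr rfl fun i _ => by ring
    rw [h2, Complex.ofReal_re] at h1
    have h3 := Finset.single_le_sum (f := fun k => q k * ‖∑ i, star (B i k) * u i‖ ^ 2)
      (fun k _ => mul_nonneg (hq k) (by positivity)) (Finset.mem_univ j)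
    linarith
  -- The support of `σ` lies in that of `ρ`. Terms with `p i = 0`, where `Real.log 0 = 0`, therefore
  -- carry no weight.
  have hsupp : ∀ i j, 0 < q j → p i = 0 → ‖B i j‖ ^ 2 = 0 := by
    intro i j hj hi
    have := hquad (Pi.single i 1) j
    have e1 : ∑ k, star (B k j) * (Pi.single i 1 : ι → ℂ) k = star (B i j) := by
      simp [Pi.single_apply]
    have e2 : ∑ k, p k * ‖(Pi.single i 1 : ι → ℂ) k‖ ^ 2 = p i := by
      rw [Finset.sum_eq_single i (fun k _ hk => by simp [hk]) (by simp)]; simp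
    rw [e1, e2, hi, norm_star] at this
    nlinarith [sq_nonneg ‖B i j‖]
  -- Testing on `ρ⁻¹` applied to the `j`-th eigenvector of `σ` bounds the mean of `ρ⁻¹` there by
  -- `2/q_j`; the inequality `log t ≤ t - 1` at `t = q_j/(2p_i)` then bounds the mean of `-log ρ`.
  have hinv : ∀ j, q j * ∑ i, ‖B i j‖ ^ 2 * (p i)⁻¹ ≤ 2 := by
    intro j
    set s := ∑ i, ‖B i j‖ ^ 2 * (p i)⁻¹ with hs
    have hs0 : 0 ≤ s := Finset.sum_nonneg fun i _ => mul_nonneg (by positivity)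
      (inv_nonneg.2 (hp i))
    have := hquad (fun i => ((p i)⁻¹ : ℝ) * B i j) j
    have e1 : ∑ i, star (B i j) * (((p i)⁻¹ : ℝ) * B i j) = (s : ℂ) := by
      rw [hs]; push_cast
      refine Finset.sum_congr rfl fun i _ => ?_
      rw [← Complex.mul_conj', Complex.star_def]; ring
    have e2 : ∑ i, p i * ‖(((p i)⁻¹ : ℝ) : ℂ) * B i j‖ ^ 2 = s := by
      refine Finset.sum_congr rfl fun i _ => ?_
      rw [norm_mul, mul_pow, Complex.norm_real, Real.norm_of_nonneg (inv_nonneg.2 (hp i))]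
      rcases (hp i).eq_or_lt with h0 | h0
      · simp [← h0]
      · field_simp
    rw [e1, e2, Complex.norm_real, Real.norm_of_nonneg hs0] at this
    rcases hs0.eq_or_lt with h0 | h0
    · rw [← h0]; norm_num
    · have : q j * s * s ≤ 2 * s := by nlinarith
      exact le_of_mul_le_mul_right this h0
  have key : ∀ j, ∑ i, ‖B i j‖ ^ 2 * q j * (-Real.log (p i)) ≤
      Real.negMulLog (q j) + q j * Real.log 2 := by
    intro j
    rcases (hq j).eq_or_lt with h0 | h0
    · simp [← h0]
    have hij : ∀ i, ‖B i j‖ ^ 2 * (-Real.log (p i)) ≤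
        ‖B i j‖ ^ 2 * (Real.log 2 - Real.log (q j)) +
          (q j / 2 * (‖B i j‖ ^ 2 * (p i)⁻¹) - ‖B i j‖ ^ 2) := by
      intro i
      rcases (hp i).eq_or_lt with hi | hi
      · rw [hsupp i j h0 hi.symm]; simp
      · have := Real.log_le_sub_one_of_pos (x := q j / (2 * p i)) (by positivity)
        rw [Real.log_div h0.ne' (by positivity), Real.log_mul (by norm_num) hi.ne'] at this
        have h3 := mul_le_mul_of_nonneg_left this (sq_nonneg ‖B i j‖)
        have e3 : q j / 2 * (‖B i j‖ ^ 2 * (p i)⁻¹) - ‖B i j‖ ^ 2 =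
          ‖B i j‖ ^ 2 * (q j / (2 * p i) - 1) := by field_simp
        rw [e3]
        linarith
    have hs := Finset.sum_le_sum fun i (_ : i ∈ Finset.univ) => hij i
    rw [Finset.sum_add_distrib, ← Finset.sum_mul, Finset.sum_sub_distrib, ← Finset.mul_sum,
      sum_norm_sq_col hB] at hs
    have h4 : ∑ i, ‖B i j‖ ^ 2 * (-Real.log (p i)) ≤ Real.log 2 - Real.log (q j) := by
      have := hinv j
      linarith
    have h5 := mul_le_mul_of_nonneg_left h4 h0.le
    rw [Finset.mul_sum] at h5
    rw [Real.negMulLog]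
    calc _ = ∑ i, q j * (‖B i j‖ ^ 2 * (-Real.log (p i))) :=
          Finset.sum_congr rfl fun i _ => by ring
      _ ≤ _ := by linarith
  calc _ = ∑ j, ∑ i, ‖B i j‖ ^ 2 * q j * (-Real.log (p i)) := by
        rw [Finset.sum_comm]
        refine Finset.sum_congr rfl fun i _ => ?_
        rw [diag_ofSpectrum, Finset.sum_mul]
    _ ≤ ∑ j, (Real.negMulLog (q j) + q j * Real.log 2) := Finset.sum_le_sum fun j _ => key j
    _ = _ := by rw [Finset.sum_add_distrib, ← Finset.sum_mul, hq1, one_mul]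

/-- The Holevo quantity is the average relative entropy to the mean state, at most one bit because
`ρ x ≤ 2ρ`. It guarantees that the chosen key length is at most `n`. -/
theorem holevo_le_one {ρ : ZMod 2 → Matrix ι ι ℂ} (hρ : ∀ x, (ρ x).PosSemidef)
    (h1 : ∀ x, (ρ x).trace = 1) : holevo ρ ≤ 1 := by
  obtain ⟨W, hW, p, hp, h⟩ := exists_eq_ofSpectrum_nonneg (posSemidef_avg hρ)
  have h2 : 0 < Real.log 2 := Real.log_pos (by norm_num)
  have hle : ∀ x, ((2 : ℂ) • ofSpectrum W p - ρ x).PosSemidef := by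
    intro x
    rw [← h, smul_smul, zmod_two_sum]
    norm_num
    obtain rfl | rfl : x = 0 ∨ x = 1 := by revert x; decide
    · simpa using hρ 1
    · simpa using hρ 0
  have hx : ∀ x, (∑ i, ((Wᴴ * ρ x * W) i i).re * (-Real.log (p i))) / Real.log 2 ≤
      entropy (ρ x) + 1 := by
    intro x
    have hl := hle x
    have ht := h1 x
    obtain ⟨W', hW', q, hq, e⟩ := exists_eq_ofSpectrum_nonneg (hρ x)
    rw [e] at hl ht ⊢
    rw [entropy_ofSpectrum hW', div_add_one h2.ne']
    have := cross_entropy_le hW hW' hp hq (sum_eq_one_of_trace hW' ht) hl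
    gcongr
  have hS : ∑ i, Real.negMulLog (p i) =
      1 / 2 * (∑ i, ((Wᴴ * ρ 0 * W) i i).re * (-Real.log (p i))) +
      1 / 2 * (∑ i, ((Wᴴ * ρ 1 * W) i i).re * (-Real.log (p i))) := by
    rw [Finset.mul_sum, Finset.mul_sum, ← Finset.sum_add_distrib]
    refine Finset.sum_congr rfl fun i _ => ?_
    have := diag_avg hW h i
    rw [Real.negMulLog]
    linear_combination (-Real.log (p i)) * this
  rw [holevo, h, entropy_ofSpectrum hW, zmod_two_sum, hS, add_div, mul_div_assoc, mul_div_assoc]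
  have := hx 0
  have := hx 1
  linarith

end Entropy

/-! ### Tensor powers -/

section Tensor

variable {ι : Type*} [Fintype ι] [DecidableEq ι]

/-- The tensor power `M^{⊗n}`. -/
def tensorPow (n : ℕ) (M : Matrix ι ι ℂ) : Matrix (Fin n → ι) (Fin n → ι) ℂ :=
  Matrix.of fun p q => ∏ i, M (p i) (q i)

theorem tensorPow_mul (n : ℕ) (A B : Matrix ι ι ℂ) :
    tensorPow n (A * B) = tensorPow n A * tensorPow n B := by
  ext p q
  simp only [tensorPow, Matrix.mul_apply, Matrix.of_apply, ← Finset.prod_mul_distrib]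
  rw [Finset.prod_univ_sum]
  simp

theorem conjTranspose_tensorPow (n : ℕ) (A : Matrix ι ι ℂ) :
    (tensorPow n A)ᴴ = tensorPow n Aᴴ := by
  ext p q
  simp [tensorPow]

theorem tensorPow_diagonal (n : ℕ) (d : ι → ℂ) :
    tensorPow n (Matrix.diagonal d) = Matrix.diagonal fun j => ∏ i, d (j i) := by
  ext p q
  simp only [tensorPow, Matrix.of_apply, Matrix.diagonal_apply]
  split_ifs with h
  · simp [h]
  · obtain ⟨i, hi⟩ := Function.ne_iff.1 h
    exact Finset.prod_eq_zero (Finset.mem_univ i) (by simp [hi])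

theorem tensorPow_one (n : ℕ) : tensorPow n (1 : Matrix ι ι ℂ) = 1 := by
  rw [← Matrix.diagonal_one, tensorPow_diagonal]
  simp

theorem tensorPow_mem_unitaryGroup (n : ℕ) {W : Matrix ι ι ℂ}
    (hW : W ∈ Matrix.unitaryGroup ι ℂ) :
    tensorPow n W ∈ Matrix.unitaryGroup (Fin n → ι) ℂ := by
  rw [Matrix.mem_unitaryGroup_iff, Matrix.star_eq_conjTranspose, conjTranspose_tensorPow,
    ← tensorPow_mul, show W * Wᴴ = 1 from Matrix.mem_unitaryGroup_iff.1 hW, tensorPow_one]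

theorem tensorPow_ofSpectrum (n : ℕ) (W : Matrix ι ι ℂ) (p : ι → ℝ) :
    tensorPow n (ofSpectrum W p) = ofSpectrum (tensorPow n W) fun j => ∏ i, p (j i) := by
  rw [ofSpectrum, tensorPow_mul, tensorPow_mul, tensorPow_diagonal, ← conjTranspose_tensorPow,
    ofSpectrum]
  simp

theorem posSemidef_tensorPow (n : ℕ) {A : Matrix ι ι ℂ} (hA : A.PosSemidef) :
    (tensorPow n A).PosSemidef := by
  obtain ⟨W, hW, p, hp, rfl⟩ := exists_eq_ofSpectrum_nonneg hA
  rw [tensorPow_ofSpectrum]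
  exact posSemidef_ofSpectrum _ fun j => Finset.prod_nonneg fun i _ => hp _

theorem trace_tensorPow (n : ℕ) (A : Matrix ι ι ℂ) : (tensorPow n A).trace = A.trace ^ n := by
  simp only [Matrix.trace, Matrix.diag_apply, tensorPow, Matrix.of_apply]
  rw [Finset.sum_pow', Fintype.piFinset_univ]

end Tensor

/-! ### Typical subspaces -/

section Typical

variable {ι : Type*} [Fintype ι] [DecidableEq ι]

theorem isProj_typicalProj (n : ℕ) (s δ : ℝ) {σ : Matrix ι ι ℂ} (hσ : σ.IsHermitian) :
    IsProj (typicalProj n s δ σ) :=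
  isProj_cfc (fun t => by split_ifs <;> simp) hσ

theorem typicalProj_le (n : ℕ) (s δ : ℝ) {σ : Matrix ι ι ℂ} (hσ : σ.PosSemidef) :
    ((((2 : ℝ) ^ (n * (s + δ)) : ℝ) : ℂ) • σ - typicalProj n s δ σ).PosSemidef := by
  obtain ⟨W, hW, p, hp, rfl⟩ := exists_eq_ofSpectrum_nonneg hσ
  rw [typicalProj, cfc_ofSpectrum _ hW, ofSpectrum_smul, ofSpectrum_sub]
  refine posSemidef_ofSpectrum W fun i => ?_
  simp only [Pi.sub_apply, Pi.smul_apply, smul_eq_mul, Function.comp_apply]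
  have h0 : (0 : ℝ) < 2 ^ (n * (s + δ)) := by positivity
  split_ifs with h
  · have h1 := mul_le_mul_of_nonneg_left h.1 h0.le
    rw [Real.rpow_neg (by norm_num), mul_inv_cancel₀ h0.ne'] at h1
    linarith
  · have := mul_nonneg h0.le (hp i)
    linarith

theorem typicalProj_conj_le (n : ℕ) (s δ : ℝ) {σ : Matrix ι ι ℂ} (hσ : σ.PosSemidef) :
    ((((2 : ℝ) ^ (-(n * (s - δ))) : ℝ) : ℂ) • (1 : Matrix ι ι ℂ) -
      typicalProj n s δ σ * σ * typicalProj n s δ σ).PosSemidef := by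
  obtain ⟨W, hW, p, hp, rfl⟩ := exists_eq_ofSpectrum_nonneg hσ
  rw [typicalProj, cfc_ofSpectrum _ hW, ofSpectrum_mul hW, ofSpectrum_mul hW, ← ofSpectrum_one hW,
    ofSpectrum_smul, ofSpectrum_sub]
  refine posSemidef_ofSpectrum W fun i => ?_
  simp only [Pi.sub_apply, Pi.smul_apply, smul_eq_mul, Function.comp_apply, Pi.mul_apply,
    Pi.one_apply]
  have h0 : (0 : ℝ) < 2 ^ (-(n * (s - δ))) := by positivity
  split_ifs with h
  · linarith [h.2]
  · linarith

/-- Every eigenvalue counted is at least `2^{-n(s+δ)}`, and the eigenvalues sum to one. -/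
theorem rank_typicalProj_le (n : ℕ) (s δ : ℝ) {σ : Matrix ι ι ℂ} (hσ : σ.PosSemidef)
    (h1 : σ.trace = 1) : ((typicalProj n s δ σ).rank : ℝ) ≤ 2 ^ (n * (s + δ)) := by
  classical
  obtain ⟨W, hW, p, hp, rfl⟩ := exists_eq_ofSpectrum_nonneg hσ
  have hsum := sum_eq_one_of_trace hW h1
  rw [typicalProj, cfc_ofSpectrum _ hW]
  set f : ℝ → ℝ := fun t =>
    if (2 : ℝ) ^ (-(n * (s + δ))) ≤ t ∧ t ≤ (2 : ℝ) ^ (-(n * (s - δ))) then 1 else 0 with hf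
  have hr : (ofSpectrum W (f ∘ p)).rank ≤ Fintype.card {i // f (p i) ≠ 0} := by
    rw [ofSpectrum]
    refine ((Matrix.rank_mul_le_left _ _).trans (Matrix.rank_mul_le_right _ _)).trans ?_
    rw [Matrix.rank_diagonal]
    simp
  have h0 : (0 : ℝ) < 2 ^ (n * (s + δ)) := by positivity
  calc ((ofSpectrum W (f ∘ p)).rank : ℝ) ≤ Fintype.card {i // f (p i) ≠ 0} := by exact_mod_cast hr
    _ = ∑ i, (if f (p i) ≠ 0 then (1 : ℝ) else 0) := by
        rw [Fintype.card_subtype, Finset.sum_boole]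
    _ ≤ ∑ i, 2 ^ (n * (s + δ)) * p i := by
        refine Finset.sum_le_sum fun i _ => ?_
        split_ifs with h
        · have h2 : (2 : ℝ) ^ (-(n * (s + δ))) ≤ p i := by
            by_contra h3
            exact h (by simp [hf, h3])
          have h4 := mul_le_mul_of_nonneg_left h2 h0.le
          rwa [Real.rpow_neg (by norm_num), mul_inv_cancel₀ h0.ne'] at h4
        · exact mul_nonneg h0.le (hp i)
    _ = 2 ^ (n * (s + δ)) := by rw [← Finset.mul_sum, hsum, mul_one]

/-- Under the product distribution distinct coordinates are independent, so mixed products of a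
centred function have mean zero. -/
theorem sum_prod_mul_mul {p g : ι → ℝ} (hp : ∑ i, p i = 1) (hg : ∑ i, p i * g i = 0) {n : ℕ}
    (a b : Fin n) : ∑ j : Fin n → ι, (∏ i, p (j i)) * (g (j a) * g (j b)) =
      if a = b then ∑ i, p i * g i ^ 2 else 0 := by
  have e : ∀ j : Fin n → ι, (∏ i, p (j i)) * (g (j a) * g (j b)) =
      ∏ i, p (j i) * ((if i = a then g (j i) else 1) * (if i = b then g (j i) else 1)) := by
    intro j
    rw [Finset.prod_mul_distrib, Finset.prod_mul_distrib]
    simp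
  simp only [e]
  have e2 := Finset.prod_univ_sum (fun _ : Fin n => (Finset.univ : Finset ι))
    (fun i k => p k * ((if i = a then g k else 1) * (if i = b then g k else 1)))
  rw [Fintype.piFinset_univ] at e2
  rw [← e2]
  split_ifs with h
  · subst h
    rw [Finset.prod_eq_single a]
    · simp [sq]
    · intro i _ hi; simp [hi, hp]
    · simp
  · refine Finset.prod_eq_zero (Finset.mem_univ a) ?_
    simpa [h] using hg

/-- Variance of a sum of independent centred variables. -/
theorem sum_prod_mul_sum_sq {p g : ι → ℝ} (hp : ∑ i, p i = 1) (hg : ∑ i, p i * g i = 0) (n : ℕ) :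
    ∑ j : Fin n → ι, (∏ i, p (j i)) * (∑ i, g (j i)) ^ 2 = n * ∑ i, p i * g i ^ 2 := by
  have e : ∀ j : Fin n → ι, (∏ i, p (j i)) * (∑ i, g (j i)) ^ 2 =
      ∑ a, ∑ b, (∏ i, p (j i)) * (g (j a) * g (j b)) := fun j => by
    rw [sq, Finset.sum_mul_sum, Finset.mul_sum]
    simp only [Finset.mul_sum]
  simp only [e]
  rw [Finset.sum_comm]
  have : ∀ a : Fin n, ∑ j : Fin n → ι, ∑ b, (∏ i, p (j i)) * (g (j a) * g (j b)) =
      ∑ i, p i * g i ^ 2 := by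
    intro a
    rw [Finset.sum_comm]
    simp only [sum_prod_mul_mul hp hg]
    simp
  simp only [this]
  simp [Finset.mul_sum]

/-- The state `M^{⊗n}` has little weight outside its typical subspace. -/
theorem exists_typical_bound {M : Matrix ι ι ℂ} (hM : M.PosSemidef) (h1 : M.trace = 1) :
    ∃ C : ℝ, 0 ≤ C ∧ ∀ (n : ℕ) (δ : ℝ), 0 < n → 0 < δ →
      (tensorPow n M * (1 - typicalProj n (entropy M) δ (tensorPow n M))).trace.re ≤
        C / (n * δ ^ 2) := by
  obtain ⟨W, hW, p, hp, rfl⟩ := exists_eq_ofSpectrum_nonneg hM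
  have hp1 := sum_eq_one_of_trace hW h1
  set s := entropy (ofSpectrum W p) with hs
  rw [entropy_ofSpectrum hW] at hs
  have hl2 : 0 < Real.log 2 := Real.log_pos (by norm_num)
  -- The surprisal centred at its mean. Where `p i = 0` the value `Real.logb 2 0 = 0` is harmless,
  -- as it is always weighted by `p i`.
  set g : ι → ℝ := fun i => -Real.logb 2 (p i) - s with hg
  have hpg : ∑ i, p i * g i = 0 := by
    have : ∀ i, p i * g i = Real.negMulLog (p i) / Real.log 2 - p i * s := fun i => by
      simp only [hg, Real.negMulLog, Real.logb]; ring
    simp only [this]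
    rw [Finset.sum_sub_distrib, ← Finset.sum_div, ← Finset.sum_mul, hp1, ← hs]
    ring
  refine ⟨∑ i, p i * g i ^ 2, Finset.sum_nonneg fun i _ => mul_nonneg (hp i) (sq_nonneg _), ?_⟩
  intro n δ hn hδ
  have hn' : (0 : ℝ) < n := by exact_mod_cast hn
  have hWn := tensorPow_mem_unitaryGroup n hW
  rw [tensorPow_ofSpectrum, typicalProj, cfc_ofSpectrum _ hWn]
  rw [← ofSpectrum_one hWn, ofSpectrum_sub, ofSpectrum_mul hWn, trace_ofSpectrum hWn,
    Complex.ofReal_re]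
  -- Chebyshev's inequality termwise: an atypical string of positive weight has `|∑ g| ≥ nδ`.
  have key : ∀ j : Fin n → ι, (∏ i, p (j i)) * (1 - (if (2 : ℝ) ^ (-(n * (s + δ))) ≤ ∏ i, p (j i) ∧
      ∏ i, p (j i) ≤ (2 : ℝ) ^ (-(n * (s - δ))) then 1 else 0)) ≤
      (∏ i, p (j i)) * (∑ i, g (j i)) ^ 2 / (n * δ) ^ 2 := by
    intro j
    have hP0 : 0 ≤ ∏ i, p (j i) := Finset.prod_nonneg fun i _ => hp _
    split_ifs with h
    · rw [sub_self, mul_zero]; positivity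
    rw [sub_zero, mul_one]
    rcases hP0.eq_or_lt with h0 | hpos
    · rw [← h0]; simp
    rw [mul_div_assoc]
    refine le_mul_of_one_le_right hP0 ?_
    rw [one_le_div (by positivity)]
    have hne : ∀ i, p (j i) ≠ 0 := fun i hi => hpos.ne' (Finset.prod_eq_zero (Finset.mem_univ i) hi)
    have hlog : Real.logb 2 (∏ i, p (j i)) = -∑ i, g (j i) - n * s := by
      rw [Real.logb, Real.log_prod fun i _ => hne i, Finset.sum_div]
      simp only [hg, Real.logb, Finset.sum_sub_distrib, Finset.sum_neg_distrib]
      simp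
    have hpow : (2 : ℝ) ^ Real.logb 2 (∏ i, p (j i)) = ∏ i, p (j i) :=
      Real.rpow_logb (by norm_num) (by norm_num) hpos
    rw [← hpow, Real.rpow_le_rpow_left_iff (by norm_num), Real.rpow_le_rpow_left_iff (by norm_num),
      hlog] at h
    have habs : n * δ ≤ |∑ i, g (j i)| := by
      by_contra! hlt
      rw [abs_lt] at hlt
      exact h ⟨by linarith [hlt.2], by linarith [hlt.1]⟩
    rw [← sq_abs (∑ i, g (j i))]
    gcongr
  refine (Finset.sum_le_sum fun j _ => key j).trans (le_of_eq ?_)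
  rw [← Finset.sum_div, sum_prod_mul_sum_sq hp1 hpg]
  field_simp

end Typical

/-! ### Covariant pretty good measurements -/

section CovariantPGM

variable {r : ℕ} {K : Type*} [Fintype K] [DecidableEq K]
  {P N : Matrix (Bits r × K) (Bits r × K) ℂ}

theorem conj_conj_of_commute {ι : Type*} [Fintype ι] {A D : Matrix ι ι ℂ} (h : A * D = D * A)
    (X : Matrix ι ι ℂ) : A * (D * X * D) * A = D * (A * X * A) * D :=
  calc A * (D * X * D) * A = (A * D) * X * (D * A) := by simp only [Matrix.mul_assoc]
    _ = (D * A) * X * (A * D) := by rw [h]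
    _ = _ := by simp only [Matrix.mul_assoc]

/-- The operators `P Z^y N Z^y P`. -/
noncomputable def covariantFamily (P N : Matrix (Bits r × K) (Bits r × K) ℂ) (y : Bits r) :
    Matrix (Bits r × K) (Bits r × K) ℂ :=
  P * (phaseOp K y * N * phaseOp K y) * P

theorem covariantFamily_eq (hPc : ∀ y, phaseOp K y * P * phaseOp K y = P) (y : Bits r) :
    covariantFamily P N y = phaseOp K y * (P * N * P) * phaseOp K y := by
  have h1 : P * phaseOp K y = phaseOp K y * P := by
    conv_lhs => rw [← hPc y]
    rw [Matrix.mul_assoc, phaseOp_mul_self, Matrix.mul_one]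
  exact conj_conj_of_commute h1 N

theorem posSemidef_covariantFamily (hP : IsProj P) (hN : IsProj N) (y : Bits r) :
    (covariantFamily P N y).PosSemidef :=
  posSemidef_conj_of_isHermitian
    (posSemidef_conj_of_isHermitian hN.posSemidef (isHermitian_phaseOp y)) hP.1

theorem posSemidef_sum_covariantFamily (hP : IsProj P) (hN : IsProj N) (s : Finset (Bits r)) :
    (∑ y ∈ s, covariantFamily P N y).PosSemidef :=
  Matrix.posSemidef_sum s fun y _ => posSemidef_covariantFamily hP hN y

theorem covariantFamily_zero : covariantFamily P N 0 = P * N * P := by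
  rw [covariantFamily, phaseOp_zero, Matrix.one_mul, Matrix.mul_one]

/-- The sum of the family is invariant under each `Z^y`, so its inverse square root commutes with
`Z^y`. -/
theorem prettyGood_covariant (hP : IsProj P) (hN : IsProj N)
    (hPc : ∀ y, phaseOp K y * P * phaseOp K y = P) (y : Bits r) :
    prettyGood (covariantFamily P N) y =
      phaseOp K y * prettyGood (covariantFamily P N) 0 * phaseOp K y := by
  set T := ∑ y, covariantFamily P N y with hT
  have hTH : T.IsHermitian := (posSemidef_sum_covariantFamily hP hN _).1
  have hTc : phaseOp K y * T * phaseOp K y = T := by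
    simp only [hT, covariantFamily_eq hPc]
    exact phaseOp_conj_sum y _
  have hRc : phaseOp K y * invSqrt T * phaseOp K y = invSqrt T := by
    have := cfc_phaseOp_conj (fun t : ℝ => (√t)⁻¹) y hTH
    rw [hTc] at this
    exact this.symm
  have h1 : invSqrt T * phaseOp K y = phaseOp K y * invSqrt T := by
    conv_lhs => rw [← hRc]
    rw [Matrix.mul_assoc, phaseOp_mul_self, Matrix.mul_one]
  rw [prettyGood, prettyGood, ← hT, covariantFamily_zero, covariantFamily_eq hPc]
  exact conj_conj_of_commute h1 _

theorem posSemidef_prettyGood_covariant (hP : IsProj P) (hN : IsProj N) (y : Bits r) :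
    (prettyGood (covariantFamily P N) y).PosSemidef :=
  posSemidef_conj_of_isHermitian (posSemidef_covariantFamily hP hN y) (isHermitian_invSqrt _)

theorem isProj_sum_prettyGood (hP : IsProj P) (hN : IsProj N) :
    IsProj (∑ y, prettyGood (covariantFamily P N) y) := by
  simp only [prettyGood]
  rw [← Finset.sum_mul, ← Finset.mul_sum]
  exact invSqrt_conj_isProj (posSemidef_sum_covariantFamily hP hN _)

theorem rank_prettyGood_covariant_le :
    (prettyGood (covariantFamily P N) 0).rank ≤ N.rank := by
  rw [prettyGood, covariantFamily_zero]
  refine (Matrix.rank_mul_le_left _ _).trans ((Matrix.rank_mul_le_right _ _).trans ?_)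
  exact (Matrix.rank_mul_le_left _ _).trans (Matrix.rank_mul_le_right _ _)

/-- By covariance of states and measurement every `y` has the same success probability. -/
theorem sum_trace_prettyGood_covariant (hP : IsProj P) (hN : IsProj N)
    (hPc : ∀ y, phaseOp K y * P * phaseOp K y = P) (σ : Matrix (Bits r × K) (Bits r × K) ℂ) :
    (1 / 2 : ℝ) ^ r * ∑ y, (phaseOp K y * σ * phaseOp K y *
      prettyGood (covariantFamily P N) y).trace.re =
      (σ * prettyGood (covariantFamily P N) 0).trace.re := by
  have : ∀ y, (phaseOp K y * σ * phaseOp K y * prettyGood (covariantFamily P N) y).trace =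
      (σ * prettyGood (covariantFamily P N) 0).trace := by
    intro y
    rw [prettyGood_covariant hP hN hPc]
    set F := prettyGood (covariantFamily P N) 0
    rw [show phaseOp K y * σ * phaseOp K y * (phaseOp K y * F * phaseOp K y) =
      phaseOp K y * (σ * (phaseOp K y * phaseOp K y) * F * phaseOp K y) by
        simp only [Matrix.mul_assoc], phaseOp_mul_self, Matrix.trace_mul_comm, Matrix.mul_one,
      Matrix.mul_assoc _ _ (phaseOp K y), phaseOp_mul_self, Matrix.mul_one]
  simp only [this, Finset.sum_const, Finset.card_univ, nsmul_eq_mul]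
  rw [← mul_assoc]
  simp [ZMod.card]

/-- Error probability of the covariant pretty good measurement. -/
theorem one_sub_trace_prettyGood_le (hP : IsProj P) (hN : IsProj N)
    {σ : Matrix (Bits r × K) (Bits r × K) ℂ} (hσ : σ.PosSemidef) (h1 : σ.trace = 1) :
    1 - (σ * prettyGood (covariantFamily P N) 0).trace.re ≤
      6 * (σ * (1 - P)).trace.re + 4 * (σ * (1 - N)).trace.re +
        4 * ∑ y ∈ Finset.univ.erase 0, (σ * covariantFamily P N y).trace.re := by
  set T := ∑ y ∈ Finset.univ.erase 0, covariantFamily P N y with hT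
  have hsum : ∑ y, covariantFamily P N y = P * N * P + T := by
    rw [← Finset.add_sum_erase _ _ (Finset.mem_univ (0 : Bits r)), covariantFamily_zero]
  have hPN : (P * N * P).PosSemidef := posSemidef_conj_of_isHermitian hN.posSemidef hP.1
  have hPN1 : (1 - P * N * P).PosSemidef := by
    have : 1 - P * N * P = (1 - P) + P * (1 - N) * P := by
      rw [Matrix.mul_sub, Matrix.sub_mul, Matrix.mul_one, hP.2]; abel
    rw [this]
    exact hP.one_sub.posSemidef.add
      (posSemidef_conj_of_isHermitian hN.one_sub.posSemidef hP.1)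
  -- Here `A = PNP` belongs to `y = 0` and `T` collects all other `y`. Doubling `1 - PNP ≤ 3(1-P) +
  -- 2(1-N)` produces the constants 6 and 4.
  have hHN := hayashi_nagaoka hPN hPN1 (posSemidef_sum_covariantFamily hP hN (Finset.univ.erase 0))
  rw [← hT, ← hsum] at hHN
  have e1 := trace_mul_re_le hσ hHN
  have e2 := trace_mul_re_le hσ (posSemidef_one_sub_conj hP hN)
  have hre : ∀ (a : ℝ) (M : Matrix (Bits r × K) (Bits r × K) ℂ),
      (σ * ((a : ℂ) • M)).trace.re = a * (σ * M).trace.re := fun a M => by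
    rw [Matrix.mul_smul, Matrix.trace_smul, smul_eq_mul, Complex.re_ofReal_mul]
  have hTs : (σ * T).trace.re =
      ∑ y ∈ Finset.univ.erase 0, (σ * covariantFamily P N y).trace.re := by
    rw [hT, Finset.mul_sum, Matrix.trace_sum, Complex.re_sum]
  have h2 := hre 2
  have h3 := hre 3
  have h4 := hre 4
  push_cast at h2 h3 h4
  have hF : (σ * (1 - invSqrt (∑ y, covariantFamily P N y) * (P * N * P) *
      invSqrt (∑ y, covariantFamily P N y))).trace.re =
      1 - (σ * prettyGood (covariantFamily P N) 0).trace.re := by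
    rw [Matrix.mul_sub, Matrix.mul_one, Matrix.trace_sub, Complex.sub_re, h1, Complex.one_re,
      prettyGood, covariantFamily_zero]
  rw [Matrix.mul_add, Matrix.trace_add, Complex.add_re, h2, h4, hF, hTs] at e1
  rw [Matrix.mul_add, Matrix.trace_add, Complex.add_re, h2, h3] at e2
  linarith

end CovariantPGM

/-! ### The states of the protocol -/

section States

variable {S E : Type*} [Fintype S] [DecidableEq S] [Fintype E] [DecidableEq E]

/-- The perfect correlation of `A` with `B` collapses both sums over `A`, and the amplitudes of
`|x̃⟩` become the phases of `Z^x` on `B`. -/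
theorem ensemble_apply (φ : ZMod 2 → S × E → ℂ) (x : ZMod 2) (p q : ZMod 2 × S) :
    ensemble φ x p q = (-1) ^ (x * p.1).val * (-1) ^ (x * q.1).val *
      (1 / 2 * ∑ e, φ p.1 (p.2, e) * star (φ q.1 (q.2, e))) := by
  have h2 : ((√2 : ℝ) : ℂ)⁻¹ * ((√2 : ℝ) : ℂ)⁻¹ = 1 / 2 := by
    simpa using inv_sqrt_two_pow_mul_self 1
  simp only [ensemble, condState, Matrix.smul_apply, Matrix.of_apply, inputState, smul_eq_mul]
  rw [Finset.sum_eq_single p.1, Finset.sum_eq_single q.1, Finset.mul_sum, Finset.mul_sum,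
    Finset.mul_sum]
  · refine Finset.sum_congr rfl fun e _ => ?_
    simp only [if_true, xKetBit_eq, star_mul', star_pow, star_neg, star_one, star_inv₀,
      Complex.star_def, Complex.conj_ofReal, div_eq_mul_inv (φ _ _)]
    linear_combination 2 * (-1) ^ (x * p.1).val * (-1) ^ (x * q.1).val *
      φ p.1 (p.2, e) * (starRingEnd ℂ) (φ q.1 (q.2, e)) *
      (((√2 : ℝ) : ℂ)⁻¹ * ((√2 : ℝ) : ℂ)⁻¹ + 1 / 2) * h2
  · intro b _ hb; simp [hb]
  · simp
  · intro b _ hb; simp [hb]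
  · simp

theorem ensemble_eq_conj (φ : ZMod 2 → S × E → ℂ) (x : ZMod 2) :
    ensemble φ x = Matrix.diagonal (fun p : ZMod 2 × S => (-1 : ℂ) ^ (x * p.1).val) *
      ensemble φ 0 * (Matrix.diagonal fun p : ZMod 2 × S => (-1 : ℂ) ^ (x * p.1).val)ᴴ := by
  ext p q
  rw [Matrix.diagonal_conjTranspose, Matrix.mul_diagonal, Matrix.diagonal_mul, ensemble_apply,
    ensemble_apply]
  simp
  ring

theorem posSemidef_ensemble_zero (φ : ZMod 2 → S × E → ℂ) : (ensemble φ 0).PosSemidef := by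
  set X : Matrix (ZMod 2 × S) E ℂ := Matrix.of fun p e => φ p.1 (p.2, e)
  have : ensemble φ 0 = (1 / 2 : ℂ) • (X * Xᴴ) := by
    ext p q
    rw [ensemble_apply, Matrix.smul_apply, Matrix.mul_apply]
    simp [X]
  rw [this]
  exact (Matrix.posSemidef_self_mul_conjTranspose X).smul (Complex.nonneg_iff.2 (by norm_num))

theorem posSemidef_ensemble (φ : ZMod 2 → S × E → ℂ) (x : ZMod 2) : (ensemble φ x).PosSemidef := by
  rw [ensemble_eq_conj]
  exact (posSemidef_ensemble_zero φ).mul_mul_conjTranspose_same _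

theorem trace_ensemble {φ : ZMod 2 → S × E → ℂ} (hφ : ∀ k, IsNormalized (φ k)) (x : ZMod 2) :
    (ensemble φ x).trace = 1 := by
  have hk : ∀ k, ∑ s, ∑ e, φ k (s, e) * star (φ k (s, e)) = 1 := by
    intro k
    have := hφ k
    rw [IsNormalized, Fintype.sum_prod_type] at this
    simp only [Complex.star_def, Complex.mul_conj, Complex.normSq_eq_norm_sq]
    exact_mod_cast this
  have hs : ∀ k : ℕ, (-1 : ℂ) ^ k * (-1) ^ k = 1 := fun k => by rw [← mul_pow]; simp
  simp only [Matrix.trace, Matrix.diag_apply, ensemble_apply, hs, one_mul,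
    Fintype.sum_prod_type, ← Finset.mul_sum, hk]
  simp [ZMod.card]

theorem entropy_ensemble (φ : ZMod 2 → S × E → ℂ) (x : ZMod 2) :
    entropy (ensemble φ x) = entropy (ensemble φ 0) := by
  rw [ensemble_eq_conj φ x]
  refine entropy_unitary_conj ?_ (posSemidef_ensemble_zero φ).1
  rw [Matrix.mem_unitaryGroup_iff, Matrix.star_eq_conjTranspose, Matrix.diagonal_conjTranspose,
    Matrix.diagonal_mul_diagonal, ← Matrix.diagonal_one]
  congr 1; ext p
  simp [← mul_pow]

theorem half_sum_entropy_ensemble (φ : ZMod 2 → S × E → ℂ) :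
    1 / 2 * ∑ x, entropy (ensemble φ x) = entropy (ensemble φ 0) := by
  rw [zmod_two_sum, entropy_ensemble φ 1]; ring

theorem holevo_ensemble (φ : ZMod 2 → S × E → ℂ) :
    holevo (ensemble φ) = entropy (avgState φ) - entropy (ensemble φ 0) := by
  rw [holevo, half_sum_entropy_ensemble, avgState]

theorem avgState_apply (φ : ZMod 2 → S × E → ℂ) (p q : ZMod 2 × S) :
    avgState φ p q = if p.1 = q.1 then ensemble φ 0 p q else 0 := by
  rw [avgState, zmod_two_sum, Matrix.smul_apply, Matrix.add_apply, ensemble_apply, ensemble_apply]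
  have h : ∀ a b : ZMod 2, (-1 : ℂ) ^ (1 * a).val * (-1) ^ (1 * b).val =
      if a = b then 1 else -1 := by
    intro a b
    rw [one_mul, one_mul, ← neg_one_pow_val_add]
    split_ifs with hab
    · subst hab; rw [CharTwo.add_self_eq_zero]; simp
    · have : a + b = 1 := by revert a b; decide
      rw [this]; simp [show (1 : ZMod 2).val = 1 from rfl]
  rw [h]
  split_ifs <;> simp
  ring

theorem posSemidef_avgState (φ : ZMod 2 → S × E → ℂ) : (avgState φ).PosSemidef :=
  posSemidef_avg (posSemidef_ensemble φ)

theorem trace_avgState {φ : ZMod 2 → S × E → ℂ} (hφ : ∀ k, IsNormalized (φ k)) :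
    (avgState φ).trace = 1 := by
  rw [avgState, Matrix.trace_smul, Matrix.trace_sum]
  simp only [trace_ensemble hφ]
  simp [ZMod.card]

/-- `Z^x ⊗ 1` on `n` copies of `BS`. -/
noncomputable def zOp {n : ℕ} (S : Type*) [DecidableEq S] (x : Bits n) :
    Matrix (Fin n → ZMod 2 × S) (Fin n → ZMod 2 × S) ℂ :=
  Matrix.diagonal fun j => zPhase x fun i => (j i).1

variable {n : ℕ}

theorem zOp_conj_apply (x : Bits n) (M : Matrix (Fin n → ZMod 2 × S) (Fin n → ZMod 2 × S) ℂ)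
    (j k : Fin n → ZMod 2 × S) :
    (zOp S x * M * zOp S x) j k =
      zPhase x (fun i => (j i).1) * M j k * zPhase x (fun i => (k i).1) := by
  simp [zOp]

theorem zOp_mul_self (x : Bits n) : zOp S x * zOp S x = 1 := by
  rw [zOp, Matrix.diagonal_mul_diagonal]
  simp only [zPhase_mul_self]
  exact Matrix.diagonal_one

theorem isHermitian_zOp (x : Bits n) : (zOp S x).IsHermitian :=
  Matrix.isHermitian_diagonal_iff.2 fun _ => star_zPhase x _

theorem zOp_mem_unitaryGroup (x : Bits n) :
    zOp S x ∈ Matrix.unitaryGroup (Fin n → ZMod 2 × S) ℂ := by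
  rw [Matrix.mem_unitaryGroup_iff, Matrix.star_eq_conjTranspose, (isHermitian_zOp x).eq,
    zOp_mul_self]

theorem tensorPow_avgState_apply (φ : ZMod 2 → S × E → ℂ) (j k : Fin n → ZMod 2 × S) :
    tensorPow n (avgState φ) j k = if (fun i => (j i).1) = (fun i => (k i).1) then
      tensorPow n (ensemble φ 0) j k else 0 := by
  simp only [tensorPow, Matrix.of_apply, avgState_apply]
  split_ifs with h
  · exact Finset.prod_congr rfl fun i _ => if_pos (congrFun h i)
  · obtain ⟨i, hi⟩ := Function.ne_iff.1 h
    exact Finset.prod_eq_zero (Finset.mem_univ i) (if_neg hi)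

/-- Uniformly random phases on all `n` qubits dephase each of them, which turns the state of the
zero string into the average state. -/
theorem sum_zOp_conj (φ : ZMod 2 → S × E → ℂ) :
    ∑ x : Bits n, zOp S x * tensorPow n (ensemble φ 0) * zOp S x =
      (2 : ℂ) ^ n • tensorPow n (avgState φ) := by
  ext j k
  rw [Matrix.sum_apply, Matrix.smul_apply, tensorPow_avgState_apply]
  simp only [zOp_conj_apply]
  have : ∀ x : Bits n, zPhase x (fun i => (j i).1) * tensorPow n (ensemble φ 0) j k *
      zPhase x (fun i => (k i).1) =
      (zPhase x (fun i => (j i).1) * zPhase x (fun i => (k i).1)) *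
        tensorPow n (ensemble φ 0) j k := fun x => by ring
  simp only [this, ← Finset.sum_mul, sum_zPhase_mul]
  split_ifs <;> simp

theorem zOp_conj_tensorPow_avgState (φ : ZMod 2 → S × E → ℂ) (x : Bits n) :
    zOp S x * tensorPow n (avgState φ) * zOp S x = tensorPow n (avgState φ) := by
  ext j k
  rw [zOp_conj_apply, tensorPow_avgState_apply]
  split_ifs with h
  · rw [h]
    linear_combination (tensorPow n (ensemble φ 0) j k) * zPhase_mul_self x (fun i => (k i).1)
  · simp

end States

/-! ### Overlaps of a codeword state with the other typical subspaces -/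

section Overlap

variable {S E : Type*} [Fintype S] [DecidableEq S] [Fintype E] [DecidableEq E]

/-- Typical projection of the average state of `n` copies. -/
noncomputable def avgTypical (φ : ZMod 2 → S × E → ℂ) (n : ℕ) (δ : ℝ) :
    Matrix (Fin n → ZMod 2 × S) (Fin n → ZMod 2 × S) ℂ :=
  typicalProj n (entropy (avgState φ)) δ (tensorPow n (avgState φ))

/-- Typical projection of the codeword state of the zero string. -/
noncomputable def zeroTypical (φ : ZMod 2 → S × E → ℂ) (n : ℕ) (δ : ℝ) :
    Matrix (Fin n → ZMod 2 × S) (Fin n → ZMod 2 × S) ℂ :=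
  typicalProj n (entropy (ensemble φ 0)) δ (tensorPow n (ensemble φ 0))

/-- Overlap of the state of the zero string with the typical subspace of the string `x`. -/
noncomputable def overlap (φ : ZMod 2 → S × E → ℂ) (n : ℕ) (δ : ℝ) (x : Bits n) : ℝ :=
  (tensorPow n (ensemble φ 0) * (avgTypical φ n δ *
    (zOp S x * zeroTypical φ n δ * zOp S x) * avgTypical φ n δ)).trace.re

variable {n : ℕ} (φ : ZMod 2 → S × E → ℂ) (δ : ℝ)

theorem isProj_avgTypical : IsProj (avgTypical φ n δ) :=
  isProj_typicalProj _ _ _ (posSemidef_tensorPow n (posSemidef_avgState φ)).1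

theorem isProj_zeroTypical : IsProj (zeroTypical φ n δ) :=
  isProj_typicalProj _ _ _ (posSemidef_tensorPow n (posSemidef_ensemble φ 0)).1

theorem zOp_conj_avgTypical (x : Bits n) :
    zOp S x * avgTypical φ n δ * zOp S x = avgTypical φ n δ := by
  have hH := (posSemidef_tensorPow n (posSemidef_avgState φ)).1
  have := cfc_unitary_conj (fun t : ℝ =>
    open Classical in
    if (2 : ℝ) ^ (-(n * (entropy (avgState φ) + δ))) ≤ t ∧
      t ≤ (2 : ℝ) ^ (-(n * (entropy (avgState φ) - δ))) then 1 else 0)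
    (zOp_mem_unitaryGroup (S := S) x) hH
  rw [(isHermitian_zOp x).eq, zOp_conj_tensorPow_avgState] at this
  exact this.symm

theorem overlap_nonneg (x : Bits n) : 0 ≤ overlap φ n δ x :=
  trace_mul_re_nonneg (posSemidef_tensorPow n (posSemidef_ensemble φ 0))
    (posSemidef_conj_of_isHermitian (posSemidef_conj_of_isHermitian
      (isProj_zeroTypical φ δ).posSemidef (isHermitian_zOp x)) (isProj_avgTypical φ δ).1)

/-- The average typical projection commutes with every `Z^x`, so all strings give it the same
weight, hence that of their average. Typicality of the average thus applies to each single codeword.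
-/
theorem trace_zero_mul_one_sub_avgTypical :
    (tensorPow n (ensemble φ 0) * (1 - avgTypical φ n δ)).trace =
      (tensorPow n (avgState φ) * (1 - avgTypical φ n δ)).trace := by
  have h : ∀ x : Bits n, (zOp S x * tensorPow n (ensemble φ 0) * zOp S x *
      (1 - avgTypical φ n δ)).trace =
      (tensorPow n (ensemble φ 0) * (1 - avgTypical φ n δ)).trace := by
    intro x
    rw [Matrix.mul_assoc, Matrix.trace_mul_cycle, Matrix.trace_mul_comm]
    congr 2
    rw [Matrix.mul_sub, Matrix.sub_mul, Matrix.mul_one, zOp_mul_self, zOp_conj_avgTypical]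
  have h2 := congrArg (fun M => (M * (1 - avgTypical φ n δ)).trace) (sum_zOp_conj (n := n) φ)
  simp only [Finset.sum_mul, Matrix.trace_sum, h, Matrix.smul_mul, Matrix.trace_smul,
    Finset.sum_const, Finset.card_univ, nsmul_eq_mul, smul_eq_mul] at h2
  have hc : ((Fintype.card (Bits n) : ℕ) : ℂ) = 2 ^ n := by simp [ZMod.card]
  rw [hc] at h2
  exact mul_left_cancel₀ (by positivity) h2

/-- The typical projection of a string is at most `2^{n(s+δ)}` times its state; these states sum to
`2^n` times the average; and the average compressed to its typical subspace is at most
`2^{-n(S-δ)}`. -/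
theorem sum_overlap_le (hφ : ∀ k, IsNormalized (φ k)) :
    ∑ x : Bits n, overlap φ n δ x ≤ (2 : ℝ) ^ n *
      ((2 : ℝ) ^ (n * (entropy (ensemble φ 0) + δ)) *
        (2 : ℝ) ^ (-(n * (entropy (avgState φ) - δ)))) := by
  set ω := tensorPow n (ensemble φ 0) with hω
  set ρ := tensorPow n (avgState φ) with hρ
  set P := avgTypical φ n δ with hP
  set N := zeroTypical φ n δ with hN
  set a : ℝ := (2 : ℝ) ^ (n * (entropy (ensemble φ 0) + δ)) with ha
  set b : ℝ := (2 : ℝ) ^ (-(n * (entropy (avgState φ) - δ))) with hb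
  have hωp : ω.PosSemidef := posSemidef_tensorPow n (posSemidef_ensemble φ 0)
  have hω1 : ω.trace = 1 := by rw [hω, trace_tensorPow, trace_ensemble hφ, one_pow]
  have h1 : ∀ x : Bits n, overlap φ n δ x ≤
      a * (ω * (P * (zOp S x * ω * zOp S x) * P)).trace.re := by
    intro x
    have hN' : (((a : ℝ) : ℂ) • ω - N).PosSemidef := typicalProj_le n _ δ hωp
    have h2 := posSemidef_conj_of_isHermitian
      (posSemidef_conj_of_isHermitian hN' (isHermitian_zOp x)) (isProj_avgTypical φ δ).1
    have e : P * (zOp S x * ((a : ℂ) • ω - N) * zOp S x) * P =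
        (a : ℂ) • (P * (zOp S x * ω * zOp S x) * P) - P * (zOp S x * N * zOp S x) * P := by
      simp only [Matrix.mul_sub, Matrix.sub_mul, Matrix.mul_smul, Matrix.smul_mul]
    rw [← hP, e] at h2
    have h3 := trace_mul_re_le hωp h2
    rwa [Matrix.mul_smul, Matrix.trace_smul, smul_eq_mul, Complex.re_ofReal_mul] at h3
  refine (Finset.sum_le_sum fun x _ => h1 x).trans ?_
  have h4 : ∑ x : Bits n, (ω * (P * (zOp S x * ω * zOp S x) * P)).trace.re =
      2 ^ n * (ω * (P * ρ * P)).trace.re := by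
    rw [← Complex.re_sum, ← Matrix.trace_sum, ← Finset.mul_sum, ← Finset.sum_mul,
      ← Finset.mul_sum, sum_zOp_conj, Matrix.mul_smul, Matrix.smul_mul, Matrix.mul_smul,
      Matrix.trace_smul, smul_eq_mul]
    rw [show (2 : ℂ) ^ n = (((2 : ℝ) ^ n : ℝ) : ℂ) by push_cast; rfl, Complex.re_ofReal_mul]
  have h5 : (ω * (P * ρ * P)).trace.re ≤ b := by
    have h6 := trace_mul_re_le hωp (typicalProj_conj_le n (entropy (avgState φ)) δ
      (posSemidef_tensorPow n (posSemidef_avgState φ)))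
    rw [Matrix.mul_smul, Matrix.mul_one, Matrix.trace_smul, hω1, smul_eq_mul, mul_one,
      Complex.ofReal_re] at h6
    exact h6
  rw [← Finset.mul_sum, h4]
  have ha0 : 0 ≤ a := by positivity
  calc a * (2 ^ n * (ω * (P * ρ * P)).trace.re) ≤ a * (2 ^ n * b) := by gcongr
    _ = _ := by ring

end Overlap

/-! ### Encoded registers and the linear code -/

section Registers

variable {S E : Type*} [Fintype S] [DecidableEq S] [Fintype E] [DecidableEq E] {n r m : ℕ}

/-- The encoded registers `B₁ B₂ S` as `n` copies of `BS`. -/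
def regEquiv (S : Type*) (c : Bits n ≃ₗ[ZMod 2] Bits r × Bits m) :
    Bits r × Bits m × (Fin n → S) ≃ (Fin n → ZMod 2 × S) where
  toFun p i := (c.symm (p.1, p.2.1) i, p.2.2 i)
  invFun j := ((c fun i => (j i).1).1, (c fun i => (j i).1).2, fun i => (j i).2)
  left_inv p := by
    have : (c fun i => c.symm (p.1, p.2.1) i) = (p.1, p.2.1) := c.apply_symm_apply _
    simp [this]
  right_inv j := by
    funext i
    simp

/-- The string `x` with `x · k = y · ℓ` for `c k = (ℓ, m)`. -/
def codeword (c : Bits n ≃ₗ[ZMod 2] Bits r × Bits m) (y : Bits r) : Bits n :=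
  fun i => y ⬝ᵥ (c (Pi.single i 1)).1

theorem codeword_dotProduct (c : Bits n ≃ₗ[ZMod 2] Bits r × Bits m) (y : Bits r) (k : Bits n) :
    codeword c y ⬝ᵥ k = y ⬝ᵥ (c k).1 := by
  have hk : k = ∑ i, k i • (Pi.single i 1 : Bits n) := by
    ext j; simp [Finset.sum_apply, Pi.single_apply]
  conv_rhs => rw [hk]
  rw [map_sum, Prod.fst_sum, dotProduct_sum, dotProduct]
  refine Finset.sum_congr rfl fun i _ => ?_
  rw [map_smul, Prod.smul_fst, dotProduct_smul, codeword, smul_eq_mul, mul_comm]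

theorem codeword_injective (c : Bits n ≃ₗ[ZMod 2] Bits r × Bits m) :
    Function.Injective (codeword c) := by
  intro y y' h
  ext j
  have h1 := codeword_dotProduct c y (c.symm (Pi.single j 1, 0))
  have h2 := codeword_dotProduct c y' (c.symm (Pi.single j 1, 0))
  rw [h] at h1
  simpa using h1.symm.trans h2

theorem codeword_zero (c : Bits n ≃ₗ[ZMod 2] Bits r × Bits m) : codeword c 0 = 0 := by
  ext i; simp [codeword]

theorem codeword_check (c : Bits n ≃ₗ[ZMod 2] Bits r × Bits m) (y : Bits r) (i : Fin m) :
    c.symm (0, Pi.single i 1) ⬝ᵥ codeword c y = 0 := by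
  rw [dotProduct_comm, codeword_dotProduct]; simp

theorem phaseOp_eq_submatrix (c : Bits n ≃ₗ[ZMod 2] Bits r × Bits m) (y : Bits r) :
    phaseOp (Bits m × (Fin n → S)) y =
      (zOp S (codeword c y)).submatrix (regEquiv S c) (regEquiv S c) := by
  rw [zOp, Matrix.submatrix_diagonal_equiv, phaseOp]
  congr 1
  funext p
  rw [Function.comp_apply, zPhase_eq, zPhase_eq, codeword_dotProduct]
  have : (c fun i => (regEquiv S c p i).1) = (p.1, p.2.1) := c.apply_symm_apply _
  rw [this]

/-- Amplitudes of the state after the announcement, for `B` (`= A` on the key) and `S`, and `E`. -/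
noncomputable def codeVec (φ : ZMod 2 → S × E → ℂ) (c : Bits n ≃ₗ[ZMod 2] Bits r × Bits m) :
    Matrix (Bits r × Bits m × (Fin n → S)) (Fin n → E) ℂ :=
  Matrix.of fun p e => (((√2 : ℝ) : ℂ)⁻¹) ^ n *
    ∏ i, φ (c.symm (p.1, p.2.1) i) (p.2.2 i, e i)

theorem codeVec_mul_conjTranspose (φ : ZMod 2 → S × E → ℂ)
    (c : Bits n ≃ₗ[ZMod 2] Bits r × Bits m) :
    codeVec φ c * (codeVec φ c)ᴴ =
      (tensorPow n (ensemble φ 0)).submatrix (regEquiv S c) (regEquiv S c) := by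
  ext p q
  rw [Matrix.mul_apply, Matrix.submatrix_apply, tensorPow, Matrix.of_apply]
  simp only [ensemble_apply, zero_mul, ZMod.val_zero, pow_zero, one_mul]
  rw [Finset.prod_mul_distrib, Finset.prod_univ_sum, Fintype.piFinset_univ, Finset.prod_const,
    Finset.card_univ, Fintype.card_fin, ← inv_sqrt_two_pow_mul_self, Finset.mul_sum]
  refine Finset.sum_congr rfl fun e _ => ?_
  simp only [codeVec, Matrix.conjTranspose_apply, Matrix.of_apply, star_mul', regEquiv,
    Equiv.coe_fn_mk, Finset.prod_mul_distrib]
  simp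
  ring

theorem trace_submatrix_equiv {ι κ : Type*} [Fintype ι] [Fintype κ] (e : κ ≃ ι)
    (M : Matrix ι ι ℂ) : (M.submatrix e e).trace = M.trace := by
  simp only [Matrix.trace, Matrix.diag_apply, Matrix.submatrix_apply]
  exact e.sum_comp fun i => M i i

theorem trace_codeVec {φ : ZMod 2 → S × E → ℂ} (hφ : ∀ k, IsNormalized (φ k))
    (c : Bits n ≃ₗ[ZMod 2] Bits r × Bits m) :
    (codeVec φ c * (codeVec φ c)ᴴ).trace = 1 := by
  rw [codeVec_mul_conjTranspose, trace_submatrix_equiv, trace_tensorPow, trace_ensemble hφ,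
    one_pow]

theorem normalize_smul {ι : Type*} [Fintype ι] {v : ι → ℂ} (hv : IsNormalized v) {t : ℝ}
    (ht : 0 < t) : normalize (fun i => (t : ℂ) * v i) = v := by
  have : ∑ j, ‖(t : ℂ) * v j‖ ^ 2 = t ^ 2 := by
    simp only [norm_mul, mul_pow, Complex.norm_real, Real.norm_of_nonneg ht.le]
    rw [← Finset.mul_sum, hv, mul_one]
  funext i
  rw [normalize, this, Real.sqrt_sq ht.le, ← mul_assoc, ← Complex.ofReal_mul,
    inv_mul_cancel₀ ht.ne', Complex.ofReal_one, one_mul]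

theorem isNormalized_sharedKey_codeVec {φ : ZMod 2 → S × E → ℂ} (hφ : ∀ k, IsNormalized (φ k))
    (c : Bits n ≃ₗ[ZMod 2] Bits r × Bits m) : IsNormalized (sharedKey (codeVec φ c)) := by
  rw [IsNormalized, sum_norm_sq_sharedKey, Matrix.trace_mul_comm, trace_codeVec hφ, Complex.one_re]

theorem inputPow_apply (φ : ZMod 2 → S × E → ℂ) (k k' : Bits n) (s : Fin n → S) (e : Fin n → E) :
    inputPow φ n (k, k', s, e) = if k = k' then
      (((√2 : ℝ) : ℂ)⁻¹) ^ n * ∏ i, φ (k i) (s i, e i) else 0 := by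
  simp only [inputPow, inputState]
  split_ifs with h
  · subst h
    simp [div_eq_mul_inv, Finset.prod_mul_distrib, mul_comm]
  · obtain ⟨i, hi⟩ := Function.ne_iff.1 h
    exact Finset.prod_eq_zero (Finset.mem_univ i) (if_neg hi)

/-- Since `A₂` and `B₂` agree, projecting `A₂` on `|h̃⟩` only leaves a factor `2^{-m/2}` and the
phase `(-1)^(h·b₂)`, which `Z^h` cancels. Normalization removes the factor. -/
theorem announced_eq {φ : ZMod 2 → S × E → ℂ} (hφ : ∀ k, IsNormalized (φ k))
    (c : Bits n ≃ₗ[ZMod 2] Bits r × Bits m) (h : Bits m) :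
    announced φ c h = sharedKey (codeVec φ c) := by
  rw [announced, ← normalize_smul (isNormalized_sharedKey_codeVec hφ c)
    (t := (√2)⁻¹ ^ m) (by positivity)]
  congr 1
  funext p
  obtain ⟨a, b, ⟨b₂, s⟩, e⟩ := p
  rw [Finset.sum_eq_single b₂]
  · simp only [inputPow_apply, sharedKey, codeVec, Matrix.of_apply, xKet_eq,
      EmbeddingLike.apply_eq_iff_eq, Prod.mk.injEq, and_true, star_mul', star_zPhase]
    split_ifs with hab
    · subst hab
      have h1 := zPhase_mul_self h b₂
      have hs : star ((((√2 : ℝ) : ℂ)⁻¹) ^ m) = (((√2 : ℝ) : ℂ)⁻¹) ^ m := by simp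
      rw [hs]
      push_cast
      linear_combination ((((√2 : ℝ) : ℂ)⁻¹) ^ m * ((((√2 : ℝ) : ℂ)⁻¹) ^ n *
        ∏ i, φ (c.symm (a, b₂) i) (s i, e i))) * h1
    · simp
  · intro a₂ _ ha
    simp [inputPow_apply, ha]
  · simp

theorem codeState_eq {φ : ZMod 2 → S × E → ℂ} (hφ : ∀ k, IsNormalized (φ k))
    (c : Bits n ≃ₗ[ZMod 2] Bits r × Bits m) (h : Bits m) (y : Bits r) :
    codeState φ c h y = phaseOp (Bits m × (Fin n → S)) y * (codeVec φ c * (codeVec φ c)ᴴ) *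
      phaseOp (Bits m × (Fin n → S)) y := by
  ext p q
  rw [phaseOp_conj_apply, codeState, Matrix.smul_apply, condState, Matrix.of_apply,
    announced_eq hφ, smul_eq_mul, Matrix.mul_apply]
  rw [Finset.sum_eq_single p.1, Finset.sum_eq_single q.1, Finset.mul_sum, Finset.mul_sum,
    Finset.sum_mul]
  · refine Finset.sum_congr rfl fun e _ => ?_
    have hs : star ((((√2 : ℝ) : ℂ)⁻¹) ^ r) = (((√2 : ℝ) : ℂ)⁻¹) ^ r := by simp
    simp only [sharedKey, if_true, xKet_eq, star_mul', star_zPhase, hs,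
      Matrix.conjTranspose_apply]
    have h3 := inv_sqrt_two_pow_mul_self r
    have h4 : (1 / 2 : ℂ) ^ r * 2 ^ r = 1 := by rw [← mul_pow]; norm_num
    linear_combination (zPhase y p.1 * zPhase y q.1 * codeVec φ c p e *
      star (codeVec φ c q e)) * (h4 + 2 ^ r * h3)
  · intro b _ hb; simp [sharedKey, hb]
  · simp
  · intro b _ hb; simp [sharedKey, hb]
  · simp

theorem avgPow_eq (φ : ZMod 2 → S × E → ℂ) (c : Bits n ≃ₗ[ZMod 2] Bits r × Bits m) :
    avgPow φ c = (tensorPow n (avgState φ)).submatrix (regEquiv S c) (regEquiv S c) := rfl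

/-- All functional calculi are transported to the `n`-copy registers, showing that the measurement
is covariant and independent of `h`. -/
theorem bobPGM_eq {φ : ZMod 2 → S × E → ℂ} (hφ : ∀ k, IsNormalized (φ k))
    (c : Bits n ≃ₗ[ZMod 2] Bits r × Bits m) (h : Bits m) (δ : ℝ) :
    bobPGM φ c h δ = prettyGood (covariantFamily
      ((avgTypical φ n δ).submatrix (regEquiv S c) (regEquiv S c))
      ((zeroTypical φ n δ).submatrix (regEquiv S c) (regEquiv S c))) := by
  rw [bobPGM]
  congr 1
  funext y
  have h0 := (posSemidef_tensorPow n (posSemidef_ensemble φ 0)).1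
  rw [covariantFamily, half_sum_entropy_ensemble, typicalProj, typicalProj, codeState_eq hφ,
    avgPow_eq, cfc_submatrix _ _ (posSemidef_tensorPow n (posSemidef_avgState φ)).1,
    codeVec_mul_conjTranspose, cfc_phaseOp_conj _ _ (h0.submatrix _),
    cfc_submatrix _ _ h0]
  rfl

end Registers

/-! ### Random linear codes -/

section Counting

variable {n m : ℕ}

/-- A nonzero string passes `m` random independent parity checks with probability at most
`2^{-m}`. -/
theorem card_checks_mul_le (hm : m ≤ n) {x : Bits n} (hx : x ≠ 0) :
    Nat.card {u : Fin m → Bits n // LinearIndependent (ZMod 2) u ∧ ∀ i, u i ⬝ᵥ x = 0} * 2 ^ m ≤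
      Nat.card {u : Fin m → Bits n // LinearIndependent (ZMod 2) u} := by
  set f : Bits n →ₗ[ZMod 2] ZMod 2 := dotProductBilin (ZMod 2) (ZMod 2) x with hf
  have hfa : ∀ k, f k = x ⬝ᵥ k := fun k => rfl
  have hf0 : f ≠ 0 := by
    intro h
    apply hx
    ext i
    have := congrArg (fun g : Bits n →ₗ[ZMod 2] ZMod 2 => g (Pi.single i 1)) h
    simpa [hfa] using this
  -- Checks passed by `x` lie in a hyperplane, with `∏ (2^(n-1) - 2^i)` independent families. Factor
  -- by factor, `2(2^(n-1) - 2^i) = 2^n - 2^(i+1) ≤ 2^n - 2^i`.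
  set H := LinearMap.ker f with hH
  have hrank : Module.finrank (ZMod 2) H + 1 = n := by
    have := Module.Dual.finrank_ker_add_one_of_ne_zero (f := f) hf0
    simpa using this
  have hle : Nat.card {u : Fin m → Bits n // LinearIndependent (ZMod 2) u ∧ ∀ i, u i ⬝ᵥ x = 0} ≤
      Nat.card {v : Fin m → H // LinearIndependent (ZMod 2) v} := by
    refine Nat.card_le_card_of_injective
      (fun u => ⟨fun i => ⟨u.1 i, by
        rw [hH, LinearMap.mem_ker, hfa, dotProduct_comm]; exact u.2.2 i⟩,
        LinearIndependent.of_comp H.subtype u.2.1⟩) ?_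
    intro u u' h
    apply Subtype.ext
    funext i
    have := congrFun (Subtype.ext_iff.1 h) i
    exact Subtype.ext_iff.1 this
  refine (Nat.mul_le_mul_right _ hle).trans ?_
  by_cases hmn : m ≤ Module.finrank (ZMod 2) H
  · rw [card_linearIndependent hmn, card_linearIndependent (by simpa using hm)]
    have hc : (2 : ℕ) ^ m = ∏ _i : Fin m, 2 := by simp
    rw [hc, ← Finset.prod_mul_distrib]
    refine Finset.prod_le_prod' fun i _ => ?_
    rw [ZMod.card, Module.finrank_fin_fun, Nat.sub_mul, ← pow_succ, hrank, ← pow_succ]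
    exact Nat.sub_le_sub_left (Nat.pow_le_pow_right (by norm_num) (Nat.le_succ _)) _
  · have : IsEmpty {v : Fin m → H // LinearIndependent (ZMod 2) v} := by
      refine ⟨fun v => hmn ?_⟩
      have := v.2.fintype_card_le_finrank
      simpa using this
    simp

/-- The Markov inequality for the total weight of the nonzero strings passing random parity checks. -/
theorem card_good_checks_ge (hm : m ≤ n) {t : Bits n → ℝ} (ht : ∀ x, 0 ≤ t x) {z : ℝ} (hz : 0 < z)
    (hsum : ∑ x, t x ≤ 2 ^ m * z ^ 2) :
    (1 - z) * (Nat.card {u : Fin m → Bits n // LinearIndependent (ZMod 2) u} : ℝ) ≤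
      (Nat.card {u : Fin m → Bits n // LinearIndependent (ZMod 2) u ∧
        ∀ s : Finset (Bits n), (∀ x ∈ s, x ≠ 0 ∧ ∀ i, u i ⬝ᵥ x = 0) → ∑ x ∈ s, t x ≤ z} : ℝ) := by
  classical
  set Z : (Fin m → Bits n) → ℝ := fun u =>
    ∑ x, if x ≠ 0 ∧ ∀ i, u i ⬝ᵥ x = 0 then t x else 0 with hZ
  have hZ0 : ∀ u, 0 ≤ Z u := fun u => Finset.sum_nonneg fun x _ => by
    split_ifs
    · exact ht x
    · exact le_rfl
  set L : Finset (Fin m → Bits n) := Finset.univ.filter fun u => LinearIndependent (ZMod 2) u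
  have hL : Nat.card {u : Fin m → Bits n // LinearIndependent (ZMod 2) u} = L.card := by
    rw [Nat.card_eq_fintype_card, Fintype.card_subtype]
  -- A mean of at most `z²` makes the threshold `z` fail with probability at most `z`.
  have hmean : ∑ u ∈ L, Z u ≤ z ^ 2 * L.card := by
    rw [hZ, Finset.sum_comm]
    have h1 : ∀ x, (∑ u ∈ L, if x ≠ 0 ∧ ∀ i, u i ⬝ᵥ x = 0 then t x else 0) ≤
        t x * (L.card / 2 ^ m) := by
      intro x
      by_cases hx : x = 0
      · simp only [hx, ne_eq, not_true, false_and, if_false, Finset.sum_const_zero]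
        exact mul_nonneg (ht _) (by positivity)
      have h2 := card_checks_mul_le hm hx
      rw [hL, Nat.card_eq_fintype_card, Fintype.card_subtype] at h2
      have h3 : (∑ u ∈ L, if x ≠ 0 ∧ ∀ i, u i ⬝ᵥ x = 0 then t x else 0) =
          t x * (Finset.univ.filter fun u : Fin m → Bits n =>
            LinearIndependent (ZMod 2) u ∧ ∀ i, u i ⬝ᵥ x = 0).card := by
        simp only [hx, ne_eq, not_false_eq_true, true_and]
        rw [← Finset.sum_filter, Finset.filter_filter, Finset.sum_const, nsmul_eq_mul, mul_comm]
      rw [h3]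
      refine mul_le_mul_of_nonneg_left ?_ (ht x)
      rw [le_div_iff₀ (by positivity)]
      exact_mod_cast h2
    refine (Finset.sum_le_sum fun x _ => h1 x).trans ?_
    rw [← Finset.sum_mul]
    calc (∑ x, t x) * (L.card / 2 ^ m : ℝ) ≤ (2 ^ m * z ^ 2) * (L.card / 2 ^ m : ℝ) := by gcongr
      _ = _ := by field_simp
  have hbad : ((L.filter fun u => ¬ Z u ≤ z).card : ℝ) ≤ z * L.card := by
    have h4 : z * ((L.filter fun u => ¬ Z u ≤ z).card : ℝ) ≤ ∑ u ∈ L, Z u := by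
      calc z * ((L.filter fun u => ¬ Z u ≤ z).card : ℝ) =
            ∑ u ∈ L.filter fun u => ¬ Z u ≤ z, z := by
              rw [Finset.sum_const, nsmul_eq_mul, mul_comm]
        _ ≤ ∑ u ∈ L.filter fun u => ¬ Z u ≤ z, Z u :=
              Finset.sum_le_sum fun u hu => (not_le.1 (Finset.mem_filter.1 hu).2).le
        _ ≤ _ := Finset.sum_le_sum_of_subset_of_nonneg (Finset.filter_subset _ _)
              fun u _ _ => hZ0 u
    have h5 : z * ((L.filter fun u => ¬ Z u ≤ z).card : ℝ) ≤ z * (z * L.card) := by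
      refine (h4.trans hmean).trans (le_of_eq (by ring))
    exact le_of_mul_le_mul_left h5 hz
  have hsplit := Finset.card_filter_add_card_filter_not (s := L) (fun u => Z u ≤ z)
  have hsplit' : ((L.filter fun u => Z u ≤ z).card : ℝ) + (L.filter fun u => ¬ Z u ≤ z).card =
      L.card := by exact_mod_cast hsplit
  -- One event bounds every set of strings passing the checks, so it serves all completions `c` of
  -- the same `u` at once.
  have hgood : (L.filter fun u => Z u ≤ z).card ≤
      Nat.card {u : Fin m → Bits n // LinearIndependent (ZMod 2) u ∧
        ∀ s : Finset (Bits n), (∀ x ∈ s, x ≠ 0 ∧ ∀ i, u i ⬝ᵥ x = 0) → ∑ x ∈ s, t x ≤ z} := by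
    rw [Nat.card_eq_fintype_card, Fintype.card_subtype]
    refine Finset.card_le_card fun u hu => ?_
    rw [Finset.mem_filter, Finset.mem_filter] at hu
    refine Finset.mem_filter.2 ⟨Finset.mem_univ _, hu.1.2, fun s hs => le_trans ?_ hu.2⟩
    rw [hZ]
    calc ∑ x ∈ s, t x = ∑ x ∈ s, if x ≠ 0 ∧ ∀ i, u i ⬝ᵥ x = 0 then t x else 0 :=
          Finset.sum_congr rfl fun x hx => (if_pos (hs x hx)).symm
      _ ≤ _ := Finset.sum_le_sum_of_subset_of_nonneg (Finset.subset_univ _) fun x _ _ => by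
          split_ifs
          · exact ht x
          · exact le_rfl
  rw [hL]
  have : ((L.filter fun u => Z u ≤ z).card : ℝ) ≤ _ := Nat.cast_le.2 hgood
  linarith

end Counting

/-! ### Performance of the protocol -/

section Protocol

variable {S E : Type*} [Fintype S] [DecidableEq S] [Fintype E] [DecidableEq E] {n r m : ℕ}

theorem isProj_submatrix {ι κ : Type*} [Fintype ι] [Fintype κ] (e : κ ≃ ι) {P : Matrix ι ι ℂ}
    (hP : IsProj P) : IsProj (P.submatrix e e) :=
  ⟨hP.1.submatrix e, by rw [Matrix.submatrix_mul_equiv, hP.2]⟩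

theorem trace_submatrix_mul_submatrix {ι κ : Type*} [Fintype ι] [Fintype κ] (e : κ ≃ ι)
    (A B : Matrix ι ι ℂ) : (A.submatrix e e * B.submatrix e e).trace = (A * B).trace := by
  rw [Matrix.submatrix_mul_equiv, trace_submatrix_equiv]

/-- The conclusions of the protocol from a bound `z` on the overlaps with the other codewords. -/
theorem goodHash_of_overlap_le {φ : ZMod 2 → S × E → ℂ} (hφ : ∀ k, IsNormalized (φ k)) {δ ε e z : ℝ}
    {u : Fin m → Bits n}
    (hrank : (zeroTypical φ n δ).rank ≤ Fintype.card (Bits m × (Fin n → S)) ∨ r = 0)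
    (hz : ∀ c : Bits n ≃ₗ[ZMod 2] Bits r × Bits m, (∀ i, c.symm (0, Pi.single i 1) = u i) →
      ∑ y ∈ Finset.univ.erase 0, overlap φ n δ (codeword c y) ≤ z)
    (he : 6 * (tensorPow n (avgState φ) * (1 - avgTypical φ n δ)).trace.re +
      4 * (tensorPow n (ensemble φ 0) * (1 - zeroTypical φ n δ)).trace.re + 4 * z ≤ e)
    (he0 : 0 < e) (he1 : e < 1 / 2) (heε : e ≤ ε) (hsε : 2 * √e ≤ ε) :
    GoodHash φ r δ ε u := by
  intro c hc h
  set g := regEquiv S c with hg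
  set P := (avgTypical φ n δ).submatrix g g with hPdef
  set N := (zeroTypical φ n δ).submatrix g g with hNdef
  have hP : IsProj P := isProj_submatrix g (isProj_avgTypical φ δ)
  have hN : IsProj N := isProj_submatrix g (isProj_zeroTypical φ δ)
  have hPc : ∀ y : Bits r, phaseOp (Bits m × (Fin n → S)) y * P *
      phaseOp (Bits m × (Fin n → S)) y = P := by
    intro y
    rw [phaseOp_eq_submatrix c, hPdef, Matrix.submatrix_mul_equiv, Matrix.submatrix_mul_equiv,
      zOp_conj_avgTypical]
  have hη := codeVec_mul_conjTranspose φ c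
  set σ := codeVec φ c * (codeVec φ c)ᴴ with hσ
  have hσp : σ.PosSemidef := Matrix.posSemidef_self_mul_conjTranspose _
  have hσ1 : σ.trace = 1 := trace_codeVec hφ c
  have hone : (1 : Matrix (Bits r × Bits m × (Fin n → S)) (Bits r × Bits m × (Fin n → S)) ℂ) =
      (1 : Matrix (Fin n → ZMod 2 × S) (Fin n → ZMod 2 × S) ℂ).submatrix g g := by
    rw [Matrix.submatrix_one_equiv]
  have herr := one_sub_trace_prettyGood_le hP hN hσp hσ1
  have ha : (σ * (1 - P)).trace =
      (tensorPow n (avgState φ) * (1 - avgTypical φ n δ)).trace := by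
    rw [← trace_zero_mul_one_sub_avgTypical, ← trace_submatrix_mul_submatrix g, ← hη,
      hPdef, hone]
    rfl
  have hb : (σ * (1 - N)).trace =
      (tensorPow n (ensemble φ 0) * (1 - zeroTypical φ n δ)).trace := by
    rw [← trace_submatrix_mul_submatrix g, ← hη, hNdef, hone]
    rfl
  have ht : ∀ y, (σ * covariantFamily P N y).trace.re = overlap φ n δ (codeword c y) := by
    intro y
    rw [overlap, ← trace_submatrix_mul_submatrix g, ← hη, covariantFamily, phaseOp_eq_submatrix c,
      hPdef, hNdef]
    simp only [← hg, Matrix.submatrix_mul_equiv]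
  simp only [ha, hb, ht] at herr
  have hF : 1 - e ≤ (σ * prettyGood (covariantFamily P N) 0).trace.re := by
    have := hz c hc
    linarith
  have hbob := bobPGM_eq hφ c h δ
  rw [← hg, ← hPdef, ← hNdef] at hbob
  rw [announced_eq hφ, hbob]
  -- For `r = 0` the key register is trivial, so the rank bound is automatic.
  obtain ⟨V, hV⟩ := exists_untwists (prettyGood_covariant hP hN hPc)
    (posSemidef_prettyGood_covariant hP hN 0) (isProj_sum_prettyGood hP hN) (by
      rcases hrank with hrank | rfl
      · refine rank_prettyGood_covariant_le.trans ?_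
        rw [hNdef, Matrix.rank_submatrix]
        exact hrank
      · refine (Matrix.rank_le_card_width _).trans ?_
        rw [Fintype.card_prod]
        simp)
  have hη1 : ((codeVec φ c)ᴴ * codeVec φ c).trace.re = 1 := by
    rw [Matrix.trace_mul_comm, ← hσ, hσ1, Complex.one_re]
  obtain ⟨ξ, hξ, hγ, hclose⟩ := exists_close_privateState hV (isProj_sum_prettyGood hP hN) hη1 he1 hF
  have hD : 0 < 2 * √e := by positivity
  have hD2 : 4 * e = (2 * √e) ^ 2 := by rw [mul_pow, Real.sq_sqrt he0.le]; norm_num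
  rw [hD2] at hclose
  have hΨ := isNormalized_sharedKey_codeVec hφ c
  refine ⟨?_, ⟨V, ξ, hV, hξ, ?_⟩, ?_⟩
  · simp only [codeState_eq hφ]
    rw [sum_trace_prettyGood_covariant hP hN hPc]
    linarith
  · have := isClosePrivate_of_close hΨ hγ hD hclose
    rw [IsClosePrivate] at this ⊢
    linarith
  · obtain ⟨ρE, h1, h2, h3⟩ := isEpsPrivate_of_close hV.1 hξ hΨ hγ hD hclose
    exact ⟨ρE, h1, h2, by linarith⟩

end Protocol

/-! ### Rates below the Holevo quantity -/

section Rate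

variable {S E : Type*} [Fintype S] [DecidableEq S] [Fintype E] [DecidableEq E] {n r : ℕ}

/-- As `S(ρ) ≤ log dim BS`, the rate condition gives `2^{n(s+δ)} · 2^r ≤ (dim BS)^n`, and the shield
has dimension `(dim BS)^n / 2^r`. This is what the untwisting operator requires. -/
theorem rank_zeroTypical_le {φ : ZMod 2 → S × E → ℂ} (hφ : ∀ k, IsNormalized (φ k)) {δ : ℝ}
    (hδ : 0 ≤ δ) (hrn : r ≤ n) (hr : (r : ℝ) ≤ n * (holevo (ensemble φ) - 3 * δ)) :
    (zeroTypical φ n δ).rank ≤ Fintype.card (Bits (n - r) × (Fin n → S)) := by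
  have h1 : ((zeroTypical φ n δ).rank : ℝ) ≤ 2 ^ (n * (entropy (ensemble φ 0) + δ)) :=
    rank_typicalProj_le n _ δ (posSemidef_tensorPow n (posSemidef_ensemble φ 0))
      (by rw [trace_tensorPow, trace_ensemble hφ, one_pow])
  have hS : Nonempty (ZMod 2 × S) := by
    by_contra hne
    rw [not_nonempty_iff] at hne
    have := trace_ensemble hφ 0
    simp [Matrix.trace] at this
  have hd : (0 : ℝ) < Fintype.card (ZMod 2 × S) := by exact_mod_cast Fintype.card_pos
  have h2 := entropy_le_logb_card (posSemidef_avgState φ) (trace_avgState hφ)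
  rw [holevo_ensemble] at hr
  have h3 : (2 : ℝ) ^ (n * (entropy (ensemble φ 0) + δ)) * 2 ^ r ≤
      (Fintype.card (ZMod 2 × S) : ℝ) ^ n := by
    rw [← Real.rpow_natCast 2 r, ← Real.rpow_add (by norm_num)]
    have hn : (0 : ℝ) ≤ n := Nat.cast_nonneg n
    calc (2 : ℝ) ^ (n * (entropy (ensemble φ 0) + δ) + r) ≤
          2 ^ (Real.logb 2 (Fintype.card (ZMod 2 × S)) * n) := by
            refine Real.rpow_le_rpow_of_exponent_le (by norm_num) ?_
            nlinarith [mul_le_mul_of_nonneg_left h2 hn, mul_nonneg hn hδ]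
      _ = _ := by
            rw [Real.rpow_mul (by norm_num), Real.rpow_logb (by norm_num) (by norm_num) hd,
              Real.rpow_natCast]
  have h4 : (Fintype.card (ZMod 2 × S) : ℝ) ^ n =
      (Fintype.card (Bits (n - r) × (Fin n → S)) : ℝ) * 2 ^ r := by
    rw [Fintype.card_prod, Fintype.card_prod, Fintype.card_fun, Fintype.card_fun, ZMod.card,
      Fintype.card_fin, Fintype.card_fin]
    push_cast
    rw [mul_pow, mul_right_comm, ← pow_add, Nat.sub_add_cancel hrn]
  rw [h4] at h3
  have h5 := le_of_mul_le_mul_right h3 (by positivity)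
  exact_mod_cast h1.trans h5

/-- For rates below the Holevo quantity, most hashes are good. -/
theorem card_goodHash_ge {φ : ZMod 2 → S × E → ℂ} (hφ : ∀ k, IsNormalized (φ k)) {δ ε e z : ℝ}
    (hδ : 0 ≤ δ) (hrn : r ≤ n) (hr : (r : ℝ) ≤ n * (holevo (ensemble φ) - 3 * δ) ∨ r = 0)
    (hz0 : 0 < z) (hz : (2 : ℝ) ^ (-(n * δ)) ≤ z ^ 2)
    (he : 6 * (tensorPow n (avgState φ) * (1 - avgTypical φ n δ)).trace.re +
      4 * (tensorPow n (ensemble φ 0) * (1 - zeroTypical φ n δ)).trace.re + 4 * z ≤ e)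
    (he0 : 0 < e) (he1 : e < 1 / 2) (heε : e ≤ ε) (hsε : 2 * √e ≤ ε) (hzε : z ≤ ε) :
    (1 - ε) * (Nat.card {u : Fin (n - r) → Bits n // LinearIndependent (ZMod 2) u} : ℝ) ≤
      (Nat.card {u : Fin (n - r) → Bits n // LinearIndependent (ZMod 2) u ∧
        GoodHash φ r δ ε u} : ℝ) := by
  rcases hr with hr | hr
  -- Exponents: `n + n(s+δ) - n(S-δ) = n - nχ + 2nδ ≤ (n-r) - nδ`.
  · have hsum : ∑ x : Bits n, overlap φ n δ x ≤ 2 ^ (n - r) * z ^ 2 := by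
      refine (sum_overlap_le φ δ hφ).trans ?_
      refine le_trans ?_ (mul_le_mul_of_nonneg_left hz (by positivity))
      rw [← Real.rpow_add (by norm_num), ← Real.rpow_natCast 2 n, ← Real.rpow_natCast 2 (n - r),
        ← Real.rpow_add (by norm_num), ← Real.rpow_add (by norm_num)]
      refine Real.rpow_le_rpow_of_exponent_le (by norm_num) ?_
      rw [Nat.cast_sub hrn]
      rw [holevo_ensemble] at hr
      linarith
    refine le_trans ?_ ((card_good_checks_ge (Nat.sub_le n r) (overlap_nonneg φ δ) hz0
      hsum).trans ?_)
    · gcongr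
    · refine Nat.cast_le.2 (Nat.card_mono (Set.toFinite _) fun u hu => ⟨hu.1, ?_⟩)
      refine goodHash_of_overlap_le hφ (Or.inl (rank_zeroTypical_le hφ hδ hrn hr))
        (fun c hc => ?_) he he0 he1 heε hsε
      rw [← Finset.sum_image (g := codeword c) (f := overlap φ n δ)
        (codeword_injective c).injOn]
      refine hu.2 _ fun x hx => ?_
      obtain ⟨y, hy, rfl⟩ := Finset.mem_image.1 hx
      refine ⟨fun h0 => ?_, fun i => by rw [← hc i]; exact codeword_check c y i⟩
      rw [← codeword_zero c] at h0
      exact (Finset.mem_erase.1 hy).1 (codeword_injective c h0)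
  -- With no key bits there is no competing codeword. This covers the case in which the floor
  -- defining `r` truncates a negative rate.
  · subst hr
    have hall : ∀ u : Fin (n - 0) → Bits n, GoodHash φ 0 δ ε u := fun u =>
      goodHash_of_overlap_le hφ (Or.inr rfl) (fun c _ => by
        rw [Finset.sum_eq_zero fun y hy =>
          absurd (Subsingleton.elim y 0) (Finset.mem_erase.1 hy).1]
        exact hz0.le) he he0 he1 heε hsε
    simp only [hall, and_true]
    have : 0 ≤ ε := hz0.le.trans hzε
    refine mul_le_of_le_one_left (Nat.cast_nonneg _) (by linarith)

end Rate

/-! ### Convergence of the rate -/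

section Asymptotics

open Filter Topology

theorem tendsto_succ_rpow_neg {a : ℝ} (ha : 0 < a) :
    Tendsto (fun n : ℕ => ((n : ℝ) + 1) ^ (-a)) atTop (𝓝 0) :=
  (tendsto_rpow_neg_atTop ha).comp
    (tendsto_atTop_add_const_right _ _ tendsto_natCast_atTop_atTop)

theorem tendsto_floor_div {χ : ℝ} (h0 : 0 ≤ χ) {δ : ℕ → ℝ} (hδ0 : ∀ n, 0 ≤ δ n)
    (hδ : Tendsto δ atTop (𝓝 0)) :
    Tendsto (fun n : ℕ => (⌊(n : ℝ) * (χ - 3 * δ n)⌋₊ : ℝ) / n) atTop (𝓝 χ) := by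
  have hlow : Tendsto (fun n : ℕ => χ - 3 * δ n - 1 / (n : ℝ)) atTop (𝓝 χ) := by
    have := ((tendsto_const_nhds (x := χ)).sub (hδ.const_mul 3)).sub
      (tendsto_one_div_atTop_nhds_zero_nat (𝕜 := ℝ))
    simpa using this
  refine tendsto_of_tendsto_of_tendsto_of_le_of_le' hlow tendsto_const_nhds ?_ ?_
  · filter_upwards [eventually_gt_atTop 0] with n hn
    have hn' : (0 : ℝ) < n := by exact_mod_cast hn
    rw [le_div_iff₀ hn']
    have := (Nat.lt_floor_add_one ((n : ℝ) * (χ - 3 * δ n))).le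
    have e : (χ - 3 * δ n - 1 / (n : ℝ)) * n = n * (χ - 3 * δ n) - 1 := by field_simp
    linarith
  · filter_upwards [eventually_gt_atTop 0] with n hn
    have hn' : (0 : ℝ) < n := by exact_mod_cast hn
    rw [div_le_iff₀ hn']
    have h1 : ⌊(n : ℝ) * (χ - 3 * δ n)⌋₊ ≤ ⌊χ * n⌋₊ := Nat.floor_mono (by nlinarith [hδ0 n])
    exact (Nat.cast_le.2 h1).trans (Nat.floor_le (by positivity))

end Asymptotics

end PrivateState

/-! ### Choice of the parameters -/

open PrivateState Filter Topology

theorem theorem4 {S E : Type*} [Fintype S] [DecidableEq S] [Fintype E] [DecidableEq E]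
    (φ : ZMod 2 → S × E → ℂ) (hφ : ∀ k, PrivateState.IsNormalized (φ k)) :
    ∃ (r : ℕ → ℕ) (δ ε : ℕ → ℝ),
      (∀ n, r n ≤ n) ∧
      Filter.Tendsto (fun n => (r n : ℝ) / n) Filter.atTop
        (nhds (PrivateState.holevo (PrivateState.ensemble φ))) ∧
      (∀ n, 0 < δ n) ∧ Filter.Tendsto δ Filter.atTop (nhds 0) ∧
      Filter.Tendsto ε Filter.atTop (nhds 0) ∧
      ∀ n, (1 - ε n) *
          (Nat.card {u : Fin (n - r n) → PrivateState.Bits n // LinearIndependent (ZMod 2) u} : ℝ) ≤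
        (Nat.card {u : Fin (n - r n) → PrivateState.Bits n // LinearIndependent (ZMod 2) u ∧
          PrivateState.GoodHash φ (r n) (δ n) (ε n) u} : ℝ) := by
  obtain ⟨C, hC, hCb⟩ := exists_typical_bound (posSemidef_avgState φ) (trace_avgState hφ)
  obtain ⟨C', hC', hCb'⟩ := exists_typical_bound (posSemidef_ensemble φ 0) (trace_ensemble hφ 0)
  set χ := holevo (ensemble φ) with hχ
  have hχ0 : 0 ≤ χ := holevo_nonneg (posSemidef_ensemble φ)
  have hχ1 : χ ≤ 1 := holevo_le_one (posSemidef_ensemble φ) (trace_ensemble hφ)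
  -- `δ = (n+1)^(-1/4)`, `w = (n+1)^(-1/2) = δ²`
  set δ : ℕ → ℝ := fun n => ((n : ℝ) + 1) ^ (-(1 / 4 : ℝ)) with hδdef
  set w : ℕ → ℝ := fun n => ((n : ℝ) + 1) ^ (-(1 / 2 : ℝ)) with hwdef
  have hδ0 : ∀ n, 0 < δ n := fun n => by positivity
  have hw0 : ∀ n, 0 < w n := fun n => by positivity
  have hδ : Tendsto δ atTop (𝓝 0) := tendsto_succ_rpow_neg (by norm_num)
  have hw : Tendsto w atTop (𝓝 0) := tendsto_succ_rpow_neg (by norm_num)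
  have hδw : ∀ n, δ n ^ 2 = w n := fun n => by
    rw [hδdef, hwdef, ← Real.rpow_natCast, ← Real.rpow_mul (by positivity)]
    norm_num
  have hww : ∀ n, w n * w n * ((n : ℝ) + 1) = 1 := fun n => by
    have hp : (0 : ℝ) < (n : ℝ) + 1 := by positivity
    rw [hwdef, ← Real.rpow_add hp, ← Real.rpow_add_one hp.ne']
    norm_num
  have hδ1 : ∀ n, δ n ≤ 1 := fun n =>
    Real.rpow_le_one_of_one_le_of_nonpos (by linarith [(Nat.cast_nonneg n : (0 : ℝ) ≤ n)])
      (by norm_num)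
  -- Chosen so that `z² = 2^{-1/(2w)}`, which dominates `2^{-nδ}` for `n ≥ 1` because `nδ ≥ nw ≥
  -- 1/(2w)`.
  set z : ℕ → ℝ := fun n => (2 : ℝ) ^ (-(1 / (4 * w n))) with hzdef
  have hz0 : ∀ n, 0 < z n := fun n => by positivity
  have hz : Tendsto z atTop (𝓝 0) := by
    have h1 : Tendsto (fun n => (4 * w n)⁻¹) atTop atTop := by
      refine tendsto_inv_nhdsGT_zero.comp (tendsto_nhdsWithin_iff.2 ⟨?_, ?_⟩)
      · simpa using hw.const_mul 4
      · exact Eventually.of_forall fun n => by have := hw0 n; simpa using this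
    have h2 := (tendsto_rpow_atTop_of_base_lt_one (2⁻¹ : ℝ) (by norm_num) (by norm_num)).comp h1
    refine h2.congr fun n => ?_
    rw [Function.comp_apply, Real.inv_rpow (by norm_num), ← Real.rpow_neg (by norm_num), hzdef]
    simp only [one_div]
  -- For `n ≥ 1`, `nw² = n/(n+1) ≥ 1/2`, so the Chebyshev bounds `C/(nδ²)` are at most `2Cw`; the
  -- weights 6 and 4 give 12 and 8.
  set e : ℕ → ℝ := fun n => (12 * C + 8 * C') * w n + 4 * z n with hedef
  have he0 : ∀ n, 0 < e n := fun n => by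
    have := hz0 n
    have := hw0 n
    positivity
  have he : Tendsto e atTop (𝓝 0) := by
    have := (hw.const_mul (12 * C + 8 * C')).add (hz.const_mul 4)
    simpa using this
  -- The sum dominates the decoding error `e`, the distance `2√e` and the Markov probability `z`.
  -- The value 1 at `n = 0`, where Chebyshev is not available, makes the claim trivial there.
  set ε : ℕ → ℝ := fun n => if n = 0 then 1 else e n + 2 * √(e n) + z n with hεdef
  have hε : Tendsto ε atTop (𝓝 0) := by
    have h1 : Tendsto (fun n => e n + 2 * √(e n) + z n) atTop (𝓝 0) := by
      have := (he.add ((he.sqrt).const_mul 2)).add hz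
      simpa using this
    refine h1.congr' ?_
    filter_upwards [eventually_ne_atTop 0] with n hn
    simp [hεdef, hn]
  have hrn : ∀ n : ℕ, ⌊(n : ℝ) * (χ - 3 * δ n)⌋₊ ≤ n := fun n => by
    refine Nat.floor_le_of_le ?_
    have hn : (0 : ℝ) ≤ n := Nat.cast_nonneg n
    nlinarith [hδ0 n]
  refine ⟨fun n => ⌊(n : ℝ) * (χ - 3 * δ n)⌋₊, δ, ε, hrn,
    tendsto_floor_div hχ0 (fun n => (hδ0 n).le) hδ, hδ0, hδ, hε, fun n => ?_⟩
  -- If `ε n ≥ 1` nothing is to be shown; otherwise `e n + 2√(e n) < 1` yields the condition `e n <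
  -- 1/2`.
  by_cases hε1 : 1 ≤ ε n
  · exact (mul_nonpos_of_nonpos_of_nonneg (by linarith) (Nat.cast_nonneg _)).trans
      (Nat.cast_nonneg _)
  have hn : n ≠ 0 := by
    rintro rfl
    simp [hεdef] at hε1
  have hεn : ε n = e n + 2 * √(e n) + z n := by simp [hεdef, hn]
  have hn' : (1 : ℝ) ≤ n := by exact_mod_cast Nat.one_le_iff_ne_zero.2 hn
  have hwn : 1 / (2 * w n) ≤ n * w n := by
    rw [div_le_iff₀ (by have := hw0 n; positivity)]
    nlinarith [hww n, mul_pos (hw0 n) (hw0 n)]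
  have hbound : ∀ B : ℝ, 0 ≤ B → B / (n * δ n ^ 2) ≤ 2 * B * w n := fun B hB => by
    have := hw0 n
    rw [hδw, div_le_iff₀ (by positivity)]
    have h1 : 1 ≤ 2 * w n * (n * w n) := by
      rw [div_le_iff₀ (by positivity)] at hwn
      linarith
    nlinarith
  have hsqrt : 0 ≤ √(e n) := Real.sqrt_nonneg _
  have hsq : √(e n) ^ 2 = e n := Real.sq_sqrt (he0 n).le
  have hzn := hz0 n
  have hen := he0 n
  rw [not_le, hεn] at hε1
  refine card_goodHash_ge hφ (e := e n) (z := z n) (hδ0 n).le (hrn n) ?_ hzn ?_ ?_ hen ?_ ?_ ?_ ?_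
  · by_cases h : 0 ≤ (n : ℝ) * (χ - 3 * δ n)
    · exact Or.inl (Nat.floor_le h)
    · exact Or.inr (Nat.floor_of_nonpos (not_le.1 h).le)
  · rw [hzdef, ← Real.rpow_natCast, ← Real.rpow_mul (by norm_num)]
    refine Real.rpow_le_rpow_of_exponent_le (by norm_num) ?_
    have h1 : n * w n ≤ n * δ n := by
      rw [← hδw]
      have := hδ1 n
      have := hδ0 n
      gcongr
      nlinarith
    have h2 : 1 / (4 * w n) * 2 = 1 / (2 * w n) := by
      have := (hw0 n).ne'
      field_simp; norm_num
    push_cast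
    linarith
  · have h1 := hCb n (δ n) (Nat.pos_of_ne_zero hn) (hδ0 n)
    have h2 := hCb' n (δ n) (Nat.pos_of_ne_zero hn) (hδ0 n)
    have h3 := hbound C hC
    have h4 := hbound C' hC'
    change 6 * (tensorPow n (avgState φ) * (1 - typicalProj n (entropy (avgState φ)) (δ n)
      (tensorPow n (avgState φ)))).trace.re + 4 * (tensorPow n (ensemble φ 0) *
      (1 - typicalProj n (entropy (ensemble φ 0)) (δ n)
        (tensorPow n (ensemble φ 0)))).trace.re + 4 * z n ≤
      (12 * C + 8 * C') * w n + 4 * z n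
    linarith
  · nlinarith
  all_goals rw [hεn]; linarith
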